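/- Let $\sigma:\mathbb{R}\to\mathbb{R}$ be smooth, Lipschitz continuous and not a polynomial, and let $\Omega\subset\mathbb{R}^d$ be a bounded domain with Lipschitz boundary (a bounded open set, not necessarily connected, that near each of its boundary points is, in suitable orthonormal coordinates, the region strictly above the graph of a Lipschitz function). A \emph{neural network} is a feedforward network with activation function $\sigma$ and at least one hidden layer. A \emph{neural operator with general integral kernel} is a map of the form $\Psi=\mathcal{Q}\circ\mathcal{L}_L\circ\dots\circ\mathcal{L}_1\circ\mathcal{R}$, $L\ge 1$, sending $\mathbb{R}^k$-valued functions on $\Omega$ to $\mathbb{R}^{k'}$-valued functions on $\Omega$, where, for some channel dimension $d_c$, \[ \mathcal{R}(u)(x)=R(u(x),x),\qquad \mathcal{L}_\ell(v)(x)=\sigma\Big(W_\ell v(x)+b_\ell+\int_\Omega K_\ell(x,y)v(y)\,dy\Big),\qquad \mathcal{Q}(v)(x)=Q(v(x),x). \] Here $R:\mathbb{R}^k\times\mathbb{R}^d\to\mathbb{R}^{d_c}$ and $Q:\mathbb{R}^{d_c}\times\mathbb{R}^d\to\mathbb{R}^{k'}$ are neural networks, $W_\ell\in\mathbb{R}^{d_c\times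 d_c}$, $b_\ell\in\mathbb{R}^{d_c}$, $K_\ell:\overline\Omega\times\overline\Omega\to\mathbb{R}^{d_c\times d_c}$ is continuous, and $\sigma$ acts componentwise. Let $s,s'\ge 0$ be integers. Then neural operators with general integral kernel are universal in the following two settings. (1) Let $\Psi^\dagger:C^s(\overline\Omega;\mathbb{R}^k)\to C^{s'}(\overline\Omega;\mathbb{R}^{k'})$ be continuous and let $\mathsf{K}\subset C^s(\overline\Omega;\mathbb{R}^k)$ be compact. Then for every $\epsilon>0$ there is a neural operator $\Psi$ with general integral kernel that maps $C^s(\overline\Omega;\mathbb{R}^k)$ to $C^{s'}(\overline\Omega;\mathbb{R}^{k'})$ and satisfies \[ \sup_{u\in\mathsf{K}}\Vert\Psi^\dagger(u)-\Psi(u)\Vert_{C^{s'}}\le\epsilon . \] (2) Let $p,p'\in[1,\infty)$, let $\Psi^\dagger:W^{s,p}(\Omega;\mathbb{R}^k)\to W^{s',p'}(\Omega;\mathbb{R}^{k'})$ be continuous, and let $\mathsf{K}\subset W^{s,p}(\Omega;\mathbb{R}^k)$ be compact with $\sup_{u\in\mathsf{K}}\Vert u\Vert_{L^\infty}<\infty$.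 Then for every $\epsilon>0$ there is a neural operator $\Psi$ with general integral kernel that maps $W^{s,p}(\Omega;\mathbb{R}^k)$ to $W^{s',p'}(\Omega;\mathbb{R}^{k'})$ and satisfies \[ \sup_{u\in\mathsf{K}}\Vert\Psi^\dagger(u)-\Psi(u)\Vert_{W^{s',p'}}\le\epsilon . \] -/

import Mathlib

open scoped ContDiff Matrix RealInnerProductSpace
open MeasureTheory

noncomputable section

/-- Activation functions: smooth, Lipschitz continuous and not a polynomial. -/
structure IsActivation (σ : ℝ → ℝ) : Prop where
  smooth : ContDiff ℝ ∞ σ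
  lipschitz : ∃ C, LipschitzWith C σ
  nonpolynomial : ¬ ∃ P : Polynomial ℝ, ∀ t, σ t = P.eval t

/-- A bounded Lipschitz domain: a bounded open set which near each boundary point lies strictly
above the graph of a Lipschitz function, with respect to some direction `e`. -/
structure IsBoundedLipschitzDomain {d : ℕ} (Ω : Set (EuclideanSpace ℝ (Fin d))) : Prop where
  isOpen : IsOpen Ω
  isBounded : Bornology.IsBounded Ω
  lipschitz_boundary : ∀ z ∈ frontier Ω, ∃ (e : EuclideanSpace ℝ (Fin d)) (r : ℝ)
    (C : NNReal) (γ : (ℝ ∙ e)ᗮ → ℝ), ‖e‖ = 1 ∧ 0 < r ∧ LipschitzWith C γ ∧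
      ∀ x ∈ Metric.ball z r, x ∈ Ω ↔ γ ((ℝ ∙ e)ᗮ.orthogonalProjectionOnto x) < ⟪e, x⟫

/-! ### Function spaces -/

/-- Bounded continuous functions on `closure Ω` with values in the `n`-linear maps. -/
abbrev CJet {d : ℕ} (Ω : Set (EuclideanSpace ℝ (Fin d))) (k n : ℕ) : Type :=
  BoundedContinuousFunction (closure Ω)
    (EuclideanSpace ℝ (Fin d) [×n]→L[ℝ] EuclideanSpace ℝ (Fin k))

instance {d : ℕ} (Ω : Set (EuclideanSpace ℝ (Fin d))) (k n : ℕ) :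
    NormedAddCommGroup (CJet Ω k n) :=
  BoundedContinuousFunction.instNormedAddCommGroup

instance {d : ℕ} (Ω : Set (EuclideanSpace ℝ (Fin d))) (k n : ℕ) :
    AddCommGroup (CJet Ω k n) :=
  NormedAddCommGroup.toAddCommGroup

instance {d : ℕ} (Ω : Set (EuclideanSpace ℝ (Fin d))) (k n : ℕ) :
    AddCommMonoid (CJet Ω k n) :=
  AddCommGroup.toAddCommMonoid

instance {d : ℕ} (Ω : Set (EuclideanSpace ℝ (Fin d))) (k n : ℕ) :
    NormedSpace ℝ (CJet Ω k n) :=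
  BoundedContinuousFunction.instNormedSpace

instance {d : ℕ} (Ω : Set (EuclideanSpace ℝ (Fin d))) (k n : ℕ) :
    Module ℝ (CJet Ω k n) :=
  NormedSpace.toModule

/-- The space `C^s` of functions on the closure of `Ω` with values in `ℝᵏ`. An element is the
family `(u, Du, …, Dˢu)` of bounded continuous functions on `closure Ω` that extend the
derivatives of a function which is `s` times continuously differentiable in `Ω`. The norm
is `max_{n ≤ s} sup_x ‖Dⁿu(x)‖`. -/
def CSubmodule {d : ℕ} (Ω : Set (EuclideanSpace ℝ (Fin d))) (s k : ℕ) :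
    Submodule ℝ ((n : Fin (s + 1)) → CJet Ω k n) where
  carrier := {J | ∃ u : EuclideanSpace ℝ (Fin d) → EuclideanSpace ℝ (Fin k),
    (∀ x ∈ Ω, ContDiffAt ℝ s u x) ∧
    ∀ (n : Fin (s + 1)) (x : EuclideanSpace ℝ (Fin d)) (hx : x ∈ Ω),
      J n ⟨x, subset_closure hx⟩ = iteratedFDeriv ℝ n u x}
  add_mem' := by
    rintro J J' ⟨u, hu, hJ⟩ ⟨u', hu', hJ'⟩
    refine ⟨u + u', fun x hx => (hu x hx).add (hu' x hx), fun n x hx => ?_⟩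
    have hn : ((n : ℕ) : WithTop ℕ∞) ≤ s := by exact_mod_cast Nat.lt_succ_iff.mp n.2
    rw [iteratedFDeriv_add_apply ((hu x hx).of_le hn) ((hu' x hx).of_le hn), ← hJ n x hx, ← hJ' n x hx]
    rfl
  zero_mem' := by
    refine ⟨0, fun x _ => contDiffAt_const, fun n x hx => ?_⟩
    simp
  smul_mem' := by
    rintro c J ⟨u, hu, hJ⟩
    refine ⟨c • u, fun x hx => (hu x hx).const_smul c, fun n x hx => ?_⟩
    have hn : ((n : ℕ) : WithTop ℕ∞) ≤ s := by exact_mod_cast Nat.lt_succ_iff.mp n.2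
    rw [iteratedFDeriv_const_smul_apply ((hu x hx).of_le hn), ← hJ n x hx]
    rfl

/-- The normed space `C^s`. -/
def CSpace {d : ℕ} (Ω : Set (EuclideanSpace ℝ (Fin d))) (s k : ℕ) : Type :=
  CSubmodule Ω s k

instance {d : ℕ} (Ω : Set (EuclideanSpace ℝ (Fin d))) (s k : ℕ) :
    NormedAddCommGroup (CSpace Ω s k) :=
  inferInstanceAs (NormedAddCommGroup (CSubmodule Ω s k))

instance {d : ℕ} (Ω : Set (EuclideanSpace ℝ (Fin d))) (s k : ℕ) :
    NormedSpace ℝ (CSpace Ω s k) :=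
  inferInstanceAs (NormedSpace ℝ (CSubmodule Ω s k))

open Classical in
/-- The function `u` itself, with the irrelevant value `0` outside of `closure Ω`. -/
def CSpace.toFun {d s k : ℕ} {Ω : Set (EuclideanSpace ℝ (Fin d))} (u : CSpace Ω s k) :
    EuclideanSpace ℝ (Fin d) → EuclideanSpace ℝ (Fin k) :=
  fun x => if h : x ∈ closure Ω then u.1 0 ⟨x, h⟩ 0 else 0

/-- `g` is the `n`-th weak derivative of `u` in `Ω`, as a function whose values are `n`-linear
maps: for all directions `m₁, …, mₙ` and all test functions `φ` with compact support in `Ω`,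
`∫ φ g(m₁, …, mₙ) = (-1)ⁿ ∫ (∂_{m₁} ⋯ ∂_{mₙ} φ) u`. -/
def IsWeakDeriv {d k : ℕ} (Ω : Set (EuclideanSpace ℝ (Fin d))) (n : ℕ)
    (u : EuclideanSpace ℝ (Fin d) → EuclideanSpace ℝ (Fin k))
    (g : EuclideanSpace ℝ (Fin d) →
      (EuclideanSpace ℝ (Fin d) [×n]→L[ℝ] EuclideanSpace ℝ (Fin k))) : Prop :=
  ∀ φ : EuclideanSpace ℝ (Fin d) → ℝ, ContDiff ℝ ∞ φ → HasCompactSupport φ → tsupport φ ⊆ Ω →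
    ∀ m : Fin n → EuclideanSpace ℝ (Fin d),
      ∫ x in Ω, φ x • g x m = (-1 : ℝ) ^ n • ∫ x in Ω, iteratedFDeriv ℝ n φ x m • u x

theorem integrable_testFunction_smul_apply {d k n : ℕ} {Ω : Set (EuclideanSpace ℝ (Fin d))}
    {p : ENNReal} (hp : 1 ≤ p)
    (g : Lp (EuclideanSpace ℝ (Fin d) [×n]→L[ℝ] EuclideanSpace ℝ (Fin k)) p
      (volume.restrict Ω)) {φ : EuclideanSpace ℝ (Fin d) → ℝ} (hφ : Continuous φ)
    (hc : HasCompactSupport φ) (m : Fin n → EuclideanSpace ℝ (Fin d)) :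
    IntegrableOn (fun x => φ x • g x m) Ω := by
  have h1 : LocallyIntegrable g (volume.restrict Ω) := (Lp.memLp g).locallyIntegrable hp
  have h2 := h1.integrable_smul_left_of_hasCompactSupport hφ hc
  exact (ContinuousMultilinearMap.apply ℝ (fun _ : Fin n => EuclideanSpace ℝ (Fin d))
    (EuclideanSpace ℝ (Fin k)) m).integrable_comp h2

/-- `Lᵖ` functions on `Ω` with values in the `n`-linear maps. -/
abbrev LpJet {d : ℕ} (Ω : Set (EuclideanSpace ℝ (Fin d))) (p : ENNReal) (k n : ℕ) : Type :=
  Lp (EuclideanSpace ℝ (Fin d) [×n]→L[ℝ] EuclideanSpace ℝ (Fin k)) p (volume.restrict Ω)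

/-- The Sobolev space `W^{s,p}` of functions on `Ω` with values in `ℝᵏ`. An element is the
family `(u, Du, …, Dˢu)` of `Lᵖ` functions on `Ω` consisting of `u` and its weak derivatives.
The norm is `max_{n ≤ s} ‖Dⁿu‖_{Lᵖ}`. -/
def WSubmodule {d : ℕ} (Ω : Set (EuclideanSpace ℝ (Fin d))) (s : ℕ) (p : ENNReal)
    [hp : Fact (1 ≤ p)] (k : ℕ) : Submodule ℝ ((n : Fin (s + 1)) → LpJet Ω p k n) where
  carrier := {J | ∀ n : Fin (s + 1), IsWeakDeriv Ω n (fun x => J 0 x 0) (J n)}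
  add_mem' := by
    intro J J' hJ hJ' n φ h1 h2 h3 m
    have hD : Continuous (fun x => iteratedFDeriv ℝ n φ x m) :=
      (ContinuousMultilinearMap.apply ℝ _ ℝ m).continuous.comp
        (h1.continuous_iteratedFDeriv (by exact_mod_cast le_top))
    have hDc : HasCompactSupport (fun x => iteratedFDeriv ℝ n φ x m) :=
      (h2.iteratedFDeriv (𝕜 := ℝ) n).comp_left
        (g := fun T : EuclideanSpace ℝ (Fin d) [×(n : ℕ)]→L[ℝ] ℝ => T m) rfl
    have e1 : ∫ x in Ω, φ x • (J + J') n x m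
        = ∫ x in Ω, (φ x • J n x m + φ x • J' n x m) := by
      refine integral_congr_ae ?_
      filter_upwards [Lp.coeFn_add (J n) (J' n)] with x hx
      rw [Pi.add_apply, hx]
      simp
    have e2 : ∫ x in Ω, iteratedFDeriv ℝ n φ x m • (J + J') 0 x 0
        = ∫ x in Ω, (iteratedFDeriv ℝ n φ x m • J 0 x 0
          + iteratedFDeriv ℝ n φ x m • J' 0 x 0) := by
      refine integral_congr_ae ?_
      filter_upwards [Lp.coeFn_add (J 0) (J' 0)] with x hx
      rw [Pi.add_apply, hx, Pi.add_apply, add_apply, smul_add]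
    rw [e1, e2, integral_add, integral_add, hJ n φ h1 h2 h3 m, hJ' n φ h1 h2 h3 m, smul_add]
    · exact integrable_testFunction_smul_apply hp.out _ hD hDc _
    · exact integrable_testFunction_smul_apply hp.out _ hD hDc _
    · exact integrable_testFunction_smul_apply hp.out _ h1.continuous h2 _
    · exact integrable_testFunction_smul_apply hp.out _ h1.continuous h2 _
  zero_mem' := by
    intro n φ h1 h2 h3 m
    have e1 : ∫ x in Ω, φ x • ((0 : (n : Fin (s + 1)) → LpJet Ω p k n) n) x m
        = ∫ x in Ω, (0 : EuclideanSpace ℝ (Fin k)) := by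
      refine integral_congr_ae ?_
      filter_upwards [(Lp.coeFn_zero _ _ _ : ⇑(0 : LpJet Ω p k n) =ᵐ[_] 0)] with x hx
      rw [Pi.zero_apply, hx]
      simp
    have e2 : ∫ x in Ω, iteratedFDeriv ℝ n φ x m •
        ((0 : (n : Fin (s + 1)) → LpJet Ω p k n) 0) x 0
        = ∫ x in Ω, (0 : EuclideanSpace ℝ (Fin k)) := by
      refine integral_congr_ae ?_
      filter_upwards [(Lp.coeFn_zero _ _ _ :
        ⇑(0 : LpJet Ω p k ((0 : Fin (s + 1)) : ℕ)) =ᵐ[_] 0)] with x hx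
      rw [Pi.zero_apply, hx, Pi.zero_apply, zero_apply, smul_zero]
    rw [e1, e2]
    simp
  smul_mem' := by
    intro c J hJ n φ h1 h2 h3 m
    have e1 : ∫ x in Ω, φ x • (c • J) n x m = ∫ x in Ω, c • (φ x • J n x m) := by
      refine integral_congr_ae ?_
      filter_upwards [Lp.coeFn_smul c (J n)] with x hx
      rw [Pi.smul_apply, hx]
      simp [smul_comm c]
    have e2 : ∫ x in Ω, iteratedFDeriv ℝ n φ x m • (c • J) 0 x 0
        = ∫ x in Ω, c • (iteratedFDeriv ℝ n φ x m • J 0 x 0) := by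
      refine integral_congr_ae ?_
      filter_upwards [Lp.coeFn_smul c (J 0)] with x hx
      rw [Pi.smul_apply, hx, Pi.smul_apply, smul_apply, smul_comm]
    rw [e1, e2, integral_smul, integral_smul, hJ n φ h1 h2 h3 m, smul_comm]

/-- The normed space `W^{s,p}`. -/
def WSpace {d : ℕ} (Ω : Set (EuclideanSpace ℝ (Fin d))) (s : ℕ) (p : ENNReal) [Fact (1 ≤ p)]
    (k : ℕ) : Type :=
  WSubmodule Ω s p k

instance {d : ℕ} (Ω : Set (EuclideanSpace ℝ (Fin d))) (s : ℕ) (p : ENNReal) [Fact (1 ≤ p)]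
    (k : ℕ) : NormedAddCommGroup (WSpace Ω s p k) :=
  inferInstanceAs (NormedAddCommGroup (WSubmodule Ω s p k))

instance {d : ℕ} (Ω : Set (EuclideanSpace ℝ (Fin d))) (s : ℕ) (p : ENNReal) [Fact (1 ≤ p)]
    (k : ℕ) : NormedSpace ℝ (WSpace Ω s p k) :=
  inferInstanceAs (NormedSpace ℝ (WSubmodule Ω s p k))

/-- The function `u` itself (a representative, defined up to null sets of `Ω`). -/
def WSpace.toFun {d s k : ℕ} {Ω : Set (EuclideanSpace ℝ (Fin d))} {p : ENNReal}
    [Fact (1 ≤ p)] (u : WSpace Ω s p k) :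
    EuclideanSpace ℝ (Fin d) → EuclideanSpace ℝ (Fin k) :=
  fun x => u.1 0 x 0

/-! ### Neural networks and neural operators -/

/-- Feedforward neural networks `ℝᵐ → ℝⁿ` with at least one hidden layer. -/
inductive NeuralNet : ℕ → ℕ → Type
  /-- One hidden layer of width `h`: `x ↦ A₂ σ(A₁ x + b₁) + b₂`. -/
  | shallow {m h n : ℕ} (A₁ : Matrix (Fin h) (Fin m) ℝ) (b₁ : Fin h → ℝ)
      (A₂ : Matrix (Fin n) (Fin h) ℝ) (b₂ : Fin n → ℝ) : NeuralNet m n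
  /-- One more hidden layer of width `h` in front of a network: `x ↦ N(σ(A x + b))`. -/
  | deep {m h n : ℕ} (A : Matrix (Fin h) (Fin m) ℝ) (b : Fin h → ℝ)
      (N : NeuralNet h n) : NeuralNet m n

/-- The function computed by a neural network with activation function `σ`. -/
def NeuralNet.eval (σ : ℝ → ℝ) : {m n : ℕ} → NeuralNet m n → (Fin m → ℝ) → (Fin n → ℝ)
  | _, _, .shallow A₁ b₁ A₂ b₂, x => A₂ *ᵥ (fun i => σ ((A₁ *ᵥ x + b₁) i)) + b₂
  | _, _, .deep A b N, x => N.eval σ (fun i => σ ((A *ᵥ x + b) i))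

/-- The parameters of a hidden layer with `c` channels: a matrix `W`, a bias `b` and a continuous
matrix-valued integral kernel. -/
structure KernelLayer {d : ℕ} (Ω : Set (EuclideanSpace ℝ (Fin d))) (c : ℕ) where
  W : Matrix (Fin c) (Fin c) ℝ
  b : Fin c → ℝ
  kernel : EuclideanSpace ℝ (Fin d) → EuclideanSpace ℝ (Fin d) → Matrix (Fin c) (Fin c) ℝ
  kernel_continuousOn :
    ContinuousOn (fun z : EuclideanSpace ℝ (Fin d) × EuclideanSpace ℝ (Fin d) =>
      kernel z.1 z.2) (closure Ω ×ˢ closure Ω)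

/-- The hidden layer `v ↦ σ(W v(x) + b + ∫_Ω K(x, y) v(y) dy)`, with `σ` acting componentwise.
When `Ω` is bounded, the kernel is bounded on `Ω × Ω`, so that the integral converges absolutely
for every integrable `v`, and the layer (with Lipschitz `σ`) preserves integrability on `Ω`. -/
def KernelLayer.eval {d c : ℕ} {Ω : Set (EuclideanSpace ℝ (Fin d))} (σ : ℝ → ℝ)
    (ℓ : KernelLayer Ω c) (v : EuclideanSpace ℝ (Fin d) → (Fin c → ℝ)) :
    EuclideanSpace ℝ (Fin d) → (Fin c → ℝ) :=
  fun x i => σ ((ℓ.W *ᵥ v x + ℓ.b + ∫ y in Ω, ℓ.kernel x y *ᵥ v y) i)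

/-- A neural operator with general integral kernels, mapping `ℝᵏ`-valued to `ℝᵏ'`-valued
functions on `Ω`: a lifting network `R`, one or more hidden layers, and a projection
network `Q`, where `R` and `Q` also receive the position `x` as an input. -/
structure KernelNeuralOperator {d : ℕ} (Ω : Set (EuclideanSpace ℝ (Fin d))) (k k' : ℕ) where
  channels : ℕ
  R : NeuralNet (k + d) channels
  layers : List (KernelLayer Ω channels)
  layers_ne_nil : layers ≠ []
  Q : NeuralNet (channels + d) k'

/-- The composition `Q ∘ ℒ_L ∘ ⋯ ∘ ℒ₁ ∘ R` (the head of the list of layers is `ℒ₁`). -/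
def KernelNeuralOperator.eval {d k k' : ℕ} {Ω : Set (EuclideanSpace ℝ (Fin d))} (σ : ℝ → ℝ)
    (N : KernelNeuralOperator Ω k k')
    (u : EuclideanSpace ℝ (Fin d) → EuclideanSpace ℝ (Fin k)) :
    EuclideanSpace ℝ (Fin d) → EuclideanSpace ℝ (Fin k') :=
  let v₀ : EuclideanSpace ℝ (Fin d) → (Fin N.channels → ℝ) :=
    fun x => N.R.eval σ (Fin.append (u x).ofLp x.ofLp)
  let v := N.layers.foldl (fun v ℓ => ℓ.eval σ v) v₀
  fun x => WithLp.toLp 2 (N.Q.eval σ (Fin.append (v x) x.ofLp))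

end

/-! The approximating operators have one hidden layer, with `W = 0` and a constant kernel. Up to the
activation, such a layer outputs finitely many numbers `λ_l(u) = ∫_Ω R_l(u(y), y) dy`, where the
`R_l` are outputs of a shallow network. The target map is first approximated by finite sums `∑
exp(λ_l(u)) exp⟪ξ_l, x⟫ a_l`. Exponentials are convenient because each product is the single ridge
function `exp(λ_l(u) + ⟪ξ_l, x⟫)` of the layer output and the position, which is what a shallow
projection network can imitate.

These sums are dense in the continuous maps from the compact set into the target space, by a tensor
product argument (`dense_span_smul`) with two factors. In the scalar factor
(`dense_span_exp_integral_comp_append`), the functionals `λ` form a vector space, so the span of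
their exponentials is an algebra and Stone–Weierstrass applies once the functionals separate points.
They do, because shallow networks approximate any continuous integrand uniformly on compact sets.
For functions with a common bound this yields all integrals against test functions
(`ae_eq_of_integral_comp_append_eq`). This is where the uniform bound on the compact set enters.

In the vector factor, exponentials `exp⟪ξ, x⟫ a` approximate smooth functions together with their
derivatives: replace a mollifier by an exponential sum and observe that convolution with an
exponential is again an exponential (`exists_exp_sum_iteratedFDeriv_near`). Smooth functions are
dense in `C^s` and `W^{s,p}` because a Lipschitz boundary allows functions to be shifted locally
across the boundary, the pieces being glued by a partition of unity (`denseRange_toCSpace`,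
`denseRange_toWSpace`).

For the realisation (`exists_kernelNeuralOperator_near_exp_sum`), the activation in the hidden layer
is undone by working at a small scale near a point where `deriv σ` is nonzero. The exponential is
replaced, with all derivatives up to the required order, by a combination of `σ (w t + b)`. The
latter exists because rescaled Taylor remainders of `σ` produce every monomial, `σ` not being a
polynomial (`exp_mem_ridgeClosure`). -/

/-! ### Approximation of univariate functions by ridge sums -/

/-- The linear span of the functions `t ↦ σ (w t + b)`. -/
def ridgeSpan (σ : ℝ → ℝ) : Submodule ℝ (ℝ → ℝ) :=
  Submodule.span ℝ (Set.range fun p : ℝ × ℝ => fun t => σ (p.1 * t + p.2))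

theorem contDiff_of_mem_ridgeSpan {σ : ℝ → ℝ} (hσ : ContDiff ℝ ∞ σ) {g : ℝ → ℝ}
    (hg : g ∈ ridgeSpan σ) : ContDiff ℝ ∞ g := by
  refine Submodule.span_induction ?_ ?_ ?_ ?_ hg
  · rintro _ ⟨p, rfl⟩
    exact hσ.comp ((contDiff_const.mul contDiff_id).add contDiff_const)
  · exact contDiff_const
  · intro f g _ _ hf hg
    exact hf.add hg
  · intro a f _ hf
    exact contDiff_const.smul hf

/-- Closure of the ridge sums in the topology of locally uniform convergence of all derivatives. -/
def ridgeClosure (σ : ℝ → ℝ) (hσ : ContDiff ℝ ∞ σ) : Submodule ℝ (ℝ → ℝ) where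
  carrier := {f | ContDiff ℝ ∞ f ∧ ∀ (m : ℕ) (M ε : ℝ), 0 < ε → ∃ g ∈ ridgeSpan σ,
    ∀ j ≤ m, ∀ t, |t| ≤ M → |iteratedDeriv j (f - g) t| ≤ ε}
  add_mem' := by
    rintro f f' ⟨hf, h⟩ ⟨hf', h'⟩
    refine ⟨hf.add hf', fun m M ε hε => ?_⟩
    obtain ⟨g, hg, hfg⟩ := h m M (ε / 2) (half_pos hε)
    obtain ⟨g', hg', hfg'⟩ := h' m M (ε / 2) (half_pos hε)
    refine ⟨g + g', Submodule.add_mem _ hg hg', fun j hj t ht => ?_⟩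
    have c1 : ContDiff ℝ ∞ (f - g) := hf.sub (contDiff_of_mem_ridgeSpan hσ hg)
    have c2 : ContDiff ℝ ∞ (f' - g') := hf'.sub (contDiff_of_mem_ridgeSpan hσ hg')
    have e : f + f' - (g + g') = (f - g) + (f' - g') := by abel
    rw [e, iteratedDeriv_add (c1.contDiffAt.of_le (by exact_mod_cast le_top))
      (c2.contDiffAt.of_le (by exact_mod_cast le_top))]
    calc _ ≤ _ := abs_add_le _ _
      _ ≤ ε / 2 + ε / 2 := add_le_add (hfg j hj t ht) (hfg' j hj t ht)
      _ = ε := by ring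
  zero_mem' := by
    refine ⟨contDiff_const, fun m M ε hε => ⟨0, Submodule.zero_mem _, fun j _ t _ => ?_⟩⟩
    have : (0 - 0 : ℝ → ℝ) = fun _ => 0 := by ext; simp
    rw [this, iteratedDeriv_const]
    simp [hε.le]
  smul_mem' := by
    rintro c f ⟨hf, h⟩
    refine ⟨contDiff_const.smul hf, fun m M ε hε => ?_⟩
    obtain ⟨g, hg, hfg⟩ := h m M (ε / (|c| + 1)) (by positivity)
    refine ⟨c • g, Submodule.smul_mem _ _ hg, fun j hj t ht => ?_⟩
    rw [← smul_sub, iteratedDeriv_const_smul_field, smul_eq_mul, abs_mul]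
    calc |c| * _ ≤ |c| * (ε / (|c| + 1)) := by gcongr; exact hfg j hj t ht
      _ ≤ (|c| + 1) * (ε / (|c| + 1)) := by gcongr; linarith
      _ = ε := by field_simp

/-- Closing twice gains nothing. This permits approximation in stages, with elements of the closure
such as monomials or Taylor sums as intermediate approximants. -/
theorem mem_ridgeClosure_of_forall_approx {σ : ℝ → ℝ} {hσ : ContDiff ℝ ∞ σ} {f : ℝ → ℝ}
    (hf : ContDiff ℝ ∞ f) (h : ∀ (m : ℕ) (M ε : ℝ), 0 < ε → ∃ g ∈ ridgeClosure σ hσ,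
      ∀ j ≤ m, ∀ t, |t| ≤ M → |iteratedDeriv j (f - g) t| ≤ ε) :
    f ∈ ridgeClosure σ hσ := by
  refine ⟨hf, fun m M ε hε => ?_⟩
  obtain ⟨g, hg, hfg⟩ := h m M (ε / 2) (half_pos hε)
  obtain ⟨g', hg', hgg'⟩ := hg.2 m M (ε / 2) (half_pos hε)
  refine ⟨g', hg', fun j hj t ht => ?_⟩
  have c1 : ContDiff ℝ ∞ (f - g) := hf.sub hg.1
  have c2 : ContDiff ℝ ∞ (g - g') := hg.1.sub (contDiff_of_mem_ridgeSpan hσ hg')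
  have e : f - g' = (f - g) + (g - g') := by abel
  rw [e, iteratedDeriv_add (c1.contDiffAt.of_le (by exact_mod_cast le_top))
    (c2.contDiffAt.of_le (by exact_mod_cast le_top))]
  calc _ ≤ _ := abs_add_le _ _
    _ ≤ ε / 2 + ε / 2 := add_le_add (hfg j hj t ht) (hgg' j hj t ht)
    _ = ε := by ring

theorem ridge_mem_ridgeClosure {σ : ℝ → ℝ} (hσ : ContDiff ℝ ∞ σ) (w b : ℝ) :
    (fun t => σ (w * t + b)) ∈ ridgeClosure σ hσ := by
  have hm : (fun t => σ (w * t + b)) ∈ ridgeSpan σ := Submodule.subset_span ⟨(w, b), rfl⟩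
  refine ⟨contDiff_of_mem_ridgeSpan hσ hm, fun m M ε hε => ⟨_, hm, fun j _ t _ => ?_⟩⟩
  rw [sub_self, show (0 : ℝ → ℝ) = fun _ => 0 from rfl, iteratedDeriv_const]
  simp [hε.le]

/-- A smooth function whose derivatives of order `< k` vanish at `0` is `O(|t| ^ k)`. -/
theorem abs_le_pow_of_iteratedDeriv_zero (k : ℕ) (M : ℝ) : ∀ g : ℝ → ℝ, ContDiff ℝ ∞ g →
    (∀ i < k, iteratedDeriv i g 0 = 0) → ∃ C, 0 ≤ C ∧ ∀ t, |t| ≤ M → |g t| ≤ C * |t| ^ k := by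
  induction k with
  | zero =>
    intro g hg _
    obtain ⟨C, hC⟩ := (isCompact_Icc (a := -M) (b := M)).exists_bound_of_continuousOn
      hg.continuous.continuousOn
    refine ⟨max C 0, le_max_right _ _, fun t ht => ?_⟩
    simpa using Or.inl (hC t (abs_le.1 ht))
  | succ k ih =>
    intro g hg h0
    have hg' : ContDiff ℝ ∞ (deriv g) := (contDiff_infty_iff_deriv.1 hg).2
    obtain ⟨C, hC0, hC⟩ := ih (deriv g) hg' fun i hi => by
      rw [← iteratedDeriv_succ']
      exact h0 (i + 1) (by omega)
    refine ⟨C, hC0, fun t ht => ?_⟩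
    have g0 : g 0 = 0 := by simpa using h0 0 (by omega)
    have key := (convex_Icc (-|t|) |t|).norm_image_sub_le_of_norm_deriv_le (f := g)
      (C := C * |t| ^ k) (x := 0) (y := t)
      (fun x _ => (hg.differentiable (by simp)) x) (fun x hx => ?_)
      (by simp) (by constructor <;> [exact neg_abs_le t; exact le_abs_self t])
    · rw [g0, sub_zero, sub_zero, Real.norm_eq_abs, Real.norm_eq_abs] at key
      rw [pow_succ]
      linarith
    · have hx' : |x| ≤ |t| := abs_le.2 hx
      calc |deriv g x| ≤ C * |x| ^ k := hC x (hx'.trans ht)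
        _ ≤ C * |t| ^ k := by gcongr

/-- Subtracting the Taylor polynomial kills the derivatives at `0`. -/
theorem iteratedDeriv_sub_taylor_zero {f : ℝ → ℝ} (hf : ContDiff ℝ ∞ f) (n i : ℕ) (hi : i < n) :
    iteratedDeriv i (fun s => f s - ∑ l ∈ Finset.range n,
      iteratedDeriv l f 0 / l.factorial * s ^ l) 0 = 0 := by
  have hp : ∀ l : ℕ, ContDiff ℝ ∞ (fun s : ℝ => iteratedDeriv l f 0 / l.factorial * s ^ l) :=
    fun l => contDiff_const.mul (contDiff_id.pow l)
  have e : (fun s => f s - ∑ l ∈ Finset.range n, iteratedDeriv l f 0 / l.factorial * s ^ l)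
    = f - fun s => ∑ l ∈ Finset.range n, iteratedDeriv l f 0 / l.factorial * s ^ l := rfl
  rw [e, iteratedDeriv_sub (hf.contDiffAt.of_le (by exact_mod_cast le_top))
    ((ContDiff.sum fun l _ => hp l).contDiffAt.of_le (by exact_mod_cast le_top)),
    iteratedDeriv_fun_sum (fun l _ => (hp l).contDiffAt.of_le (by exact_mod_cast le_top))]
  simp only [iteratedDeriv_const_mul_field, iteratedDeriv_fun_pow_zero]
  rw [Finset.sum_eq_single i]
  · have := Nat.factorial_ne_zero i
    simp
    field_simp
    simp
  · intro l _ hl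
    simp [hl.symm]
  · intro h
    exact absurd (Finset.mem_range.2 hi) h

/-- In the expansion of `σ (h t + b)` in powers of `h`, the lower monomials are available by
induction. After subtracting them and dividing by `h ^ n`, the monomial of degree `n` remains up to
an error `O(h)`, and this estimate survives differentiation in `t`. -/
theorem monomial_mem_ridgeClosure {σ : ℝ → ℝ} (hσ : ContDiff ℝ ∞ σ) (b : ℝ) (n : ℕ) :
    (fun t => iteratedDeriv n σ b * t ^ n) ∈ ridgeClosure σ hσ := by
  induction n using Nat.strong_induction_on with
  | _ n ih =>
  set f : ℝ → ℝ := fun s => σ (s + b) with hf_def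
  have hf : ContDiff ℝ ∞ f := hσ.comp (contDiff_id.add contDiff_const)
  have hfd : ∀ l, iteratedDeriv l f 0 = iteratedDeriv l σ b := fun l => by
    simp [hf_def, iteratedDeriv_comp_add_const]
  set g : ℝ → ℝ := fun s => f s - ∑ l ∈ Finset.range (n + 1),
      iteratedDeriv l f 0 / l.factorial * s ^ l with hg_def
  have hg : ContDiff ℝ ∞ g :=
    hf.sub (ContDiff.sum fun l _ => contDiff_const.mul (contDiff_id.pow l))
  suffices H : (fun t => iteratedDeriv n σ b / n.factorial * t ^ n) ∈ ridgeClosure σ hσ by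
    have := Submodule.smul_mem _ (n.factorial : ℝ) H
    convert this using 1
    ext t
    have := Nat.factorial_ne_zero n
    simp only [Pi.smul_apply, smul_eq_mul]
    field_simp
  refine mem_ridgeClosure_of_forall_approx (contDiff_const.mul (contDiff_id.pow n))
    fun m M ε hε => ?_
  have hC : ∀ j, ∃ C, 0 ≤ C ∧ ∀ t, |t| ≤ M → |iteratedDeriv j g t| ≤ C * |t| ^ (n + 1 - j) := by
    intro j
    refine abs_le_pow_of_iteratedDeriv_zero _ _ _ ?_ fun i hi => ?_
    · exact ContDiff.iterate_deriv j hg |> fun h => by rwa [iteratedDeriv_eq_iterate]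
    · rw [iteratedDeriv_eq_iterate, iteratedDeriv_eq_iterate, ← Function.iterate_add_apply,
        ← iteratedDeriv_eq_iterate]
      exact iteratedDeriv_sub_taylor_zero hf (n + 1) (i + j) (by omega)
  choose C hC0 hC using hC
  -- One constant dominating the remainder bounds for all orders `j ≤ m`, so that a single scale `h`
  -- serves for all of them.
  set D : ℝ := ∑ j ∈ Finset.range (m + 1), C j * |M| ^ (n + 1 - j) + ∑ j ∈ Finset.range (m + 1), C j
    with hD
  have hD0 : 0 ≤ D := by
    refine add_nonneg (Finset.sum_nonneg fun j _ => ?_) (Finset.sum_nonneg fun j _ => hC0 j)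
    exact mul_nonneg (hC0 j) (by positivity)
  obtain ⟨h, hh0, hh1, hhε⟩ : ∃ h : ℝ, 0 < h ∧ h ≤ 1 ∧ h * D ≤ ε := by
    refine ⟨min 1 (ε / (D + 1)), by positivity, min_le_left _ _, ?_⟩
    calc _ ≤ (ε / (D + 1)) * D := by gcongr; exact min_le_right _ _
      _ ≤ (ε / (D + 1)) * (D + 1) := by gcongr; linarith
      _ = ε := by field_simp
  refine ⟨(h ^ n)⁻¹ • ((fun t => σ (h * t + b)) - ∑ l ∈ Finset.range n,
    (h ^ l / l.factorial) • fun t => iteratedDeriv l σ b * t ^ l), ?_, fun j hj t ht => ?_⟩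
  · refine Submodule.smul_mem _ _ (Submodule.sub_mem _ (ridge_mem_ridgeClosure hσ h b)
      (Submodule.sum_mem _ fun l hl => Submodule.smul_mem _ _ (ih l (Finset.mem_range.1 hl))))
  · have e : ((fun t => iteratedDeriv n σ b / n.factorial * t ^ n) -
        (h ^ n)⁻¹ • ((fun t => σ (h * t + b)) - ∑ l ∈ Finset.range n,
        (h ^ l / l.factorial) • fun t => iteratedDeriv l σ b * t ^ l))
        = (-(h ^ n)⁻¹) • fun t => g (h * t) := by
      ext t
      simp only [hg_def, Finset.sum_range_succ, hfd, Pi.sub_apply, Pi.smul_apply,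
        smul_eq_mul, Finset.sum_apply]
      simp only [hf_def]
      have hs : ∑ l ∈ Finset.range n, h ^ l / l.factorial * (iteratedDeriv l σ b * t ^ l)
          = ∑ l ∈ Finset.range n, iteratedDeriv l σ b / l.factorial * (h * t) ^ l :=
        Finset.sum_congr rfl fun l _ => by rw [mul_pow]; ring
      rw [hs, mul_pow]
      field_simp
      ring
    rw [e, iteratedDeriv_const_smul_field, iteratedDeriv_comp_const_mul
      (hg.of_le (by exact_mod_cast le_top)), smul_eq_mul, abs_mul, abs_neg, abs_mul,
      abs_of_pos (inv_pos.2 (pow_pos hh0 n)), abs_of_pos (pow_pos hh0 j)]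
    have hM : |h * t| ≤ M := by
      rw [abs_mul, abs_of_pos hh0]
      nlinarith [abs_nonneg t]
    have hM' : |t| ≤ |M| := ht.trans (le_abs_self M)
    have hjm : j ∈ Finset.range (m + 1) := Finset.mem_range.2 (by omega)
    have b1 : C j * |M| ^ (n + 1 - j) ≤ D := by
      have := Finset.single_le_sum (f := fun j => C j * |M| ^ (n + 1 - j))
        (fun j _ => mul_nonneg (hC0 j) (by positivity)) hjm
      have := Finset.sum_nonneg fun j (_ : j ∈ Finset.range (m + 1)) => hC0 j
      linarith
    calc (h ^ n)⁻¹ * (h ^ j * |iteratedDeriv j g (h * t)|)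
        ≤ (h ^ n)⁻¹ * (h ^ j * (C j * |h * t| ^ (n + 1 - j))) := by
          gcongr; exact hC j _ hM
      _ = (h ^ n)⁻¹ * h ^ (j + (n + 1 - j)) * (C j * |t| ^ (n + 1 - j)) := by
          rw [abs_mul, abs_of_pos hh0, mul_pow, pow_add]; ring
      _ ≤ h * D := by
          -- The subtraction is truncated: for `j > n + 1` the remainder bound gives no power of
          -- `h`, but the chain rule factor `h ^ j` alone suffices.
          have h1 : h ^ (j + (n + 1 - j)) ≤ h ^ (n + 1) :=
            pow_le_pow_of_le_one hh0.le hh1 (by omega)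
          have h2 : C j * |t| ^ (n + 1 - j) ≤ D := le_trans (by have := hC0 j; gcongr) b1
          calc _ ≤ (h ^ n)⁻¹ * h ^ (n + 1) * D := by
                have := hC0 j
                gcongr
            _ = h * D := by rw [pow_succ]; field_simp
      _ ≤ ε := hhε

theorem exists_derivative_eq (P : Polynomial ℝ) : ∃ Q : Polynomial ℝ, Q.derivative = P := by
  induction P using Polynomial.induction_on' with
  | add P P' h h' =>
    obtain ⟨Q, rfl⟩ := h
    obtain ⟨Q', rfl⟩ := h'
    exact ⟨Q + Q', Polynomial.derivative_add⟩
  | monomial n a =>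
    refine ⟨Polynomial.monomial (n + 1) (a / (n + 1)), ?_⟩
    have : (n : ℝ) + 1 ≠ 0 := by positivity
    rw [Polynomial.derivative_monomial]
    simp [this]

theorem exists_polynomial_of_iteratedDeriv_eq_zero (n : ℕ) : ∀ f : ℝ → ℝ, ContDiff ℝ ∞ f →
    (∀ t, iteratedDeriv n f t = 0) → ∃ P : Polynomial ℝ, ∀ t, f t = P.eval t := by
  induction n with
  | zero => exact fun f _ h => ⟨0, by simpa using h⟩
  | succ n ih =>
    intro f hf h
    obtain ⟨P, hP⟩ := ih (deriv f) (contDiff_infty_iff_deriv.1 hf).2 fun t => by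
      rw [← iteratedDeriv_succ']
      exact h t
    obtain ⟨Q, rfl⟩ := exists_derivative_eq P
    have hd : Differentiable ℝ f := hf.differentiable (by simp)
    refine ⟨Q + Polynomial.C (f 0 - Q.eval 0), fun t => ?_⟩
    have := is_const_of_deriv_eq_zero (f := fun t => f t - Q.eval t)
      (hd.sub Q.differentiable) (fun t => by
        rw [deriv_fun_sub (hd t) Q.differentiable.differentiableAt, hP, Polynomial.deriv, sub_self])
      t 0
    simp only [Polynomial.eval_add, Polynomial.eval_C]
    linarith

/-- Some derivative value of each order is nonzero, since `σ` is not a polynomial, so all monomials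
lie in the closure. Differentiating a Taylor remainder of `exp` gives the preceding remainder, hence
locally uniform convergence of the series already controls every derivative. -/
theorem exp_mem_ridgeClosure {σ : ℝ → ℝ} (hσ : IsActivation σ) :
    Real.exp ∈ ridgeClosure σ hσ.smooth := by
  have hpow : ∀ n : ℕ, (fun t : ℝ => t ^ n) ∈ ridgeClosure σ hσ.smooth := by
    intro n
    obtain ⟨b, hb⟩ : ∃ b, iteratedDeriv n σ b ≠ 0 := by
      by_contra! h
      exact hσ.nonpolynomial (exists_polynomial_of_iteratedDeriv_eq_zero n σ hσ.smooth h)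
    convert Submodule.smul_mem _ (iteratedDeriv n σ b)⁻¹ (monomial_mem_ridgeClosure hσ.smooth b n)
      using 1
    ext t
    simp [hb]
  set S : ℕ → ℝ → ℝ := fun N => ∑ l ∈ Finset.range N, (l.factorial : ℝ)⁻¹ • fun t => t ^ l with hS
  have hSmem : ∀ N, S N ∈ ridgeClosure σ hσ.smooth := fun N =>
    Submodule.sum_mem _ fun l _ => Submodule.smul_mem _ _ (hpow l)
  have hder : ∀ N, deriv (Real.exp - S (N + 1)) = Real.exp - S N := by
    intro N
    ext t
    have h1 : HasDerivAt (S (N + 1)) (S N t) t := by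
      have := HasDerivAt.sum (u := Finset.range (N + 1))
        (A := fun l => (l.factorial : ℝ)⁻¹ • fun t : ℝ => t ^ l)
        (fun l _ => (hasDerivAt_pow l t).const_smul (l.factorial : ℝ)⁻¹)
      refine this.congr_deriv ?_
      rw [Finset.sum_range_succ']
      simp only [hS, Finset.sum_apply, Pi.smul_apply, smul_eq_mul]
      simp only [Nat.cast_zero, zero_mul, mul_zero, add_zero, Nat.add_sub_cancel]
      refine Finset.sum_congr rfl fun l _ => ?_
      rw [Nat.factorial_succ]
      have : (l.factorial : ℝ) ≠ 0 := by exact_mod_cast l.factorial_ne_zero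
      have : (l : ℝ) + 1 ≠ 0 := by positivity
      push_cast
      field_simp
    exact ((Real.hasDerivAt_exp t).sub h1).deriv
  have hiter : ∀ j N, iteratedDeriv j (Real.exp - S (N + j)) = Real.exp - S N := by
    intro j
    induction j with
    | zero => intro N; simp
    | succ j ih => intro N; rw [iteratedDeriv_succ', ← add_assoc, hder, ih]
  refine mem_ridgeClosure_of_forall_approx Real.contDiff_exp fun m M ε hε => ?_
  have hunif : ∃ N₀, ∀ N ≥ N₀, ∀ t, |t| ≤ M → |(Real.exp - S N) t| ≤ ε := by
    have h1 := tendstoUniformlyOn_tsum_nat (f := fun (l : ℕ) (t : ℝ) => t ^ l / l.factorial)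
      (s := Set.Icc (-M) M) (u := fun l => |M| ^ l / l.factorial)
      (Real.summable_pow_div_factorial |M|) (fun l t ht => by
        rw [norm_div, norm_pow, Real.norm_eq_abs, Real.norm_natCast]
        have := (abs_le.2 ht).trans (le_abs_self M)
        exact div_le_div_of_nonneg_right (pow_le_pow_left₀ (abs_nonneg t) this l) (by positivity))
    obtain ⟨N₀, hN₀⟩ := Filter.eventually_atTop.1 (Metric.tendstoUniformlyOn_iff.1 h1 ε hε)
    refine ⟨N₀, fun N hN t ht => ?_⟩
    have h2 := (hN₀ N hN t (abs_le.1 ht)).le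
    rw [Real.dist_eq] at h2
    rw [← congrFun NormedSpace.exp_eq_tsum_div t, ← Real.exp_eq_exp_ℝ] at h2
    refine le_of_eq_of_le ?_ h2
    simp only [hS, Pi.sub_apply, Finset.sum_apply, Pi.smul_apply, smul_eq_mul]
    congr 2
    exact Finset.sum_congr rfl fun l _ => by ring
  obtain ⟨N₀, hN₀⟩ := hunif
  -- The `m` extra terms make up for the loss of one term with each differentiation.
  refine ⟨S (N₀ + m), hSmem _, fun j hj t ht => ?_⟩
  rw [show N₀ + m = (N₀ + (m - j)) + j by omega, hiter]
  exact hN₀ _ (by omega) t ht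

/-! ### Density of exponential sums -/

/-- The exponentials of the elements of a vector space of continuous functions which separates
points span a dense subspace. -/
theorem exists_exp_sum_near {X : Type*} [TopologicalSpace X] (V : Submodule ℝ C(X, ℝ))
    (hV : ∀ x y : X, x ≠ y → ∃ l ∈ V, l x ≠ l y) (f : C(X, ℝ)) {K : Set X} (hK : IsCompact K)
    {ε : ℝ} (hε : 0 < ε) :
    ∃ (n : ℕ) (c : Fin n → ℝ) (l : Fin n → C(X, ℝ)), (∀ i, l i ∈ V) ∧
      ∀ x ∈ K, |∑ i, c i * Real.exp (l i x) - f x| ≤ ε := by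
  let S : Submonoid C(X, ℝ) :=
    { carrier := {g | ∃ l ∈ V, ∀ x, g x = Real.exp (l x)}
      one_mem' := ⟨0, V.zero_mem, fun x => by simp⟩
      mul_mem' := by
        rintro g g' ⟨l, hl, h⟩ ⟨l', hl', h'⟩
        exact ⟨l + l', V.add_mem hl hl', fun x => by simp [h, h', Real.exp_add]⟩ }
  have hA : (Algebra.adjoin ℝ (S : Set C(X, ℝ))).SeparatesPoints := by
    intro x y hxy
    obtain ⟨l, hl, hne⟩ := hV x y hxy
    refine ⟨_, ⟨(⟨Real.exp, Real.continuous_exp⟩ : C(ℝ, ℝ)).comp l,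
      Algebra.subset_adjoin ⟨l, hl, fun _ => rfl⟩, rfl⟩, ?_⟩
    simpa using hne
  obtain ⟨g, hg, hfg⟩ :=
    ContinuousMap.exists_mem_subalgebra_near_continuous_of_isCompact_of_separatesPoints hA f hK hε
  -- Products of exponentials of elements of `V` are again of this form, so the generated algebra is
  -- merely the linear span.
  rw [← Subalgebra.mem_toSubmodule, Algebra.adjoin_eq_span, Submonoid.closure_eq] at hg
  obtain ⟨n, c, s, hs⟩ := Submodule.mem_span_set'.1 hg
  choose l hl hexp using fun i => (s i).2
  refine ⟨n, c, l, hl, fun x hx => ?_⟩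
  have := (hfg x hx).le
  rw [← hs] at this
  simpa [hexp] using this

/-! ### Convolution and simultaneous approximation of derivatives. -/

section Convolution

open scoped Convolution

variable {E : Type} [NormedAddCommGroup E] [InnerProductSpace ℝ E] [FiniteDimensional ℝ E]
  [MeasurableSpace E] [BorelSpace E]

/-- All derivatives can be put on the smooth factor. Each induction step replaces `g` by `fderiv ℝ
g` and the pairing `L` by `L.precompR E`, which is why the spaces and the pairing are quantified
inside the induction. -/
theorem iteratedFDeriv_convolution_apply {F : Type} [NormedAddCommGroup F] [NormedSpace ℝ F]
    {f : E → F} (hf : LocallyIntegrable f volume) (n : ℕ) :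
    ∀ {G H : Type} [NormedAddCommGroup G] [NormedSpace ℝ G] [NormedAddCommGroup H]
      [NormedSpace ℝ H] (L : F →L[ℝ] G →L[ℝ] H) {g : E → G},
      HasCompactSupport g → ContDiff ℝ n g → ∀ (x : E) (m : Fin n → E),
      iteratedFDeriv ℝ n (f ⋆[L, volume] g) x m
        = ∫ y, L (f y) (iteratedFDeriv ℝ n g (x - y) m) := by
  induction n with
  | zero =>
    intro G H _ _ _ _ L g _ _ x m
    simp [convolution_def]
  | succ n ih =>
    intro G H _ _ _ _ L g hc hg x m
    have hg1 : ContDiff ℝ 1 g := hg.of_le (by norm_cast; omega)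
    have e : fderiv ℝ (f ⋆[L, volume] g) = f ⋆[L.precompR E, volume] fderiv ℝ g := by
      ext1 x
      exact (hc.hasFDerivAt_convolution_right L hf hg1 x).fderiv
    have hg' : ContDiff ℝ n (fderiv ℝ g) := hg.fderiv_right (by norm_cast)
    rw [iteratedFDeriv_succ_apply_right, e, ih (L.precompR E) (hc.fderiv ℝ) hg',
      ContinuousLinearMap.integral_apply]
    · congr 1
      ext y
      rw [iteratedFDeriv_succ_apply_right]
      rfl
    · have hcont : Continuous fun z => iteratedFDeriv ℝ n (fderiv ℝ g) z (Fin.init m) :=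
        (ContinuousMultilinearMap.apply ℝ (fun _ : Fin n => E) _ (Fin.init m)).continuous.comp
          (hg'.continuous_iteratedFDeriv le_rfl)
      have hsupp : HasCompactSupport fun z => iteratedFDeriv ℝ n (fderiv ℝ g) z (Fin.init m) :=
        ((hc.fderiv ℝ).iteratedFDeriv (𝕜 := ℝ) n).comp_left
          (g := fun T : E [×n]→L[ℝ] (E →L[ℝ] G) => T (Fin.init m)) rfl
      exact hsupp.convolutionExists_right (L.precompR E) hf hcont x

theorem iteratedFDeriv_lsmul_convolution {F : Type} [NormedAddCommGroup F] [NormedSpace ℝ F]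
    [CompleteSpace F] {P : E → ℝ} (hP : LocallyIntegrable P volume) {n : ℕ} {f : E → F}
    (hc : HasCompactSupport f) (hf : ContDiff ℝ n f) (x : E) :
    iteratedFDeriv ℝ n (P ⋆[ContinuousLinearMap.lsmul ℝ ℝ, volume] f) x
      = (P ⋆[ContinuousLinearMap.lsmul ℝ ℝ, volume] iteratedFDeriv ℝ n f) x := by
  ext m : 1
  rw [iteratedFDeriv_convolution_apply hP n _ hc hf, convolution_def]
  have h := (hc.iteratedFDeriv (𝕜 := ℝ) n).convolutionExists_right
    (ContinuousLinearMap.lsmul ℝ ℝ) hP (hf.continuous_iteratedFDeriv le_rfl) x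
  exact ContinuousLinearMap.integral_comp_comm
    (ContinuousMultilinearMap.apply ℝ (fun _ : Fin n => E) F m) h

/-- Exponential sums approximate compactly supported `C^m` functions together with their
derivatives. -/
theorem exists_exp_sum_iteratedFDeriv_near {F : Type} [NormedAddCommGroup F] [NormedSpace ℝ F]
    [CompleteSpace F] {m : ℕ} {f : E → F} (hc : HasCompactSupport f) (hf : ContDiff ℝ m f)
    {B : Set E} (hB : IsCompact B) {ε : ℝ} (hε : 0 < ε) :
    ∃ (n : ℕ) (ξ : Fin n → E) (a : Fin n → F), ∀ j ≤ m, ∀ x ∈ B,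
      ‖iteratedFDeriv ℝ j (f - fun x => ∑ i, Real.exp ⟪ξ i, x⟫ • a i) x‖ ≤ ε := by
  have hfj : ∀ j ≤ m, ContDiff ℝ j f := fun j hj => hf.of_le (by exact_mod_cast hj)
  have hcont : ∀ j ≤ m, Continuous (iteratedFDeriv ℝ j f) := fun j hj =>
    hf.continuous_iteratedFDeriv (by exact_mod_cast hj)
  have hcs : ∀ j, HasCompactSupport (iteratedFDeriv ℝ j f) := fun j => hc.iteratedFDeriv j
  obtain ⟨δ, hδ0, hδ⟩ : ∃ δ > 0, ∀ j ≤ m, ∀ x y, dist x y < δ →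
      dist (iteratedFDeriv ℝ j f x) (iteratedFDeriv ℝ j f y) ≤ ε / 2 := by
    have : ∀ j, ∃ δ > 0, j ≤ m → ∀ x y, dist x y < δ →
        dist (iteratedFDeriv ℝ j f x) (iteratedFDeriv ℝ j f y) ≤ ε / 2 := by
      intro j
      by_cases hj : j ≤ m
      · obtain ⟨δ, h0, h⟩ := Metric.uniformContinuous_iff.1
          ((hcs j).uniformContinuous_of_continuous (hcont j hj)) (ε / 2) (half_pos hε)
        exact ⟨δ, h0, fun _ x y hxy => (h hxy).le⟩
      · exact ⟨1, one_pos, fun h => absurd h hj⟩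
    choose δ h0 h using this
    refine ⟨(Finset.range (m + 1)).inf' ⟨0, by simp⟩ δ, ?_, fun j hj x y hxy => h j hj x y ?_⟩
    · exact (Finset.lt_inf'_iff _).2 fun i _ => h0 i
    · exact hxy.trans_le (Finset.inf'_le _ (Finset.mem_range.2 (by omega)))
  -- Mollification at the scale `δ` of the common modulus of continuity moves each derivative by at
  -- most `ε / 2`.
  let φ : ContDiffBump (0 : E) := ⟨δ / 2, δ, by positivity, by linarith⟩
  -- The tolerance for replacing the mollifier by an exponential sum: the resulting error in the
  -- `j`-th derivative is at most `η` times the `L¹` norm of that derivative.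
  obtain ⟨η, hη0, hη⟩ : ∃ η > 0, ∀ j ≤ m, η * ∫ y, ‖iteratedFDeriv ℝ j f y‖ ≤ ε / 2 := by
    set S := ∑ j ∈ Finset.range (m + 1), ∫ y, ‖iteratedFDeriv ℝ j f y‖
    have hS : 0 ≤ S := Finset.sum_nonneg fun j _ => integral_nonneg fun _ => norm_nonneg _
    refine ⟨ε / 2 / (S + 1), by positivity, fun j hj => ?_⟩
    have : ∫ y, ‖iteratedFDeriv ℝ j f y‖ ≤ S :=
      Finset.single_le_sum (f := fun j => ∫ y, ‖iteratedFDeriv ℝ j f y‖)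
        (fun j _ => integral_nonneg fun _ => norm_nonneg _) (Finset.mem_range.2 (by omega))
    calc _ ≤ ε / 2 / (S + 1) * (S + 1) := by gcongr; linarith
      _ = ε / 2 := by field_simp
  let ip : E →ₗ[ℝ] C(E, ℝ) :=
    { toFun := fun w => ⟨fun x => ⟪w, x⟫, by fun_prop⟩
      map_add' := fun w w' => by ext x; simp [inner_add_left]
      map_smul' := fun c w => by ext x; simp [inner_smul_left] }
  obtain ⟨n, c, l, hl, hφ⟩ := exists_exp_sum_near (LinearMap.range ip)
    (fun x y hxy => ⟨ip (x - y), ⟨x - y, rfl⟩, fun h => hxy (sub_eq_zero.1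
      (inner_self_eq_zero (𝕜 := ℝ).1 (by
        change ⟪x - y, x⟫ = ⟪x - y, y⟫ at h
        rw [inner_sub_right, h, sub_self])))⟩)
    (⟨φ.normed volume, φ.continuous_normed⟩ : C(E, ℝ))
    -- Only the values of the mollifier on the difference set of `B` and the support of `f` enter
    -- the convolution at points of `B`.
    ((hB.prod hc.isCompact).image continuous_sub) hη0
  choose ξ hξ using hl
  set P : E → ℝ := fun x => ∑ i, c i * Real.exp (l i x) with hPdef
  have hPc : Continuous P := by fun_prop
  have hPl : LocallyIntegrable P volume := hPc.locallyIntegrable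
  -- Since `exp⟪ξ, x - z⟫` factors, the convolution is an exponential sum in `x` whose coefficients
  -- are integrals of `f`.
  have hPf : (P ⋆[ContinuousLinearMap.lsmul ℝ ℝ, volume] f)
      = fun x => ∑ i, Real.exp ⟪ξ i, x⟫ • (c i • ∫ z, Real.exp (-⟪ξ i, z⟫) • f z) := by
    ext1 x
    have hgint : ∀ i, Integrable (fun z => Real.exp (-⟪ξ i, z⟫) • f z) := fun i =>
      Continuous.integrable_of_hasCompactSupport
        (by have := hf.continuous; fun_prop) hc.smul_left
    have e : ∀ y, P y • f (x - y) = ∑ i, (Real.exp ⟪ξ i, x⟫ * c i) •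
        (fun z => Real.exp (-⟪ξ i, z⟫) • f z) (x - y) := by
      intro y
      rw [hPdef, Finset.sum_smul]
      refine Finset.sum_congr rfl fun i _ => ?_
      rw [← hξ i]
      simp only [smul_smul]
      congr 1
      change c i * Real.exp ⟪ξ i, y⟫ = _
      rw [mul_comm (Real.exp _), mul_assoc, ← Real.exp_add, inner_sub_right]
      ring_nf
    rw [convolution_lsmul]
    simp_rw [e]
    rw [integral_finsetSum _ fun i _ =>
      ((hgint i).comp_sub_left x).fun_smul (Real.exp ⟪ξ i, x⟫ * c i)]
    refine Finset.sum_congr rfl fun i _ => ?_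
    rw [integral_smul, integral_sub_left_eq_self (fun z => Real.exp (-⟪ξ i, z⟫) • f z), mul_smul]
  refine ⟨n, ξ, fun i => c i • ∫ z, Real.exp (-⟪ξ i, z⟫) • f z, fun j hj x hx => ?_⟩
  have hPs : ContDiff ℝ m (P ⋆[ContinuousLinearMap.lsmul ℝ ℝ, volume] f) :=
    hc.contDiff_convolution_right (n := m) _ hPl hf
  rw [← hPf, iteratedFDeriv_sub_apply (hfj j hj).contDiffAt
    (hPs.of_le (by exact_mod_cast hj)).contDiffAt, iteratedFDeriv_lsmul_convolution hPl hc (hfj j hj)]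
  set h := iteratedFDeriv ℝ j f
  have hh := hcont j hj
  have hφl : LocallyIntegrable (φ.normed volume) volume := φ.continuous_normed.locallyIntegrable
  have d1 : dist ((φ.normed volume ⋆[ContinuousLinearMap.lsmul ℝ ℝ, volume] h) x) (h x) ≤ ε / 2 :=
    φ.dist_normed_convolution_le hh.aestronglyMeasurable fun y hy => hδ j hj y x hy
  have d2 : ‖(P ⋆[ContinuousLinearMap.lsmul ℝ ℝ, volume] h) x
      - (φ.normed volume ⋆[ContinuousLinearMap.lsmul ℝ ℝ, volume] h) x‖ ≤ ε / 2 := by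
    have i1 := (hcs j).convolutionExists_right (ContinuousLinearMap.lsmul ℝ ℝ) hPl hh x
    have i2 := (hcs j).convolutionExists_right (ContinuousLinearMap.lsmul ℝ ℝ) hφl hh x
    rw [convolution_def, convolution_def, ← integral_sub i1 i2]
    refine le_trans ?_ (hη j hj)
    rw [← integral_sub_left_eq_self (fun y => ‖h y‖) volume x, ← integral_const_mul]
    refine norm_integral_le_of_norm_le ?_ (Filter.Eventually.of_forall fun y => ?_)
    · exact ((hh.norm.integrable_of_hasCompactSupport (hcs j).norm).comp_sub_left x).const_mul _
    · simp only [ContinuousLinearMap.lsmul_apply]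
      rw [← sub_smul, norm_smul]
      by_cases hy : h (x - y) = 0
      · simp [show iteratedFDeriv ℝ j f (x - y) = 0 from hy, hy]
      · gcongr
        refine hφ y ⟨(x, x - y), ⟨hx, ?_⟩, sub_sub_cancel x y⟩
        exact support_iteratedFDeriv_subset (𝕜 := ℝ) j hy
  calc _ = ‖(h x - (φ.normed volume ⋆[ContinuousLinearMap.lsmul ℝ ℝ, volume] h) x) -
        ((P ⋆[ContinuousLinearMap.lsmul ℝ ℝ, volume] h) x
      - (φ.normed volume ⋆[ContinuousLinearMap.lsmul ℝ ℝ, volume] h) x)‖ := by congr 1; abel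
    _ ≤ _ := norm_sub_le _ _
    _ ≤ ε / 2 + ε / 2 := add_le_add (by rwa [← dist_eq_norm, dist_comm]) d2
    _ = ε := by ring

end Convolution

/-! ### Weak derivatives of smooth functions -/

section IntegrationByParts

variable {E : Type} [NormedAddCommGroup E] [NormedSpace ℝ E]
variable {F : Type} [NormedAddCommGroup F] [NormedSpace ℝ F]

theorem contDiff_iteratedFDeriv_apply {f : E → F} (hf : ContDiff ℝ ∞ f) {n : ℕ}
    (m : Fin n → E) : ContDiff ℝ ∞ fun x => iteratedFDeriv ℝ n f x m :=
  (ContinuousMultilinearMap.apply ℝ (fun _ : Fin n => E) F m).contDiff.comp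
    (hf.iteratedFDeriv_right (by exact_mod_cast le_rfl))

theorem iteratedFDeriv_succ_apply_eq_fderiv {f : E → F} (hf : ContDiff ℝ ∞ f) {n : ℕ} (x : E)
    (m : Fin (n + 1) → E) :
    iteratedFDeriv ℝ (n + 1) f x m
      = fderiv ℝ (fun y => iteratedFDeriv ℝ n f y (Fin.tail m)) x (m 0) := by
  have hd : DifferentiableAt ℝ (iteratedFDeriv ℝ n f) x :=
    (hf.differentiable_iteratedFDeriv (by exact_mod_cast WithTop.coe_lt_top _)) x
  have h := ((ContinuousMultilinearMap.apply ℝ (fun _ : Fin n => E) F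
    (Fin.tail m)).hasFDerivAt.comp x hd.hasFDerivAt).fderiv
  rw [iteratedFDeriv_succ_apply_left]
  exact (congrArg (fun T : E →L[ℝ] F => T (m 0)) h).symm

/-- A directional derivative commutes with the iterated derivative. -/
theorem iteratedFDeriv_fderiv_apply {f : E → F} (hf : ContDiff ℝ ∞ f) (v : E) (n : ℕ) :
    ∀ (x : E) (m : Fin n → E), iteratedFDeriv ℝ n (fun y => fderiv ℝ f y v) x m
      = fderiv ℝ (fun y => iteratedFDeriv ℝ n f y m) x v := by
  have hfv : ContDiff ℝ ∞ fun y => fderiv ℝ f y v :=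
    (hf.fderiv_right (by exact_mod_cast le_rfl)).clm_apply contDiff_const
  induction n with
  | zero => intro x m; simp
  | succ n ih =>
    intro x m
    rw [iteratedFDeriv_succ_apply_eq_fderiv hfv]
    simp_rw [ih, iteratedFDeriv_succ_apply_eq_fderiv hf]
    set h : E → F := fun y => iteratedFDeriv ℝ n f y (Fin.tail m)
    have hh : ContDiff ℝ ∞ h := contDiff_iteratedFDeriv_apply hf _
    have hh' : DifferentiableAt ℝ (fderiv ℝ h) x :=
      ((hh.fderiv_right (m := ∞) (by exact_mod_cast le_rfl)).differentiable (by simp)) x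
    have hsymm : IsSymmSndFDerivAt ℝ h x :=
      hh.contDiffAt.isSymmSndFDerivAt (by simpa using WithTop.coe_le_coe.2 (le_top : (2 : ℕ∞) ≤ ⊤))
    rw [fderiv_clm_apply hh' (differentiableAt_const _),
      fderiv_clm_apply hh' (differentiableAt_const _)]
    simpa using hsymm (m 0) v

variable [FiniteDimensional ℝ E] [MeasurableSpace E] [BorelSpace E]
  (μ : Measure E) [μ.IsAddHaarMeasure]

/-- Integration by parts in the direction `m 0`, then induction with the test function replaced by
its directional derivative. The outcome is a derivative of `φ` with the directions in a different
order, which `iteratedFDeriv_fderiv_apply` puts right. -/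
theorem integral_smul_iteratedFDeriv_apply {f : E → F} (hf : ContDiff ℝ ∞ f) (n : ℕ) :
    ∀ {φ : E → ℝ}, ContDiff ℝ ∞ φ → HasCompactSupport φ → ∀ m : Fin n → E,
      ∫ x, φ x • iteratedFDeriv ℝ n f x m ∂μ
        = (-1 : ℝ) ^ n • ∫ x, iteratedFDeriv ℝ n φ x m • f x ∂μ := by
  induction n with
  | zero => intro φ _ _ m; simp
  | succ n ih =>
    intro φ hφ hc m
    have hφ' : ContDiff ℝ ∞ fun y => fderiv ℝ φ y (m 0) :=
      (hφ.fderiv_right (by exact_mod_cast le_rfl)).clm_apply contDiff_const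
    have hc' : HasCompactSupport fun y => fderiv ℝ φ y (m 0) := hc.fderiv_apply ℝ (m 0)
    have hg : ContDiff ℝ ∞ fun y => iteratedFDeriv ℝ n f y (Fin.tail m) :=
      contDiff_iteratedFDeriv_apply hf _
    have hg' : Continuous fun y => fderiv ℝ (fun y => iteratedFDeriv ℝ n f y (Fin.tail m)) y (m 0) :=
      ((hg.fderiv_right (m := ∞) (by exact_mod_cast le_rfl)).clm_apply contDiff_const).continuous
    simp_rw [iteratedFDeriv_succ_apply_eq_fderiv hf, iteratedFDeriv_succ_apply_eq_fderiv hφ]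
    rw [integral_smul_fderiv_eq_neg_fderiv_smul_of_integrable, ih hφ' hc']
    · simp_rw [iteratedFDeriv_fderiv_apply hφ]
      rw [pow_succ, mul_neg_one, neg_smul]
    · exact (hφ'.continuous.smul hg.continuous).integrable_of_hasCompactSupport hc'.smul_right
    · exact (hφ.continuous.smul hg').integrable_of_hasCompactSupport hc.smul_right
    · exact (hφ.continuous.smul hg.continuous).integrable_of_hasCompactSupport hc.smul_right
    · exact fun x _ => hφ.differentiable (by simp) x
    · exact fun x _ => hg.differentiable (by simp) x

end IntegrationByParts

variable {d k s : ℕ} {Ω : Set (EuclideanSpace ℝ (Fin d))}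

theorem isWeakDeriv_iteratedFDeriv {f : EuclideanSpace ℝ (Fin d) → EuclideanSpace ℝ (Fin k)}
    (hf : ContDiff ℝ ∞ f) (n : ℕ) : IsWeakDeriv Ω n f (iteratedFDeriv ℝ n f) := by
  intro φ hφ hc hsub m
  rw [setIntegral_eq_integral_of_forall_compl_eq_zero,
    setIntegral_eq_integral_of_forall_compl_eq_zero,
    integral_smul_iteratedFDeriv_apply volume hf n hφ hc m]
  · intro x hx
    have : iteratedFDeriv ℝ n φ x = 0 := by
      by_contra h
      exact hx (hsub (support_iteratedFDeriv_subset (𝕜 := ℝ) n h))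
    simp [this]
  · intro x hx
    rw [image_eq_zero_of_notMem_tsupport fun h => hx (hsub h), zero_smul]

/-! ### Smooth functions as elements of `C^s` and `W^{s,p}` -/

/-- The vector space of smooth functions on `ℝᵈ`. -/
def SmoothFun (d k : ℕ) :
    Submodule ℝ (EuclideanSpace ℝ (Fin d) → EuclideanSpace ℝ (Fin k)) where
  carrier := {f | ContDiff ℝ ∞ f}
  add_mem' {f g} (hf : ContDiff ℝ ∞ f) (hg : ContDiff ℝ ∞ g) :=
    show ContDiff ℝ ∞ (f + g) from hf.add hg
  zero_mem' := show ContDiff ℝ ∞ fun _ => 0 from contDiff_const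
  smul_mem' c f (hf : ContDiff ℝ ∞ f) := show ContDiff ℝ ∞ (c • f) from hf.const_smul c

theorem SmoothFun.contDiff (f : SmoothFun d k) : ContDiff ℝ ∞ f.1 := f.2

theorem SmoothFun.iteratedFDeriv_add (f g : SmoothFun d k) (n : ℕ) (x : EuclideanSpace ℝ (Fin d)) :
    iteratedFDeriv ℝ n (f + g).1 x = iteratedFDeriv ℝ n f.1 x + iteratedFDeriv ℝ n g.1 x :=
  iteratedFDeriv_add_apply ((SmoothFun.contDiff f).contDiffAt.of_le (by exact_mod_cast le_top))
    ((SmoothFun.contDiff g).contDiffAt.of_le (by exact_mod_cast le_top))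

theorem SmoothFun.iteratedFDeriv_smul (c : ℝ) (f : SmoothFun d k) (n : ℕ)
    (x : EuclideanSpace ℝ (Fin d)) :
    iteratedFDeriv ℝ n (c • f).1 x = c • iteratedFDeriv ℝ n f.1 x :=
  iteratedFDeriv_const_smul_apply ((SmoothFun.contDiff f).contDiffAt.of_le (by exact_mod_cast le_top))

theorem SmoothFun.continuous_iteratedFDeriv (f : SmoothFun d k) (n : ℕ) :
    Continuous (iteratedFDeriv ℝ n f.1) :=
  (SmoothFun.contDiff f).continuous_iteratedFDeriv (by exact_mod_cast le_top)

theorem SmoothFun.exists_bound (hΩ : Bornology.IsBounded Ω) (f : SmoothFun d k) (n : ℕ) :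
    ∃ C, ∀ x ∈ closure Ω, ‖iteratedFDeriv ℝ n f.1 x‖ ≤ C :=
  hΩ.isCompact_closure.exists_bound_of_continuousOn (SmoothFun.continuous_iteratedFDeriv f n).continuousOn

/-- The restriction of a smooth function to `closure Ω`, as an element of `C^s`. -/
noncomputable def toCSpace (hΩ : Bornology.IsBounded Ω) (s : ℕ) :
    SmoothFun d k →ₗ[ℝ] CSpace Ω s k where
  toFun f := ⟨fun n => BoundedContinuousFunction.ofNormedAddCommGroup
      (fun x : closure Ω => iteratedFDeriv ℝ n f.1 x)
      ((SmoothFun.continuous_iteratedFDeriv f n).comp continuous_subtype_val)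
      (SmoothFun.exists_bound hΩ f n).choose (fun x => (SmoothFun.exists_bound hΩ f n).choose_spec x x.2),
    f.1, fun _ _ => (SmoothFun.contDiff f).contDiffAt.of_le (by exact_mod_cast le_top), fun _ _ _ => rfl⟩
  map_add' f g := by
    refine Subtype.ext (funext fun n => ?_)
    ext1 x
    exact SmoothFun.iteratedFDeriv_add f g n x
  map_smul' c f := by
    refine Subtype.ext (funext fun n => ?_)
    ext1 x
    exact SmoothFun.iteratedFDeriv_smul c f n x

theorem toFun_toCSpace (hΩ : Bornology.IsBounded Ω) (f : SmoothFun d k)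
    {x : EuclideanSpace ℝ (Fin d)} (hx : x ∈ closure Ω) : (toCSpace hΩ s f).toFun x = f.1 x := by
  rw [CSpace.toFun, dif_pos hx]
  rfl

/-! ### Basic properties of `C^s`. -/

/-- By continuity and density of `Ω` in its closure, the boundary contributes nothing to the
supremum. Hence all estimates can be made in `Ω`, where the jet consists of true derivatives. -/
theorem CSpace.norm_le (J : CSpace Ω s k) {B : ℝ} (hB : 0 ≤ B)
    (h : ∀ (n : Fin (s + 1)) (x : EuclideanSpace ℝ (Fin d)) (hx : x ∈ Ω),
      ‖J.1 n ⟨x, subset_closure hx⟩‖ ≤ B) : ‖J‖ ≤ B := by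
  change ‖J.1‖ ≤ B
  refine (pi_norm_le_iff_of_nonneg hB).2 fun n => ?_
  refine (BoundedContinuousFunction.norm_le hB).2 fun x => ?_
  have hd : Dense {y : closure Ω | (y : EuclideanSpace ℝ (Fin d)) ∈ Ω} := by
    intro y
    rw [closure_subtype]
    convert y.2
    ext z
    constructor
    · rintro ⟨y, hy, rfl⟩
      exact hy
    · exact fun hz => ⟨⟨z, subset_closure hz⟩, hz, rfl⟩
  have hc : IsClosed {y : closure Ω | ‖J.1 n y‖ ≤ B} :=
    isClosed_le (J.1 n).continuous.norm continuous_const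
  have hall := hd.closure_eq ▸ hc.closure_subset_iff.2
    (show {y : closure Ω | (y : EuclideanSpace ℝ (Fin d)) ∈ Ω} ⊆ _ from fun y hy => h n y hy)
  exact hall (Set.mem_univ x)

theorem CSpace.toFun_eq_apply (J : CSpace Ω s k) {x : EuclideanSpace ℝ (Fin d)} (hx : x ∈ closure Ω) :
    J.toFun x = J.1 0 ⟨x, hx⟩ 0 := by
  rw [CSpace.toFun, dif_pos hx]

theorem CSpace.ext_of_eqOn (hΩ : IsOpen Ω) (J J' : CSpace Ω s k)
    (h : Set.EqOn J.toFun J'.toFun Ω) : J = J' := by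
  have key : ∀ (n : Fin (s + 1)) (x : EuclideanSpace ℝ (Fin d)) (hx : x ∈ Ω),
      J.1 n ⟨x, subset_closure hx⟩ = J'.1 n ⟨x, subset_closure hx⟩ := by
    obtain ⟨u, -, hJ⟩ := J.2
    obtain ⟨u', -, hJ'⟩ := J'.2
    have huu : Set.EqOn u u' Ω := by
      intro x hx
      have := h hx
      rw [J.toFun_eq_apply (subset_closure hx), J'.toFun_eq_apply (subset_closure hx),
        hJ 0 x hx, hJ' 0 x hx] at this
      exact this
    intro n x hx
    rw [hJ n x hx, hJ' n x hx]
    exact (Filter.EventuallyEq.iteratedFDeriv ℝ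
      (huu.eventuallyEq_of_mem (hΩ.mem_nhds hx)) n).eq_of_nhds
  rw [← sub_eq_zero, ← norm_le_zero_iff]
  refine CSpace.norm_le _ le_rfl fun n x hx => ?_
  change ‖J.1 n ⟨x, _⟩ - J'.1 n ⟨x, _⟩‖ ≤ 0
  rw [key n x hx, sub_self, norm_zero]

theorem CSpace.norm_toFun_le (J : CSpace Ω s k) (x : EuclideanSpace ℝ (Fin d)) :
    ‖J.toFun x‖ ≤ ‖J‖ := by
  rw [CSpace.toFun]
  split_ifs with hx
  · calc ‖J.1 0 ⟨x, hx⟩ 0‖ ≤ ‖J.1 0 ⟨x, hx⟩‖ := by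
          refine ((J.1 0 ⟨x, hx⟩).le_opNorm 0).trans_eq ?_
          have : IsEmpty (Fin ((0 : Fin (s + 1)) : ℕ)) := inferInstanceAs (IsEmpty (Fin 0))
          have : (∏ i : Fin ((0 : Fin (s + 1)) : ℕ), ‖(0 : Fin ((0 : Fin (s + 1)) : ℕ) →
            EuclideanSpace ℝ (Fin d)) i‖) = 1 :=
            Finset.prod_of_isEmpty _
          rw [this, mul_one]
      _ ≤ ‖J.1 0‖ := (J.1 0).norm_coe_le_norm _
      _ ≤ ‖J.1‖ := norm_le_pi_norm J.1 0
  · simp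

theorem CSpace.toFun_sub (J J' : CSpace Ω s k) : (J - J').toFun = J.toFun - J'.toFun := by
  ext1 x
  simp only [CSpace.toFun, Pi.sub_apply]
  split_ifs
  · rfl
  · simp

theorem CSpace.continuousOn_toFun (J : CSpace Ω s k) : ContinuousOn J.toFun (closure Ω) := by
  rw [continuousOn_iff_continuous_domRestrict]
  have : (closure Ω).domRestrict J.toFun = fun x => J.1 0 x 0 := by
    ext1 x
    exact J.toFun_eq_apply x.2
  rw [this]
  exact (ContinuousMultilinearMap.apply ℝ (fun _ : Fin ((0 : Fin (s + 1)) : ℕ) =>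
    EuclideanSpace ℝ (Fin d)) (EuclideanSpace ℝ (Fin k)) 0).continuous.comp (J.1 0).continuous

/-! ### Basic properties of `W^{s,p}` -/

variable {d k s : ℕ} {Ω : Set (EuclideanSpace ℝ (Fin d))} {p : ENNReal}

theorem isFiniteMeasure_restrict_of_isBounded (hΩ : Bornology.IsBounded Ω) :
    IsFiniteMeasure (volume.restrict Ω : Measure (EuclideanSpace ℝ (Fin d))) :=
  ⟨by rw [Measure.restrict_apply_univ]; exact hΩ.measure_lt_top⟩

theorem exists_integral_norm_le_norm_Lp {F : Type*} [NormedAddCommGroup F]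
    [hp : Fact (1 ≤ p)] (hΩ : Bornology.IsBounded Ω) :
    ∃ C : ℝ, 0 ≤ C ∧ ∀ g : Lp F p (volume.restrict Ω), Integrable g (volume.restrict Ω) ∧
      ∫ x in Ω, ‖g x‖ ≤ C * ‖g‖ := by
  have := isFiniteMeasure_restrict_of_isBounded hΩ
  set c : ENNReal := (volume.restrict Ω) Set.univ ^ (1 / (1 : ENNReal).toReal - 1 / p.toReal)
  have hc : c ≠ ⊤ := by
    refine ENNReal.rpow_ne_top_of_nonneg ?_ (measure_ne_top _ _)
    rcases eq_or_ne p ⊤ with rfl | hpt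
    · simp
    · have : 1 ≤ p.toReal := by simpa using ENNReal.toReal_mono hpt hp.out
      have : 1 / p.toReal ≤ 1 := by rw [div_le_one (by linarith)]; exact this
      simpa using this
  refine ⟨c.toReal, ENNReal.toReal_nonneg, fun g => ?_⟩
  have hg := Lp.memLp g
  have hgint : Integrable g (volume.restrict Ω) := hg.integrable hp.out
  refine ⟨hgint, ?_⟩
  rw [integral_norm_eq_lintegral_enorm hgint.aestronglyMeasurable, ← eLpNorm_one_eq_lintegral_enorm,
    Lp.norm_def, mul_comm, ← ENNReal.toReal_mul]
  exact ENNReal.toReal_mono (ENNReal.mul_ne_top hg.2.ne hc)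
    (eLpNorm_le_eLpNorm_mul_rpow_measure_univ hp.out hg.1)

theorem continuous_integral_smul_apply [hp : Fact (1 ≤ p)] (hΩ : Bornology.IsBounded Ω) {n : ℕ}
    {φ : EuclideanSpace ℝ (Fin d) → ℝ} (hφ : Continuous φ) (hc : HasCompactSupport φ)
    (m : Fin n → EuclideanSpace ℝ (Fin d)) :
    Continuous fun g : LpJet Ω p k n => ∫ x in Ω, φ x • g x m := by
  obtain ⟨C, hC0, hC⟩ := exists_integral_norm_le_norm_Lp
    (F := EuclideanSpace ℝ (Fin d) [×n]→L[ℝ] EuclideanSpace ℝ (Fin k)) (p := p) hΩ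
  obtain ⟨B, hB⟩ := hc.exists_bound_of_continuous hφ
  have hB0 : 0 ≤ B := (norm_nonneg _).trans (hB 0)
  refine (LipschitzWith.of_dist_le' (K := B * (∏ i, ‖m i‖) * C) fun g g' => ?_).continuous
  rw [dist_eq_norm, dist_eq_norm, ← integral_sub
    (integrable_testFunction_smul_apply hp.out g hφ hc m)
    (integrable_testFunction_smul_apply hp.out g' hφ hc m)]
  calc _ ≤ ∫ x in Ω, B * (∏ i, ‖m i‖) * ‖(g - g') x‖ := by
        refine norm_integral_le_of_norm_le ((hC _).1.norm.const_mul _) ?_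
        filter_upwards [Lp.coeFn_sub g g'] with x hx
        rw [hx, ← smul_sub, norm_smul, Pi.sub_apply, ← sub_apply, mul_assoc,
          mul_comm (∏ i, ‖m i‖)]
        exact mul_le_mul (hB x) ((g x - g' x).le_opNorm m) (norm_nonneg _) hB0
    _ = B * (∏ i, ‖m i‖) * ∫ x in Ω, ‖(g - g') x‖ := integral_const_mul _ _
    _ ≤ B * (∏ i, ‖m i‖) * (C * ‖g - g'‖) := by gcongr; exact (hC _).2
    _ = _ := by ring

/-- For a fixed test function and fixed directions, both sides of the defining identity are
continuous in the `Lᵖ` jet. The resulting completeness of `W^{s,p}` supplies the limit in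
`denseRange_toWSpace`. -/
theorem isClosed_WSubmodule [hp : Fact (1 ≤ p)] (hΩ : Bornology.IsBounded Ω) :
    IsClosed (WSubmodule Ω s p k : Set ((n : Fin (s + 1)) → LpJet Ω p k n)) := by
  have : (WSubmodule Ω s p k : Set ((n : Fin (s + 1)) → LpJet Ω p k n)) =
      {J | ∀ n : Fin (s + 1), IsWeakDeriv Ω n (fun x => J 0 x 0) (J n)} := rfl
  rw [this]
  simp only [IsWeakDeriv, Set.ofPred_forall]
  refine isClosed_iInter fun n => isClosed_iInter fun φ => isClosed_iInter fun h1 =>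
    isClosed_iInter fun h2 => isClosed_iInter fun _ => isClosed_iInter fun m => ?_
  have hD : Continuous (fun x => iteratedFDeriv ℝ n φ x m) :=
    (contDiff_iteratedFDeriv_apply h1 m).continuous
  have hDc : HasCompactSupport (fun x => iteratedFDeriv ℝ n φ x m) :=
    (h2.iteratedFDeriv (𝕜 := ℝ) n).comp_left
      (g := fun T : EuclideanSpace ℝ (Fin d) [×(n : ℕ)]→L[ℝ] ℝ => T m) rfl
  refine isClosed_eq ?_ (Continuous.fun_const_smul ?_ _)
  · exact (continuous_integral_smul_apply hΩ h1.continuous h2 m).comp (continuous_apply n)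
  · exact (continuous_integral_smul_apply hΩ hD hDc _).comp (continuous_apply (0 : Fin (s + 1)))

theorem completeSpace_WSpace [hp : Fact (1 ≤ p)] (hΩ : Bornology.IsBounded Ω) :
    CompleteSpace (WSpace Ω s p k) :=
  (isClosed_WSubmodule (s := s) (k := k) (p := p) hΩ).completeSpace_coe

/-- Weak derivatives are unique. -/
theorem IsWeakDeriv.unique [hp : Fact (1 ≤ p)] (hΩ : IsOpen Ω) {n : ℕ}
    {u u' : EuclideanSpace ℝ (Fin d) → EuclideanSpace ℝ (Fin k)} {g g' : LpJet Ω p k n}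
    (hg : IsWeakDeriv Ω n u g) (hg' : IsWeakDeriv Ω n u' g')
    (h : u =ᵐ[volume.restrict Ω] u') : g = g' := by
  refine Lp.ext ?_
  have li : ∀ g : LpJet Ω p k n, LocallyIntegrableOn g Ω := fun g =>
    locallyIntegrableOn_of_locallyIntegrable_restrict ((Lp.memLp g).locallyIntegrable hp.out)
  have key := hΩ.ae_eq_zero_of_integral_contDiff_smul_eq_zero ((li g).sub (li g'))
    fun φ h1 h2 h3 => by
      have hi : ∀ g : LpJet Ω p k n, IntegrableOn (fun x => φ x • g x) Ω := fun g =>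
        ((Lp.memLp g).locallyIntegrable hp.out).integrable_smul_left_of_hasCompactSupport
          h1.continuous h2
      rw [← setIntegral_eq_integral_of_forall_compl_eq_zero (s := Ω) (fun x hx => by
        rw [image_eq_zero_of_notMem_tsupport fun h => hx (h3 h)]
        exact zero_smul ℝ (g x - g' x))]
      simp only [Pi.sub_apply, smul_sub]
      rw [integral_sub (hi _) (hi _), sub_eq_zero]
      ext m : 1
      have ev : ∀ g : LpJet Ω p k n, (∫ x in Ω, φ x • g x) m = ∫ x in Ω, φ x • g x m := fun g =>
        (ContinuousLinearMap.integral_comp_comm (ContinuousMultilinearMap.apply ℝ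
          (fun _ : Fin n => EuclideanSpace ℝ (Fin d)) (EuclideanSpace ℝ (Fin k)) m) (hi g)).symm
      rw [ev, ev, hg φ h1 h2 h3 m, hg' φ h1 h2 h3 m]
      congr 1
      refine integral_congr_ae ?_
      filter_upwards [h] with x hx
      rw [hx]
  rw [Filter.EventuallyEq, ae_restrict_iff' hΩ.measurableSet]
  filter_upwards [key] with x hx hxΩ
  exact sub_eq_zero.1 (hx hxΩ)

theorem WSpace.ext_of_ae_eq [hp : Fact (1 ≤ p)] (hΩ : IsOpen Ω) (J J' : WSpace Ω s p k)
    (h : J.toFun =ᵐ[volume.restrict Ω] J'.toFun) : J = J' :=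
  Subtype.ext (funext fun n => IsWeakDeriv.unique hΩ (J.2 n) (J'.2 n) h)

theorem SmoothFun.memLp (hΩ : Bornology.IsBounded Ω) (f : SmoothFun d k) (n : ℕ) :
    MemLp (iteratedFDeriv ℝ n f.1) p (volume.restrict Ω) := by
  have := isFiniteMeasure_restrict_of_isBounded hΩ
  obtain ⟨C, hC⟩ := SmoothFun.exists_bound hΩ f n
  refine MemLp.of_bound (SmoothFun.continuous_iteratedFDeriv f n).aestronglyMeasurable C ?_
  have h := ae_restrict_mem (μ := volume) (isClosed_closure (s := Ω)).measurableSet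
  filter_upwards [ae_mono (Measure.restrict_mono subset_closure le_rfl) h] with x hx
  exact hC x hx

/-- The restriction of a smooth function to `Ω`, as an element of `W^{s,p}`. -/
noncomputable def toWSpace (hΩ : Bornology.IsBounded Ω) (s : ℕ) (p : ENNReal)
    [Fact (1 ≤ p)] : SmoothFun d k →ₗ[ℝ] WSpace Ω s p k where
  toFun f := ⟨fun n => (SmoothFun.memLp hΩ f n).toLp _, fun n φ h1 h2 h3 m => by
    have e1 : ∫ x in Ω, φ x • ((SmoothFun.memLp (p := p) hΩ f n).toLp _ :
        LpJet Ω p k n) x m = ∫ x in Ω, φ x • iteratedFDeriv ℝ n f.1 x m := by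
      refine integral_congr_ae ?_
      filter_upwards [(SmoothFun.memLp (p := p) hΩ f n).coeFn_toLp] with x hx
      rw [hx]
    have e2 : ∫ x in Ω, iteratedFDeriv ℝ n φ x m • ((SmoothFun.memLp (p := p) hΩ f
        ((0 : Fin (s + 1)) : ℕ)).toLp _ : LpJet Ω p k ((0 : Fin (s + 1)) : ℕ)) x 0
        = ∫ x in Ω, iteratedFDeriv ℝ n φ x m • f.1 x := by
      refine integral_congr_ae ?_
      filter_upwards [(SmoothFun.memLp (p := p) hΩ f ((0 : Fin (s + 1)) : ℕ)).coeFn_toLp] with x hx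
      rw [hx]
      rfl
    rw [e1, e2]
    exact isWeakDeriv_iteratedFDeriv (SmoothFun.contDiff f) n φ h1 h2 h3 m⟩
  map_add' f g := by
    refine Subtype.ext (funext fun n => ?_)
    refine Eq.trans ?_ (MemLp.toLp_add (SmoothFun.memLp hΩ f n) (SmoothFun.memLp hΩ g n))
    exact MemLp.toLp_congr (SmoothFun.memLp hΩ (f + g) n)
      ((SmoothFun.memLp hΩ f n).add (SmoothFun.memLp hΩ g n))
      (.of_forall fun x => SmoothFun.iteratedFDeriv_add f g n x)
  map_smul' c f := by
    refine Subtype.ext (funext fun n => ?_)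
    refine Eq.trans ?_ (MemLp.toLp_const_smul c (SmoothFun.memLp hΩ f n))
    exact MemLp.toLp_congr (SmoothFun.memLp hΩ (c • f) n)
      ((SmoothFun.memLp hΩ f n).const_smul c)
      (.of_forall fun x => SmoothFun.iteratedFDeriv_smul c f n x)

theorem coeFn_toWSpace [Fact (1 ≤ p)] (hΩ : Bornology.IsBounded Ω) (f : SmoothFun d k)
    (n : Fin (s + 1)) :
    (toWSpace hΩ s p f).1 n =ᵐ[volume.restrict Ω] iteratedFDeriv ℝ n f.1 :=
  (SmoothFun.memLp hΩ f n).coeFn_toLp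

theorem toFun_toWSpace [Fact (1 ≤ p)] (hΩ : Bornology.IsBounded Ω) (f : SmoothFun d k) :
    (toWSpace hΩ s p f).toFun =ᵐ[volume.restrict Ω] f.1 := by
  filter_upwards [coeFn_toWSpace (s := s) (p := p) hΩ f 0] with x hx
  rw [WSpace.toFun, hx]
  rfl

/-! ### Cut-off functions and the partition of unity of a Lipschitz domain -/

section Cutoff

variable {E : Type} [NormedAddCommGroup E] [NormedSpace ℝ E]
variable {F : Type} [NormedAddCommGroup F] [NormedSpace ℝ F]

theorem exists_contDiff_cutoff [FiniteDimensional ℝ E] {K U : Set E} (hK : IsCompact K)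
    (hU : IsOpen U) (hKU : K ⊆ U) :
    ∃ ψ : E → ℝ, ContDiff ℝ ∞ ψ ∧ HasCompactSupport ψ ∧ tsupport ψ ⊆ U ∧
      ∀ x ∈ K, ∀ᶠ y in nhds x, ψ y = 1 := by
  have : ProperSpace E := FiniteDimensional.proper_rclike ℝ E
  obtain ⟨L, hL, hKL, hLU⟩ := exists_compact_between hK hU hKU
  obtain ⟨f, h1, h0, -⟩ := exists_contMDiffMap_one_nhds_of_subset_interior (n := ⊤)
    (modelWithCornersSelf ℝ E) hK.isClosed hKL
  have hsub : tsupport f ⊆ L := closure_minimal (fun x hx => by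
    by_contra h
    exact hx (h0 x h)) hL.isClosed
  exact ⟨f, f.contMDiff.contDiff, hL.of_isClosed_subset (isClosed_tsupport _) hsub,
    hsub.trans hLU, fun x hx => mem_nhdsSet_iff_forall.1 h1 x hx⟩

/-- Leibniz bound for the derivatives of a product at a point. -/
theorem norm_iteratedFDeriv_smul_le_sum {χ : E → ℝ} (hχ : ContDiff ℝ ∞ χ) {w : E → F} {x : E}
    {n : ℕ} (hw : ContDiffAt ℝ n w x) {M : ℝ} (hM : ∀ i ≤ n, ‖iteratedFDeriv ℝ i χ x‖ ≤ M) :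
    ‖iteratedFDeriv ℝ n (fun y => χ y • w y) x‖
      ≤ 2 ^ n * M * ∑ i ∈ Finset.range (n + 1), ‖iteratedFDeriv ℝ i w x‖ := by
  -- The Leibniz estimate needs regularity on a set with unique derivatives, so regularity at `x` is
  -- spread to an open neighbourhood, on which derivatives within the set are ordinary ones.
  obtain ⟨V, hV, hVo, hxV⟩ := eventually_nhds_iff.1 (hw.eventually (by simp))
  have hM0 : 0 ≤ M := (norm_nonneg _).trans (hM 0 (Nat.zero_le _))
  have key := norm_iteratedFDerivWithin_smul_le (N := n) (s := V)
    (hχ.of_le (by exact_mod_cast le_top)).contDiffOn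
    (fun y hy => (hV y hy).contDiffWithinAt) hVo.uniqueDiffOn hxV (n := n) le_rfl
  rw [iteratedFDerivWithin_of_isOpen n hVo hxV] at key
  refine key.trans ?_
  rw [← Finset.sum_range_reflect (fun i => ‖iteratedFDeriv ℝ i w x‖), Finset.mul_sum]
  refine Finset.sum_le_sum fun i hi => ?_
  have hi' : i ≤ n := by simpa [Nat.lt_succ_iff] using hi
  rw [iteratedFDerivWithin_of_isOpen i hVo hxV, iteratedFDerivWithin_of_isOpen _ hVo hxV,
    show n + 1 - 1 - i = n - i by omega]
  gcongr
  · exact_mod_cast Nat.choose_le_two_pow n i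
  · exact hM i hi'

theorem exists_bound_iteratedFDeriv {ι : Type*} [Fintype ι] {χ : ι → E → ℝ}
    (hχ : ∀ i, ContDiff ℝ ∞ (χ i)) (hc : ∀ i, HasCompactSupport (χ i)) (s : ℕ) :
    ∃ M : ℝ, 0 ≤ M ∧ ∀ i, ∀ n ≤ s, ∀ x, ‖iteratedFDeriv ℝ n (χ i) x‖ ≤ M := by
  have : ∀ i n, ∃ C, ∀ x, ‖iteratedFDeriv ℝ n (χ i) x‖ ≤ C := fun i n =>
    ((hc i).iteratedFDeriv (𝕜 := ℝ) n).exists_bound_of_continuous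
      ((hχ i).continuous_iteratedFDeriv (by exact_mod_cast le_top))
  choose C hC using this
  have h0 : ∀ i n, 0 ≤ C i n := fun i n => (norm_nonneg _).trans (hC i n 0)
  refine ⟨∑ i, ∑ n ∈ Finset.range (s + 1), C i n,
    Finset.sum_nonneg fun i _ => Finset.sum_nonneg fun n _ => h0 i n, fun i n hn x => ?_⟩
  calc _ ≤ C i n := hC i n x
    _ ≤ ∑ n ∈ Finset.range (s + 1), C i n :=
        Finset.single_le_sum (f := C i) (fun n _ => h0 i n) (Finset.mem_range.2 (by omega))
    _ ≤ _ := Finset.single_le_sum (f := fun i => ∑ n ∈ Finset.range (s + 1), C i n)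
        (fun i _ => Finset.sum_nonneg fun n _ => h0 i n) (Finset.mem_univ i)

end Cutoff

variable {d k s : ℕ} {Ω : Set (EuclideanSpace ℝ (Fin d))}

/-- Near each point of `closure Ω` there is a direction that points into `Ω`. -/
theorem IsBoundedLipschitzDomain.exists_inward_direction (hΩ : IsBoundedLipschitzDomain Ω)
    {z : EuclideanSpace ℝ (Fin d)} (hz : z ∈ closure Ω) :
    ∃ (e : EuclideanSpace ℝ (Fin d)) (r : ℝ), 0 < r ∧ ∀ x ∈ closure Ω, x ∈ Metric.ball z r →
      ∀ t ∈ Set.Ioo 0 r, x + t • e ∈ Ω := by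
  by_cases hzΩ : z ∈ Ω
  · obtain ⟨r, hr, hsub⟩ := Metric.isOpen_iff.1 hΩ.isOpen z hzΩ
    -- At an interior point no shift is needed, so the zero vector serves as direction.
    exact ⟨0, r, hr, fun x _ hx t _ => by simpa using hsub hx⟩
  · have hzf : z ∈ frontier Ω := ⟨hz, by rwa [hΩ.isOpen.interior_eq]⟩
    obtain ⟨e, r, C, γ, he, hr, hγ, hiff⟩ := hΩ.lipschitz_boundary z hzf
    refine ⟨e, r / 2, by positivity, fun x hxc hx t ht => ?_⟩
    have hxr : x ∈ Metric.ball z r := Metric.ball_subset_ball (by linarith) hx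
    -- Points of the closure lie on or above the graph. Moving along `e` keeps the orthogonal
    -- projection fixed and raises the height strictly, which lands in `Ω`.
    have hle : γ ((ℝ ∙ e)ᗮ.orthogonalProjectionOnto x) ≤ ⟪e, x⟫ := by
      by_contra! hlt
      have hcont : Continuous fun y => γ ((ℝ ∙ e)ᗮ.orthogonalProjectionOnto y) :=
        hγ.continuous.comp (ContinuousLinearMap.continuous _)
      have hev : ∀ᶠ y in nhds x, ⟪e, y⟫ < γ ((ℝ ∙ e)ᗮ.orthogonalProjectionOnto y) ∧
          y ∈ Metric.ball z r :=
        Filter.inter_mem ((isOpen_lt (by fun_prop) hcont).mem_nhds hlt)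
          (Metric.isOpen_ball.mem_nhds hxr)
      obtain ⟨y, hy, hyΩ⟩ := mem_closure_iff_nhds.1 hxc _ hev
      exact lt_asymm hy.1 ((hiff y hy.2).1 hyΩ)
    have hproj : (ℝ ∙ e)ᗮ.orthogonalProjectionOnto (x + t • e)
        = (ℝ ∙ e)ᗮ.orthogonalProjectionOnto x := by
      rw [map_add, map_smul, Submodule.orthogonalProjectionOnto_orthogonal_apply_eq_zero
        (Submodule.mem_span_singleton_self e), smul_zero, add_zero]
    have hball : x + t • e ∈ Metric.ball z r := by
      rw [Metric.mem_ball, dist_eq_norm] at hx ⊢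
      calc ‖x + t • e - z‖ = ‖(x - z) + t • e‖ := by congr 1; abel
        _ ≤ ‖x - z‖ + ‖t • e‖ := norm_add_le _ _
        _ < r / 2 + r / 2 := by
          rw [norm_smul, he, mul_one, Real.norm_of_nonneg ht.1.le]
          exact add_lt_add hx ht.2
        _ = r := by ring
    rw [hiff _ hball, hproj, inner_add_right, inner_smul_right, real_inner_self_eq_norm_sq, he]
    have := ht.1
    linarith

/-- A finite smooth partition of unity such that on the support of each of its members a direction
points into `Ω`. -/
theorem IsBoundedLipschitzDomain.exists_partition (hΩ : IsBoundedLipschitzDomain Ω) :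
    ∃ (ι : Type) (_ : Fintype ι) (χ : ι → EuclideanSpace ℝ (Fin d) → ℝ)
      (e : ι → EuclideanSpace ℝ (Fin d)) (r : ℝ), 0 < r ∧ (∀ i, ContDiff ℝ ∞ (χ i)) ∧
      (∀ i, HasCompactSupport (χ i)) ∧ (∀ x ∈ Ω, ∑ i, χ i x = 1) ∧
      ∀ i, ∀ x ∈ closure Ω, x ∈ tsupport (χ i) → ∀ t ∈ Set.Ioo 0 r, x + t • e i ∈ Ω := by
  have hdir : ∀ z : EuclideanSpace ℝ (Fin d), ∃ (e : EuclideanSpace ℝ (Fin d)) (r : ℝ), 0 < r ∧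
      (z ∈ closure Ω → ∀ x ∈ closure Ω, x ∈ Metric.ball z r → ∀ t ∈ Set.Ioo 0 r,
        x + t • e ∈ Ω) := by
    intro z
    by_cases hz : z ∈ closure Ω
    · obtain ⟨e, r, hr, h⟩ := hΩ.exists_inward_direction hz
      exact ⟨e, r, hr, fun _ => h⟩
    · exact ⟨0, 1, one_pos, fun h => absurd h hz⟩
  choose e r hr hin using hdir
  have hcomp : IsCompact (closure Ω) := hΩ.isBounded.isCompact_closure
  obtain ⟨T, hT, hcov⟩ := hcomp.elim_nhds_subcover (fun z => Metric.ball z (r z))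
    fun z _ => Metric.ball_mem_nhds z (hr z)
  obtain ⟨f, hf⟩ := SmoothPartitionOfUnity.exists_isSubordinate
    (modelWithCornersSelf ℝ (EuclideanSpace ℝ (Fin d))) (isClosed_closure (s := Ω))
    (fun z : T => Metric.ball (z : EuclideanSpace ℝ (Fin d)) (r z)) (fun _ => Metric.isOpen_ball)
    (by simpa [Set.iUnion_subtype] using hcov)
  obtain ⟨ρ, hρ0, hρ⟩ : ∃ ρ > 0, ∀ z : T, ρ ≤ r z := by
    rcases T.eq_empty_or_nonempty with rfl | hne
    · exact ⟨1, one_pos, fun z => absurd z.2 (Finset.notMem_empty _)⟩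
    · exact ⟨T.inf' hne r, (Finset.lt_inf'_iff _).2 fun z _ => hr z, fun z => Finset.inf'_le _ z.2⟩
  refine ⟨T, inferInstance, fun z => f z, fun z => e z, ρ, hρ0, fun z => (f z).contMDiff.contDiff,
    fun z => ?_, fun x hx => ?_, fun z x hx hxz t ht => ?_⟩
  · exact Metric.isCompact_of_isClosed_isBounded (isClosed_tsupport _)
      (Metric.isBounded_ball.subset (hf z))
  · rw [← finsum_eq_sum_of_fintype]
    exact f.sum_eq_one (subset_closure hx)
  · exact hin z (hT z z.2) x hx (hf z hxz) t ⟨ht.1, ht.2.trans_le (hρ z)⟩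

variable {d k s : ℕ} {Ω : Set (EuclideanSpace ℝ (Fin d))}

/-! ### Density of smooth functions in `C^s` -/

theorem contDiff_exp_sum {E F : Type*} [NormedAddCommGroup E] [InnerProductSpace ℝ E]
    [NormedAddCommGroup F] [NormedSpace ℝ F] {n : ℕ} (ξ : Fin n → E) (a : Fin n → F) :
    ContDiff ℝ ∞ fun x => ∑ i, Real.exp ⟪ξ i, x⟫ • a i :=
  ContDiff.sum fun _ _ => ((contDiff_const.inner ℝ contDiff_id).exp).smul contDiff_const

theorem CSpace.exists_modulus (hΩ : Bornology.IsBounded Ω) (J : CSpace Ω s k) {η : ℝ}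
    (hη : 0 < η) : ∃ δ > 0, ∀ (n : Fin (s + 1)) (x y : closure Ω), dist x y < δ →
      ‖J.1 n x - J.1 n y‖ ≤ η := by
  have : CompactSpace (closure Ω) := isCompact_iff_compactSpace.1 hΩ.isCompact_closure
  have : ∀ n : Fin (s + 1), ∃ δ > 0, ∀ x y : closure Ω, dist x y < δ →
      ‖J.1 n x - J.1 n y‖ ≤ η := by
    intro n
    obtain ⟨δ, h0, h⟩ := Metric.uniformContinuous_iff.1
      (CompactSpace.uniformContinuous_of_continuous (J.1 n).continuous) η hη
    exact ⟨δ, h0, fun x y hxy => by rw [← dist_eq_norm]; exact (h hxy).le⟩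
  choose δ h0 h using this
  exact ⟨Finset.univ.inf' ⟨0, Finset.mem_univ _⟩ δ, (Finset.lt_inf'_iff _).2 fun n _ => h0 n,
    fun n x y hxy => h n x y (hxy.trans_le (Finset.inf'_le _ (Finset.mem_univ n)))⟩

/-- Every element of `C^s` is close in `Ω` to a `C^s` function with compact support in `ℝᵈ`. -/
theorem CSpace.exists_contDiff_near (hΩ : IsBoundedLipschitzDomain Ω) (J : CSpace Ω s k) {ε : ℝ}
    (hε : 0 < ε) : ∃ f : EuclideanSpace ℝ (Fin d) → EuclideanSpace ℝ (Fin k), ContDiff ℝ s f ∧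
      HasCompactSupport f ∧ ∀ (n : Fin (s + 1)) (x : EuclideanSpace ℝ (Fin d)) (hx : x ∈ Ω),
        ‖J.1 n ⟨x, subset_closure hx⟩ - iteratedFDeriv ℝ n f x‖ ≤ ε := by
  obtain ⟨u, hu, hJ⟩ := J.2
  obtain ⟨ι, _, χ, e, r, hr, hχ, hχc, hsum, hin⟩ := hΩ.exists_partition
  obtain ⟨M, hM0, hM⟩ := exists_bound_iteratedFDeriv hχ hχc s
  set A : ℝ := Fintype.card ι * (2 ^ s * M * (s + 1)) with hA
  have hA0 : 0 ≤ A := by positivity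
  obtain ⟨δ, hδ0, hδ⟩ := J.exists_modulus hΩ.isBounded (η := ε / (A + 1)) (by positivity)
  obtain ⟨t, ht, hte⟩ : ∃ t ∈ Set.Ioo 0 r, ∀ i, ‖t • e i‖ < δ := by
    set B : ℝ := ∑ i, ‖e i‖
    have hB : 0 ≤ B := Finset.sum_nonneg fun _ _ => norm_nonneg _
    refine ⟨min (r / 2) (δ / (B + 1) / 2), ⟨by positivity, ?_⟩, fun i => ?_⟩
    · exact (min_le_left _ _).trans_lt (by linarith)
    · have hi : ‖e i‖ ≤ B := Finset.single_le_sum (f := fun i => ‖e i‖)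
        (fun _ _ => norm_nonneg _) (Finset.mem_univ i)
      rw [norm_smul, Real.norm_of_nonneg (by positivity)]
      calc _ ≤ δ / (B + 1) / 2 * (B + 1) := by
            gcongr
            · exact min_le_right _ _
            · linarith
        _ = δ / 2 := by field_simp
        _ < δ := by linarith
  -- On the support of `χ i` the shift moves the closure into `Ω`, so `g` is `C^s` at boundary
  -- points too, although `u` is only controlled inside.
  set g : EuclideanSpace ℝ (Fin d) → EuclideanSpace ℝ (Fin k) :=
    fun x => ∑ i, χ i x • u (x + t • e i) with hg
  have hshift : ∀ i, ∀ x ∈ closure Ω, x ∈ tsupport (χ i) →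
      ContDiffAt ℝ s (fun y => u (y + t • e i)) x := fun i x hx hxi =>
    (hu _ (hin i x hx hxi t ht)).comp x (contDiffAt_id.add contDiffAt_const)
  have hzero : ∀ i (x : EuclideanSpace ℝ (Fin d)), x ∉ tsupport (χ i) → ∀
      w : EuclideanSpace ℝ (Fin d) → EuclideanSpace ℝ (Fin k),
      (fun y => χ i y • w y) =ᶠ[nhds x] fun _ => 0 := by
    intro i x hx w
    filter_upwards [(isClosed_tsupport (χ i)).isOpen_compl.mem_nhds hx] with y hy
    rw [image_eq_zero_of_notMem_tsupport hy, zero_smul]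
  have hgd : ∀ x ∈ closure Ω, ContDiffAt ℝ s g x := by
    intro x hx
    refine ContDiffAt.sum fun i _ => ?_
    by_cases hxi : x ∈ tsupport (χ i)
    · exact ((hχ i).contDiffAt.of_le (by exact_mod_cast le_top)).smul (hshift i x hx hxi)
    · exact contDiffAt_const.congr_of_eventuallyEq (hzero i x hxi _)
  have hUo : IsOpen {x | ContDiffAt ℝ s g x} :=
    isOpen_iff_eventually.2 fun x (hx : ContDiffAt ℝ s g x) => hx.eventually (by simp)
  -- The points of regularity of `g` form an open set containing the compact closure; a cut-off
  -- inside it extends `g` to the whole space without change near the closure.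
  obtain ⟨ψ, hψ, hψc, hψU, hψ1⟩ := exists_contDiff_cutoff hΩ.isBounded.isCompact_closure hUo hgd
  refine ⟨fun x => ψ x • g x, ?_, hψc.smul_right, fun n x hx => ?_⟩
  · rw [contDiff_iff_contDiffAt]
    intro x
    by_cases hx : x ∈ tsupport ψ
    · exact (hψ.contDiffAt.of_le (by exact_mod_cast le_top)).smul (hψU hx)
    · refine contDiffAt_const (c := 0) |>.congr_of_eventuallyEq ?_
      filter_upwards [(isClosed_tsupport ψ).isOpen_compl.mem_nhds hx] with y hy
      rw [image_eq_zero_of_notMem_tsupport hy, zero_smul]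
  · have hxc := subset_closure hx
    have hn : (n : ℕ) ≤ s := Nat.lt_succ_iff.1 n.2
    have hns : ((n : ℕ) : WithTop ℕ∞) ≤ s := by exact_mod_cast hn
    have e1 : iteratedFDeriv ℝ n (fun x => ψ x • g x) x = iteratedFDeriv ℝ n g x := by
      refine (Filter.EventuallyEq.iteratedFDeriv ℝ ?_ n).eq_of_nhds
      filter_upwards [hψ1 x hxc] with y hy
      rw [hy, one_smul]
    have hw : ∀ i, x ∈ tsupport (χ i) → ContDiffAt ℝ s (fun y => u (y + t • e i) - u y) x :=
      fun i hxi => (hshift i x hxc hxi).sub (hu x hx)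
    -- As the partition sums to one, only increments of `u` remain. Their derivatives are controlled
    -- by the modulus of continuity of the jet, and `A` collects the Leibniz constants over all
    -- members of the partition.
    have e2 : (fun y => g y - u y) =ᶠ[nhds x] fun y => ∑ i, χ i y • (u (y + t • e i) - u y) := by
      filter_upwards [hΩ.isOpen.mem_nhds hx] with y hy
      simp only [smul_sub, Finset.sum_sub_distrib]
      rw [← Finset.sum_smul, hsum y hy, one_smul]
    have hχw : ∀ i, ContDiffAt ℝ n (fun y => χ i y • (u (y + t • e i) - u y)) x := by
      intro i
      by_cases hxi : x ∈ tsupport (χ i)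
      · exact ((hχ i).contDiffAt.of_le (by exact_mod_cast le_top)).smul ((hw i hxi).of_le hns)
      · exact contDiffAt_const.congr_of_eventuallyEq (hzero i x hxi _)
    have e3 : iteratedFDeriv ℝ n g x - iteratedFDeriv ℝ n u x
        = ∑ i, iteratedFDeriv ℝ n (fun y => χ i y • (u (y + t • e i) - u y)) x := by
      rw [← iteratedFDeriv_fun_sum_apply fun i _ => hχw i, ← (e2.iteratedFDeriv ℝ n).eq_of_nhds]
      exact (iteratedFDeriv_sub_apply ((hgd x hxc).of_le hns) ((hu x hx).of_le hns)).symm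
    rw [hJ n x hx, e1, norm_sub_rev, e3]
    have hterm : ∀ i, ‖iteratedFDeriv ℝ n (fun y => χ i y • (u (y + t • e i) - u y)) x‖
        ≤ 2 ^ s * M * ((s + 1) * (ε / (A + 1))) := by
      intro i
      by_cases hxi : x ∈ tsupport (χ i)
      · have hxt := hin i x hxc hxi t ht
        have hdw : ∀ j ∈ Finset.range ((n : ℕ) + 1),
            ‖iteratedFDeriv ℝ j (fun y => u (y + t • e i) - u y) x‖ ≤ ε / (A + 1) := by
          intro j hj
          have hjs : j < s + 1 := by have := Finset.mem_range.1 hj; omega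
          have hjs' : (j : WithTop ℕ∞) ≤ s := by exact_mod_cast Nat.lt_succ_iff.1 hjs
          have e4 : iteratedFDeriv ℝ j (fun y => u (y + t • e i) - u y) x
              = J.1 ⟨j, hjs⟩ ⟨_, subset_closure hxt⟩ - J.1 ⟨j, hjs⟩ ⟨x, hxc⟩ := by
            rw [hJ ⟨j, hjs⟩ _ hxt, hJ ⟨j, hjs⟩ x hx, ← iteratedFDeriv_comp_add_right]
            exact iteratedFDeriv_sub_apply ((hshift i x hxc hxi).of_le hjs') ((hu x hx).of_le hjs')
          rw [e4]
          refine hδ _ _ _ ?_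
          rw [Subtype.dist_eq, dist_eq_norm, add_sub_cancel_left]
          exact hte i
        calc _ ≤ 2 ^ (n : ℕ) * M * ∑ j ∈ Finset.range ((n : ℕ) + 1),
              ‖iteratedFDeriv ℝ j (fun y => u (y + t • e i) - u y) x‖ :=
            norm_iteratedFDeriv_smul_le_sum (hχ i) ((hw i hxi).of_le hns)
              fun j hj => hM i j (hj.trans hn) x
          _ ≤ 2 ^ s * M * ((s + 1) * (ε / (A + 1))) := by
            gcongr
            · norm_num
            · refine (Finset.sum_le_sum hdw).trans ?_
              rw [Finset.sum_const, Finset.card_range, nsmul_eq_mul]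
              gcongr
              exact_mod_cast Nat.succ_le_succ hn
      · rw [((hzero i x hxi _).iteratedFDeriv ℝ n).eq_of_nhds]
        have : iteratedFDeriv ℝ n (fun _ : EuclideanSpace ℝ (Fin d) =>
            (0 : EuclideanSpace ℝ (Fin k))) x = 0 := by
          rw [iteratedFDeriv_fun_zero]
          rfl
        rw [this, norm_zero]
        positivity
    calc _ ≤ ∑ i, ‖iteratedFDeriv ℝ n (fun y => χ i y • (u (y + t • e i) - u y)) x‖ :=
          norm_sum_le _ _
      _ ≤ ∑ i : ι, 2 ^ s * M * ((s + 1) * (ε / (A + 1))) := Finset.sum_le_sum fun i _ => hterm i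
      _ = A * (ε / (A + 1)) := by
          rw [Finset.sum_const, Finset.card_univ, nsmul_eq_mul, hA]; ring
      _ ≤ (A + 1) * (ε / (A + 1)) := by gcongr; linarith
      _ = ε := by field_simp

/-- The compactly supported approximant is only `C^s`. Exponential sums, being smooth, also provide
the missing regularity, so no separate mollification is required. -/
theorem denseRange_toCSpace (hΩ : IsBoundedLipschitzDomain Ω) :
    DenseRange (toCSpace (k := k) hΩ.isBounded s) := by
  intro J
  rw [Metric.mem_closure_iff]
  intro ε hε
  obtain ⟨f, hf, hfc, hJf⟩ := CSpace.exists_contDiff_near hΩ J (ε := ε / 4) (by positivity)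
  obtain ⟨n, ξ, a, hξ⟩ := exists_exp_sum_iteratedFDeriv_near hfc hf
    hΩ.isBounded.isCompact_closure (ε := ε / 4) (by positivity)
  refine ⟨_, ⟨⟨_, contDiff_exp_sum ξ a⟩, rfl⟩, ?_⟩
  rw [dist_eq_norm]
  refine (CSpace.norm_le _ (B := ε / 2) (by positivity) fun j x hx => ?_).trans_lt (by linarith)
  change ‖J.1 j ⟨x, _⟩ - iteratedFDeriv ℝ j (fun x => ∑ i, Real.exp ⟪ξ i, x⟫ • a i) x‖ ≤ ε / 2
  have hj : (j : ℕ) ≤ s := Nat.lt_succ_iff.1 j.2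
  have h2 := hξ j hj x (subset_closure hx)
  rw [iteratedFDeriv_sub_apply (hf.contDiffAt.of_le (by exact_mod_cast hj))
    ((contDiff_exp_sum ξ a).contDiffAt.of_le (by exact_mod_cast le_top))] at h2
  calc _ ≤ _ := norm_sub_le_norm_sub_add_norm_sub _ (iteratedFDeriv ℝ j f x) _
    _ ≤ ε / 4 + ε / 4 := add_le_add (hJf j x hx) h2
    _ = ε / 2 := by ring

/-! ### Mollification in `Lᵖ` -/

theorem iteratedFDeriv_comp_const_sub_apply {E F : Type*} [NormedAddCommGroup E]
    [NormedSpace ℝ E] [NormedAddCommGroup F] [NormedSpace ℝ F] {f : E → F} (hf : ContDiff ℝ ∞ f)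
    (n : ℕ) (x y : E) (m : Fin n → E) :
    iteratedFDeriv ℝ n (fun y => f (x - y)) y m = (-1 : ℝ) ^ n • iteratedFDeriv ℝ n f (x - y) m := by
  have hfx : ContDiff ℝ ∞ fun z => f (z + x) := hf.comp (contDiff_id.add contDiff_const)
  have e : (fun y => f (x - y)) = (fun z => f (z + x)) ∘ (-ContinuousLinearMap.id ℝ E) := by
    ext y
    simp [sub_eq_neg_add]
  rw [e, ContinuousLinearMap.iteratedFDeriv_comp_right (i := n) _ hfx _
    (by exact_mod_cast le_top), iteratedFDeriv_comp_add_right]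
  have := (iteratedFDeriv ℝ n f (x - y)).map_smul_univ (fun _ => (-1 : ℝ)) m
  simpa [sub_eq_neg_add] using this

section Mollification

open scoped Convolution

variable {E : Type} [NormedAddCommGroup E] [InnerProductSpace ℝ E] [FiniteDimensional ℝ E]
  [MeasurableSpace E] [BorelSpace E]
variable {F : Type} [NormedAddCommGroup F]

/-- Translations act continuously on `Lᵖ`. -/
theorem exists_translation_modulus {p : ENNReal} (hp1 : 1 ≤ p) (hp : p ≠ ⊤) {g : E → F}
    (hg : MemLp g p volume) {η : ℝ} (hη : 0 < η) :
    ∃ τ > 0, ∀ h : E, ‖h‖ < τ →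
      eLpNorm (fun x => g (x + h) - g x) p volume ≤ ENNReal.ofReal η := by
  have : Fact (1 ≤ p) := ⟨hp1⟩
  have : Fact (p ≠ ⊤) := ⟨hp⟩
  have hcont : Continuous fun h : E => DomAddAct.mk h +ᵥ hg.toLp g :=
    (DomAddAct.continuous_mk).vadd continuous_const
  obtain ⟨τ, hτ, h⟩ := Metric.continuous_iff.1 hcont 0 η hη
  refine ⟨τ, hτ, fun v hv => ?_⟩
  have h1 := h v (by simpa using hv)
  have h2 : edist (DomAddAct.mk v +ᵥ hg.toLp g) (DomAddAct.mk (0 : E) +ᵥ hg.toLp g)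
      ≤ ENNReal.ofReal η := by
    rw [edist_dist]
    exact ENNReal.ofReal_le_ofReal h1.le
  rw [DomAddAct.mk_vadd_toLp, DomAddAct.mk_vadd_toLp, Lp.edist_toLp_toLp] at h2
  convert h2 using 2
  ext x
  simp [add_comm]

/-- Averaging over translations, as a consequence of Jensen's inequality. -/
theorem eLpNorm_integral_translate_sub_le [NormedSpace ℝ F] {p : ENNReal} (hp1 : 1 ≤ p)
    (hp : p ≠ ⊤) {g : E → F} (hg : StronglyMeasurable g) {ν : Measure E} [IsProbabilityMeasure ν]
    (v : E) {η : ENNReal}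
    (h : ∀ᵐ z ∂ν, eLpNorm (fun x => g (x + (v - z)) - g x) p volume ≤ η) :
    eLpNorm (fun x => ∫ z, (g (x + (v - z)) - g x) ∂ν) p volume ≤ η := by
  have hp0 : p ≠ 0 := (one_pos.trans_le hp1).ne'
  have hpr : 0 < p.toReal := ENNReal.toReal_pos hp0 hp
  have hm : StronglyMeasurable fun q : E × E => g (q.1 + (v - q.2)) - g q.1 :=
    (hg.comp_measurable (by fun_prop)).sub (hg.comp_measurable measurable_fst)
  rw [eLpNorm_eq_lintegral_rpow_enorm_toReal hp0 hp, one_div, ENNReal.rpow_inv_le_iff hpr]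
  -- Under a probability measure the `L¹` norm is at most the `Lᵖ` norm; Tonelli then exchanges the
  -- two integrations.
  have hjensen : ∀ x, ‖∫ z, (g (x + (v - z)) - g x) ∂ν‖ₑ ^ p.toReal
      ≤ ∫⁻ z, ‖g (x + (v - z)) - g x‖ₑ ^ p.toReal ∂ν := by
    intro x
    have hmx : AEStronglyMeasurable (fun z => g (x + (v - z)) - g x) ν :=
      (hm.comp_measurable (measurable_const.prodMk measurable_id)).aestronglyMeasurable
    have h1 := eLpNorm_le_eLpNorm_of_exponent_le hp1 hmx
    rw [eLpNorm_one_eq_lintegral_enorm, eLpNorm_eq_lintegral_rpow_enorm_toReal hp0 hp, one_div,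
      ENNReal.le_rpow_inv_iff hpr] at h1
    exact (ENNReal.rpow_le_rpow (enorm_integral_le_lintegral_enorm _) hpr.le).trans h1
  calc _ ≤ ∫⁻ x, (∫⁻ z, ‖g (x + (v - z)) - g x‖ₑ ^ p.toReal ∂ν) ∂volume := lintegral_mono hjensen
    _ = ∫⁻ z, (∫⁻ x, ‖g (x + (v - z)) - g x‖ₑ ^ p.toReal ∂volume) ∂ν := by
      refine lintegral_lintegral_swap ?_
      exact (hm.enorm.pow_const _).aemeasurable
    _ ≤ ∫⁻ z, η ^ p.toReal ∂ν := by
      refine lintegral_mono_ae ?_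
      filter_upwards [h] with z hz
      rwa [eLpNorm_eq_lintegral_rpow_enorm_toReal hp0 hp, one_div,
        ENNReal.rpow_inv_le_iff hpr] at hz
    _ = η ^ p.toReal := by simp

end Mollification

section

open scoped Convolution

variable {d k s : ℕ} {Ω : Set (EuclideanSpace ℝ (Fin d))} {p : ENNReal}

/-- Inside of `Ω`, the derivatives of a mollification are the mollifications of the weak
derivatives. -/
theorem iteratedFDeriv_mollify [hp : Fact (1 ≤ p)] (hΩ : IsBoundedLipschitzDomain Ω) {n : ℕ}
    {u : EuclideanSpace ℝ (Fin d) → EuclideanSpace ℝ (Fin k)} (hu : IntegrableOn u Ω)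
    {g : LpJet Ω p k n} (hg : IsWeakDeriv Ω n u g) {ρ : EuclideanSpace ℝ (Fin d) → ℝ}
    (hρ : ContDiff ℝ ∞ ρ) (hρc : HasCompactSupport ρ) {δ : ℝ}
    (hρδ : tsupport ρ ⊆ Metric.closedBall 0 δ) {x : EuclideanSpace ℝ (Fin d)}
    (hx : Metric.closedBall x δ ⊆ Ω) :
    iteratedFDeriv ℝ n (Ω.indicator u ⋆[(ContinuousLinearMap.lsmul ℝ ℝ).flip, volume] ρ) x
      = ∫ z, ρ z • Ω.indicator g (x - z) := by
  have hul : LocallyIntegrable (Ω.indicator u) :=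
    ((integrable_indicator_iff hΩ.isOpen.measurableSet).2 hu).locallyIntegrable
  have hgi : Integrable (Ω.indicator g) := by
    have := isFiniteMeasure_restrict_of_isBounded hΩ.isBounded
    exact (integrable_indicator_iff hΩ.isOpen.measurableSet).2 ((Lp.memLp g).integrable hp.out)
  have hgint : Integrable fun y => ρ (x - y) • Ω.indicator g y := by
    have := hρc.convolutionExists_left (ContinuousLinearMap.lsmul ℝ ℝ) hρ.continuous
      hgi.locallyIntegrable x
    exact (convolutionExistsAt_iff_integrable_swap (L := ContinuousLinearMap.lsmul ℝ ℝ)).1 this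
  ext m : 1
  have e1 : ∫ z, ρ z • Ω.indicator g (x - z) = ∫ y, ρ (x - y) • Ω.indicator g y := by
    rw [← integral_sub_left_eq_self (fun y => ρ (x - y) • Ω.indicator g y) volume x]
    simp
  have e2 : (∫ y, ρ (x - y) • Ω.indicator g y) m = ∫ y, ρ (x - y) • Ω.indicator g y m :=
    (ContinuousLinearMap.integral_comp_comm (ContinuousMultilinearMap.apply ℝ
      (fun _ : Fin n => EuclideanSpace ℝ (Fin d)) (EuclideanSpace ℝ (Fin k)) m) hgint).symm
  have e3 : ∫ y, ρ (x - y) • Ω.indicator g y m = ∫ y in Ω, ρ (x - y) • g y m := by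
    rw [← integral_indicator hΩ.isOpen.measurableSet]
    congr 1
    ext1 y
    by_cases hy : y ∈ Ω <;> simp [hy]
  -- The reflected kernel is admissible as a test function because its support stays in the ball
  -- around `x`. The sign from the reflection cancels the sign in the definition of the weak
  -- derivative.
  have hφ : ContDiff ℝ ∞ fun y => ρ (x - y) := hρ.comp (contDiff_const.sub contDiff_id)
  have hφc : HasCompactSupport fun y => ρ (x - y) := hρc.comp_homeomorph (Homeomorph.subLeft x)
  have hφΩ : tsupport (fun y => ρ (x - y)) ⊆ Ω := by
    refine (closure_minimal (fun y hy => ?_) Metric.isClosed_closedBall).trans hx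
    have : x - y ∈ Metric.closedBall (0 : EuclideanSpace ℝ (Fin d)) δ :=
      hρδ (subset_tsupport ρ hy)
    rw [Metric.mem_closedBall, dist_comm, dist_eq_norm]
    simpa using this
  rw [iteratedFDeriv_convolution_apply hul n _ hρc (hρ.of_le (by exact_mod_cast le_top)), e1, e2,
    e3, hg _ hφ hφc hφΩ m, ← integral_smul, ← integral_indicator hΩ.isOpen.measurableSet]
  congr 1
  ext1 y
  by_cases hy : y ∈ Ω
  · simp only [Set.indicator_of_mem hy, iteratedFDeriv_comp_const_sub_apply hρ]
    rw [smul_eq_mul, smul_smul, ← mul_assoc, ← mul_pow]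
    simp
  · simp [hy]

end

/-! ### Density of smooth functions in `W^{s,p}` -/

section

open scoped Convolution

variable {d k s : ℕ} {Ω : Set (EuclideanSpace ℝ (Fin d))} {p : ENNReal}

theorem WSpace.integrableOn_toFun [hp : Fact (1 ≤ p)] (hΩ : Bornology.IsBounded Ω)
    (J : WSpace Ω s p k) : IntegrableOn J.toFun Ω := by
  have := isFiniteMeasure_restrict_of_isBounded hΩ
  exact (ContinuousMultilinearMap.apply ℝ (fun _ : Fin ((0 : Fin (s + 1)) : ℕ) =>
    EuclideanSpace ℝ (Fin d)) (EuclideanSpace ℝ (Fin k)) 0).integrable_comp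
      ((Lp.memLp (J.1 0)).integrable hp.out)

/-- The derivatives of the mollified translates of an element of `W^{s,p}` are close to its weak
derivatives wherever the translation moves into `Ω`. -/
theorem exists_contDiff_near_of_isWeakDeriv [hp : Fact (1 ≤ p)] (hpt : p ≠ ⊤)
    (hΩ : IsBoundedLipschitzDomain Ω) {u : EuclideanSpace ℝ (Fin d) → EuclideanSpace ℝ (Fin k)}
    (hu : IntegrableOn u Ω) {G : (n : Fin (s + 1)) → LpJet Ω p k n}
    (hG : ∀ n : Fin (s + 1), IsWeakDeriv Ω n u (G n)) {T : Set (EuclideanSpace ℝ (Fin d))}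
    (hT : IsClosed T) {e : EuclideanSpace ℝ (Fin d)} {r : ℝ} (hr : 0 < r)
    (hin : ∀ x ∈ closure Ω, x ∈ T → ∀ t ∈ Set.Ioo 0 r, x + t • e ∈ Ω) {η : ℝ} (hη : 0 < η) :
    ∃ f : EuclideanSpace ℝ (Fin d) → EuclideanSpace ℝ (Fin k), ContDiff ℝ ∞ f ∧
      ∀ n : Fin (s + 1), eLpNorm (fun x => iteratedFDeriv ℝ n f x - G n x) p
        (volume.restrict (Ω ∩ T)) ≤ ENNReal.ofReal η := by
  have hΩm := hΩ.isOpen.measurableSet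
  set g : (n : Fin (s + 1)) → EuclideanSpace ℝ (Fin d) →
      (EuclideanSpace ℝ (Fin d) [×n]→L[ℝ] EuclideanSpace ℝ (Fin k)) :=
    fun n => Ω.indicator (G n) with hg
  have hgm : ∀ n, StronglyMeasurable (g n) := fun n => (Lp.stronglyMeasurable _).indicator hΩm
  have hgp : ∀ n, MemLp (g n) p volume := fun n =>
    (memLp_indicator_iff_restrict hΩm).2 (Lp.memLp (G n))
  have hgi : ∀ n, Integrable (g n) := by
    have := isFiniteMeasure_restrict_of_isBounded hΩ.isBounded
    exact fun n => (integrable_indicator_iff hΩm).2 ((Lp.memLp (G n)).integrable hp.out)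
  obtain ⟨τ, hτ0, hτ⟩ : ∃ τ > 0, ∀ n, ∀ h : EuclideanSpace ℝ (Fin d), ‖h‖ < τ →
      eLpNorm (fun x => g n (x + h) - g n x) p volume ≤ ENNReal.ofReal η := by
    choose τ h0 h using fun n => exists_translation_modulus hp.out hpt (hgp n) hη
    exact ⟨Finset.univ.inf' ⟨0, Finset.mem_univ _⟩ τ, (Finset.lt_inf'_iff _).2 fun n _ => h0 n,
      fun n v hv => h n v (hv.trans_le (Finset.inf'_le _ (Finset.mem_univ n)))⟩
  obtain ⟨t, ht, hte⟩ : ∃ t ∈ Set.Ioo 0 r, ‖t • e‖ < τ / 2 := by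
    refine ⟨min (r / 2) (τ / (‖e‖ + 1) / 4), ⟨by positivity, ?_⟩, ?_⟩
    · exact (min_le_left _ _).trans_lt (by linarith)
    · rw [norm_smul, Real.norm_of_nonneg (by positivity)]
      calc _ ≤ τ / (‖e‖ + 1) / 4 * (‖e‖ + 1) := by
            gcongr
            · exact min_le_right _ _
            · linarith
        _ = τ / 4 := by field_simp
        _ < τ / 2 := by linarith
  -- The shifted compact piece has positive distance to the complement of `Ω`, which leaves room for
  -- mollification at a scale below this distance.
  obtain ⟨δ₀, hδ₀, hthick⟩ : ∃ δ₀ > 0, Metric.cthickening δ₀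
      ((fun x => x + t • e) '' (closure Ω ∩ T)) ⊆ Ω := by
    refine IsCompact.exists_cthickening_subset_open ?_ hΩ.isOpen ?_
    · exact (hΩ.isBounded.isCompact_closure.inter_right hT).image (by fun_prop)
    · rintro _ ⟨x, hx, rfl⟩
      exact hin x hx.1 hx.2 t ht
  set δ : ℝ := min δ₀ (τ / 2)
  have hδ : 0 < δ := by positivity
  let φ : ContDiffBump (0 : EuclideanSpace ℝ (Fin d)) := ⟨δ / 2, δ, by positivity, by linarith⟩
  set ρ : EuclideanSpace ℝ (Fin d) → ℝ := φ.normed volume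
  have hρ : ContDiff ℝ ∞ ρ := φ.contDiff_normed
  have hρc : HasCompactSupport ρ := φ.hasCompactSupport_normed
  have hρi : Integrable ρ := φ.integrable_normed
  have hul : LocallyIntegrable (Ω.indicator u) :=
    ((integrable_indicator_iff hΩm).2 hu).locallyIntegrable
  -- Read as a probability measure, the mollifier makes the error an average of translation
  -- differences, with shifts `t • e - z` of length less than `τ`.
  set ν : Measure (EuclideanSpace ℝ (Fin d)) := volume.withDensity fun z => ENNReal.ofReal (ρ z)
  have hρm : Measurable fun z => ENNReal.ofReal (ρ z) := hρ.continuous.measurable.ennreal_ofReal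
  have hν : IsProbabilityMeasure ν := ⟨by
    rw [withDensity_apply _ MeasurableSet.univ, Measure.restrict_univ,
      ← ofReal_integral_eq_lintegral_ofReal hρi (.of_forall φ.nonneg_normed), φ.integral_normed,
      ENNReal.ofReal_one]⟩
  refine ⟨fun x => (Ω.indicator u ⋆[(ContinuousLinearMap.lsmul ℝ ℝ).flip, volume] ρ)
    (x + t • e), ?_, fun n => ?_⟩
  · have h1 : ContDiff ℝ ∞ (Ω.indicator u
        ⋆[(ContinuousLinearMap.lsmul ℝ ℝ).flip, volume] ρ) :=
      hρc.contDiff_convolution_right (n := ⊤) _ hul hρ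
    exact h1.comp (contDiff_id.add contDiff_const)
  · have hder : ∀ x ∈ Ω ∩ T, iteratedFDeriv ℝ n (fun x => (Ω.indicator u
        ⋆[(ContinuousLinearMap.lsmul ℝ ℝ).flip, volume] ρ) (x + t • e)) x - G n x
        = ∫ z, (g n (x + (t • e - z)) - g n x) ∂ν := by
      intro x hx
      have hball : Metric.closedBall (x + t • e) δ ⊆ Ω :=
        ((Metric.closedBall_subset_closedBall (min_le_left _ _)).trans
          (Metric.closedBall_subset_cthickening
            (show x + t • e ∈ (fun x => x + t • e) '' (closure Ω ∩ T) from
              ⟨x, ⟨subset_closure hx.1, hx.2⟩, rfl⟩) _)).trans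
          hthick
      have hsupp : tsupport ρ ⊆ Metric.closedBall 0 δ := φ.tsupport_normed_eq.subset
      have hi : Integrable fun z => ρ z • g n (x + t • e - z) :=
        hρc.convolutionExists_left (ContinuousLinearMap.lsmul ℝ ℝ) hρ.continuous
          (hgi n).locallyIntegrable (x + t • e)
      have hgint : ∫ z, (g n (x + (t • e - z)) - g n x) ∂ν
          = (∫ z, ρ z • g n (x + t • e - z)) - g n x := by
        rw [integral_withDensity_eq_integral_toReal_smul hρm
          (.of_forall fun z => ENNReal.ofReal_lt_top)]
        have e1 : ∀ z, (ENNReal.ofReal (ρ z)).toReal • (g n (x + (t • e - z)) - g n x)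
            = ρ z • g n (x + t • e - z) - ρ z • g n x := fun z => by
          rw [ENNReal.toReal_ofReal (φ.nonneg_normed z), smul_sub, add_sub_assoc]
        simp only [e1]
        rw [integral_sub hi (hρi.smul_const _), integral_smul_const, φ.integral_normed, one_smul]
      rw [hgint, iteratedFDeriv_comp_add_right,
        iteratedFDeriv_mollify hΩ hu (hG n) hρ hρc hsupp hball]
      congr 1
      exact (Set.indicator_of_mem hx.1 _).symm
    calc _ = eLpNorm (fun x => ∫ z, (g n (x + (t • e - z)) - g n x) ∂ν) p
          (volume.restrict (Ω ∩ T)) := by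
          refine eLpNorm_congr_ae ?_
          filter_upwards [ae_restrict_mem (hΩm.inter hT.measurableSet)] with x hx
          exact hder x hx
      _ ≤ eLpNorm (fun x => ∫ z, (g n (x + (t • e - z)) - g n x) ∂ν) p volume :=
          eLpNorm_mono_measure _ Measure.restrict_le_self
      _ ≤ ENNReal.ofReal η := by
          refine eLpNorm_integral_translate_sub_le hp.out hpt (hgm n) _ ?_
          rw [ae_withDensity_iff hρm]
          refine .of_forall fun z hz => hτ n _ ?_
          have hz' : z ∈ Metric.ball (0 : EuclideanSpace ℝ (Fin d)) δ := by
            have : z ∈ Function.support ρ := fun h => hz (by rw [h, ENNReal.ofReal_zero])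
            exact φ.support_normed_eq.subset this
          rw [mem_ball_zero_iff] at hz'
          calc ‖t • e - z‖ ≤ ‖t • e‖ + ‖z‖ := norm_sub_le _ _
            _ < τ / 2 + τ / 2 := add_lt_add hte (hz'.trans_le (min_le_right _ _))
            _ = τ := by ring

theorem eLpNorm_le_sum_restrict {X F κ : Type*} [MeasurableSpace X] {μ : Measure X}
    [NormedAddCommGroup F] [Fintype κ] (hp : 1 ≤ p) {h : X → F} {w : κ → X → ℝ}
    (hw : ∀ i, AEStronglyMeasurable (w i) μ)
    {T : κ → Set X} (hT : ∀ i, MeasurableSet (T i)) {c : ℝ}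
    (hle : ∀ᵐ x ∂μ, ‖h x‖ ≤ ∑ i, c * (T i).indicator (w i) x) :
    eLpNorm h p μ ≤ ∑ i, ENNReal.ofReal |c| * eLpNorm (w i) p (μ.restrict (T i)) := by
  calc eLpNorm h p μ ≤ eLpNorm (∑ i, c • (T i).indicator (w i)) p μ := by
        refine eLpNorm_mono_ae_real ?_
        filter_upwards [hle] with x hx
        simpa using hx
    _ ≤ ∑ i, eLpNorm (c • (T i).indicator (w i)) p μ :=
        eLpNorm_sum_le (fun i _ => ((hw i).indicator (hT i)).const_smul c) hp
    _ = _ := by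
        refine Finset.sum_congr rfl fun i _ => ?_
        rw [eLpNorm_const_smul, eLpNorm_indicator_eq_eLpNorm_restrict (hT i),
          Real.enorm_eq_ofReal_abs]

theorem norm_iteratedFDeriv_sum_smul_sub_le {ι : Type*} [Fintype ι]
    {χ : ι → EuclideanSpace ℝ (Fin d) → ℝ} (hχ : ∀ i, ContDiff ℝ ∞ (χ i)) {M : ℝ}
    (hM : ∀ i, ∀ j ≤ s, ∀ x, ‖iteratedFDeriv ℝ j (χ i) x‖ ≤ M) (hM0 : 0 ≤ M)
    {F F' : ι → EuclideanSpace ℝ (Fin d) → EuclideanSpace ℝ (Fin k)}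
    (hF : ∀ i, ContDiff ℝ ∞ (F i)) (hF' : ∀ i, ContDiff ℝ ∞ (F' i)) (n : Fin (s + 1))
    (x : EuclideanSpace ℝ (Fin d)) :
    ‖iteratedFDeriv ℝ n (fun x => ∑ i, χ i x • F i x) x
        - iteratedFDeriv ℝ n (fun x => ∑ i, χ i x • F' i x) x‖
      ≤ ∑ q : ι × Fin (s + 1), 2 ^ s * M * (tsupport (χ q.1)).indicator (fun x =>
        ‖iteratedFDeriv ℝ q.2 (F q.1) x - iteratedFDeriv ℝ q.2 (F' q.1) x‖) x := by
  have hn : (n : ℕ) ≤ s := Nat.lt_succ_iff.1 n.2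
  have hfs : ∀ {F : ι → EuclideanSpace ℝ (Fin d) → EuclideanSpace ℝ (Fin k)},
      (∀ i, ContDiff ℝ ∞ (F i)) → ContDiffAt ℝ n (fun x => ∑ i, χ i x • F i x) x := fun hF =>
    (ContDiff.sum fun i _ => (hχ i).smul (hF i)).contDiffAt.of_le (by exact_mod_cast le_top)
  have hw : ∀ i, ContDiff ℝ ∞ fun x => F i x - F' i x := fun i => (hF i).sub (hF' i)
  have hχw : ∀ i, ContDiffAt ℝ n (fun x => χ i x • (F i x - F' i x)) x := fun i =>
    ((hχ i).smul (hw i)).contDiffAt.of_le (by exact_mod_cast le_top)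
  have hwj : ∀ i (j : ℕ) x, iteratedFDeriv ℝ j (fun x => F i x - F' i x) x
      = iteratedFDeriv ℝ j (F i) x - iteratedFDeriv ℝ j (F' i) x := fun i j x =>
    iteratedFDeriv_sub_apply ((hF i).contDiffAt.of_le (by exact_mod_cast le_top))
      ((hF' i).contDiffAt.of_le (by exact_mod_cast le_top))
  have e1 : iteratedFDeriv ℝ n (fun x => ∑ i, χ i x • F i x) x
      - iteratedFDeriv ℝ n (fun x => ∑ i, χ i x • F' i x) x
      = ∑ i, iteratedFDeriv ℝ n (fun x => χ i x • (F i x - F' i x)) x := by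
    rw [← iteratedFDeriv_fun_sum_apply fun i _ => hχw i,
      ← iteratedFDeriv_sub_apply (hfs hF) (hfs hF')]
    congr 2
    ext1 y
    simp only [Pi.sub_apply, smul_sub, Finset.sum_sub_distrib]
  rw [e1, Fintype.sum_prod_type]
  refine (norm_sum_le _ _).trans (Finset.sum_le_sum fun i _ => ?_)
  by_cases hx : x ∈ tsupport (χ i)
  · simp only [Set.indicator_of_mem hx]
    rw [← Finset.mul_sum, Fin.sum_univ_eq_sum_range (fun j =>
      ‖iteratedFDeriv ℝ j (F i) x - iteratedFDeriv ℝ j (F' i) x‖)]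
    refine (norm_iteratedFDeriv_smul_le_sum (hχ i)
      ((hw i).contDiffAt.of_le (by exact_mod_cast le_top))
      fun j hj => hM i j (hj.trans hn) x).trans ?_
    simp_rw [hwj]
    gcongr
    norm_num
  · have e2 : (fun x => χ i x • (F i x - F' i x)) =ᶠ[nhds x] fun _ => 0 := by
      filter_upwards [(isClosed_tsupport (χ i)).isOpen_compl.mem_nhds hx] with y hy
      rw [image_eq_zero_of_notMem_tsupport hy, zero_smul]
    rw [(e2.iteratedFDeriv ℝ n).eq_of_nhds, iteratedFDeriv_fun_zero]
    simp [hx]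

theorem aestronglyMeasurable_iteratedFDeriv
    {f : EuclideanSpace ℝ (Fin d) → EuclideanSpace ℝ (Fin k)} (hf : ContDiff ℝ ∞ f) (n : ℕ)
    (μ : Measure (EuclideanSpace ℝ (Fin d))) : AEStronglyMeasurable (iteratedFDeriv ℝ n f) μ :=
  haveI : SecondCountableTopologyEither (EuclideanSpace ℝ (Fin d))
    (EuclideanSpace ℝ (Fin d) [×n]→L[ℝ] EuclideanSpace ℝ (Fin k)) := ⟨.inl inferInstance⟩
  (hf.continuous_iteratedFDeriv (m := n) (by exact_mod_cast le_top)).aestronglyMeasurable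

theorem eLpNorm_sub_le_of_eLpNorm_sub_le {X F : Type*} [MeasurableSpace X] {μ : Measure X}
    [NormedAddCommGroup F] (hp : 1 ≤ p) {f f' g : X → F} (hf : AEStronglyMeasurable f μ)
    (hf' : AEStronglyMeasurable f' μ) (hg : AEStronglyMeasurable g μ) {η η' : ℝ} (hη : 0 ≤ η)
    (hη' : 0 ≤ η') (h : eLpNorm (fun x => f x - g x) p μ ≤ ENNReal.ofReal η)
    (h' : eLpNorm (fun x => f' x - g x) p μ ≤ ENNReal.ofReal η') :
    eLpNorm (fun x => f x - f' x) p μ ≤ ENNReal.ofReal (η + η') := by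
  have e : (fun x => f x - f' x) = (fun x => f x - g x) - fun x => f' x - g x := by
    ext1 x
    exact (sub_sub_sub_cancel_right _ _ _).symm
  rw [e, ENNReal.ofReal_add hη hη']
  exact (eLpNorm_sub_le (hf.sub hg) (hf'.sub hg) hp).trans (add_le_add h h')

/-- Comparing two glued smooth families, both close to the weak derivatives `G`, requires the
product rule for smooth functions only; a Leibniz rule for weak derivatives is avoided. -/
theorem eLpNorm_iteratedFDeriv_sum_smul_sub_le (hp : 1 ≤ p) {ι : Type*} [Fintype ι]
    {χ : ι → EuclideanSpace ℝ (Fin d) → ℝ} (hχ : ∀ i, ContDiff ℝ ∞ (χ i)) {M : ℝ}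
    (hM : ∀ i, ∀ j ≤ s, ∀ x, ‖iteratedFDeriv ℝ j (χ i) x‖ ≤ M) (hM0 : 0 ≤ M)
    {F F' : ι → EuclideanSpace ℝ (Fin d) → EuclideanSpace ℝ (Fin k)}
    (hF : ∀ i, ContDiff ℝ ∞ (F i)) (hF' : ∀ i, ContDiff ℝ ∞ (F' i))
    {G : (n : Fin (s + 1)) → LpJet Ω p k n} {η η' : ℝ} (hη : 0 ≤ η) (hη' : 0 ≤ η')
    (hFG : ∀ i (n : Fin (s + 1)), eLpNorm (fun x => iteratedFDeriv ℝ n (F i) x - G n x) p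
      (volume.restrict (Ω ∩ tsupport (χ i))) ≤ ENNReal.ofReal η)
    (hFG' : ∀ i (n : Fin (s + 1)), eLpNorm (fun x => iteratedFDeriv ℝ n (F' i) x - G n x) p
      (volume.restrict (Ω ∩ tsupport (χ i))) ≤ ENNReal.ofReal η') (n : Fin (s + 1)) :
    eLpNorm (fun x => iteratedFDeriv ℝ n (fun x => ∑ i, χ i x • F i x) x
        - iteratedFDeriv ℝ n (fun x => ∑ i, χ i x • F' i x) x) p (volume.restrict Ω)
      ≤ ENNReal.ofReal (Fintype.card (ι × Fin (s + 1)) * (2 ^ s * M) * (η + η')) := by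
  have hTm : ∀ i, MeasurableSet (tsupport (χ i)) := fun i => (isClosed_tsupport _).measurableSet
  have hFF : ∀ (i : ι) (n : Fin (s + 1)),
      eLpNorm (fun x => iteratedFDeriv ℝ n (F i) x - iteratedFDeriv ℝ n (F' i) x) p
        ((volume.restrict Ω).restrict (tsupport (χ i))) ≤ ENNReal.ofReal (η + η') := by
    intro i n
    rw [Measure.restrict_restrict (hTm i), Set.inter_comm]
    exact eLpNorm_sub_le_of_eLpNorm_sub_le hp (aestronglyMeasurable_iteratedFDeriv (hF i) n _)
      (aestronglyMeasurable_iteratedFDeriv (hF' i) n _)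
      (Lp.stronglyMeasurable (G n)).aestronglyMeasurable hη hη' (hFG i n) (hFG' i n)
  set w : ι × Fin (s + 1) → EuclideanSpace ℝ (Fin d) → ℝ := fun q x =>
    ‖iteratedFDeriv ℝ q.2 (F q.1) x - iteratedFDeriv ℝ q.2 (F' q.1) x‖
  have hw : ∀ q, AEStronglyMeasurable (w q) (volume.restrict Ω) := fun q =>
    ((aestronglyMeasurable_iteratedFDeriv (hF q.1) q.2 _).sub
      (aestronglyMeasurable_iteratedFDeriv (hF' q.1) q.2 _)).norm
  have hwp : ∀ q, eLpNorm (w q) p ((volume.restrict Ω).restrict (tsupport (χ q.1)))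
      ≤ ENNReal.ofReal (η + η') := fun q => (eLpNorm_norm _).trans_le (hFF q.1 q.2)
  have hle := norm_iteratedFDeriv_sum_smul_sub_le hχ hM hM0 hF hF' n
  calc _ ≤ ∑ q : ι × Fin (s + 1), ENNReal.ofReal |2 ^ s * M| *
        eLpNorm (w q) p ((volume.restrict Ω).restrict (tsupport (χ q.1))) :=
        eLpNorm_le_sum_restrict hp hw (fun q => hTm q.1) (.of_forall hle)
    _ ≤ ∑ q : ι × Fin (s + 1), ENNReal.ofReal (2 ^ s * M) * ENNReal.ofReal (η + η') := by
        refine Finset.sum_le_sum fun q _ => ?_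
        rw [abs_of_nonneg (by positivity)]
        exact mul_le_mul_right (hwp q) _
    _ = _ := by
        rw [Finset.sum_const, Finset.card_univ, nsmul_eq_mul, ← ENNReal.ofReal_mul (by positivity),
          ← ENNReal.ofReal_natCast, ← ENNReal.ofReal_mul (by positivity),
          ← mul_assoc (Fintype.card (ι × Fin (s + 1)) : ℝ)]

/-- Derivatives of order zero can be compared with the limit directly, since no product rule is
involved. This identifies the function in the limit of the glued approximants. -/
theorem eLpNorm_sum_smul_sub_le (hp : 1 ≤ p) (hΩ : MeasurableSet Ω) {ι F : Type*} [Fintype ι]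
    [NormedAddCommGroup F] [NormedSpace ℝ F] {χ : ι → EuclideanSpace ℝ (Fin d) → ℝ} {M : ℝ}
    (hM : ∀ i x, ‖χ i x‖ ≤ M) (hM0 : 0 ≤ M) (hsum : ∀ x ∈ Ω, ∑ i, χ i x = 1)
    {f : ι → EuclideanSpace ℝ (Fin d) → F} {g : EuclideanSpace ℝ (Fin d) → F}
    (hf : ∀ i, AEStronglyMeasurable (f i) (volume.restrict Ω))
    (hg : AEStronglyMeasurable g (volume.restrict Ω)) {η : ℝ}
    (hfg : ∀ i, eLpNorm (fun x => f i x - g x) p (volume.restrict (Ω ∩ tsupport (χ i)))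
      ≤ ENNReal.ofReal η) :
    eLpNorm (fun x => (∑ i, χ i x • f i x) - g x) p (volume.restrict Ω)
      ≤ ENNReal.ofReal (Fintype.card ι * M * η) := by
  have hTm : ∀ i, MeasurableSet (tsupport (χ i)) := fun i => (isClosed_tsupport _).measurableSet
  calc _ ≤ ∑ i, ENNReal.ofReal |M| * eLpNorm (fun x => ‖f i x - g x‖) p
        ((volume.restrict Ω).restrict (tsupport (χ i))) := by
        refine eLpNorm_le_sum_restrict hp (fun i => ((hf i).sub hg).norm) hTm ?_
        filter_upwards [ae_restrict_mem hΩ] with x hx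
        have e1 : (∑ i, χ i x • f i x) - g x = ∑ i, χ i x • (f i x - g x) := by
          simp only [smul_sub, Finset.sum_sub_distrib]
          rw [← Finset.sum_smul, hsum x hx, one_smul]
        rw [e1]
        refine (norm_sum_le _ _).trans (Finset.sum_le_sum fun i _ => ?_)
        by_cases hxi : x ∈ tsupport (χ i)
        · rw [Set.indicator_of_mem hxi, norm_smul]
          exact mul_le_mul_of_nonneg_right (hM i x) (norm_nonneg _)
        · rw [image_eq_zero_of_notMem_tsupport hxi, zero_smul, norm_zero,
            Set.indicator_of_notMem hxi, mul_zero]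
    _ ≤ ∑ i : ι, ENNReal.ofReal M * ENNReal.ofReal η := by
        refine Finset.sum_le_sum fun i _ => ?_
        rw [abs_of_nonneg hM0, eLpNorm_norm, Measure.restrict_restrict (hTm i), Set.inter_comm]
        exact mul_le_mul_right (hfg i) _
    _ = _ := by
        rw [Finset.sum_const, Finset.card_univ, nsmul_eq_mul, ← ENNReal.ofReal_mul (by positivity),
          ← ENNReal.ofReal_natCast, ← ENNReal.ofReal_mul (by positivity), mul_assoc]

theorem LpJet.norm_sub_le [Fact (1 ≤ p)] {n : ℕ} {g g' : LpJet Ω p k n}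
    {f f' : EuclideanSpace ℝ (Fin d) → (EuclideanSpace ℝ (Fin d) [×n]→L[ℝ] EuclideanSpace ℝ (Fin k))}
    (h : g =ᵐ[volume.restrict Ω] f) (h' : g' =ᵐ[volume.restrict Ω] f') {B : ℝ} (hB : 0 ≤ B)
    (hff : eLpNorm (fun x => f x - f' x) p (volume.restrict Ω) ≤ ENNReal.ofReal B) :
    ‖g - g'‖ ≤ B := by
  rw [Lp.norm_def]
  refine ENNReal.toReal_le_of_le_ofReal hB ?_
  rwa [eLpNorm_congr_ae ((Lp.coeFn_sub g g').trans (h.sub h'))]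

/-- The glued mollifications form a Cauchy sequence, so they converge in the complete space
`W^{s,p}`. The limit has the right function as zeroth component, and uniqueness of weak derivatives
determines the other components. -/
theorem denseRange_toWSpace [hp : Fact (1 ≤ p)] (hpt : p ≠ ⊤) (hΩ : IsBoundedLipschitzDomain Ω) :
    DenseRange (toWSpace (k := k) hΩ.isBounded s p) := by
  intro J
  have hΩm := hΩ.isOpen.measurableSet
  obtain ⟨ι, _, χ, e, r, hr, hχ, hχc, hsum, hin⟩ := hΩ.exists_partition
  obtain ⟨M, hM0, hM⟩ := exists_bound_iteratedFDeriv hχ hχc s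
  choose F hF hFJ using fun (N : ℕ) (i : ι) =>
    exists_contDiff_near_of_isWeakDeriv hpt hΩ (J.integrableOn_toFun hΩ.isBounded) J.2
      (isClosed_tsupport (χ i)) hr (hin i) (η := 1 / ((N : ℝ) + 1)) (by positivity)
  have hfs : ∀ N, ContDiff ℝ ∞ fun x => ∑ i, χ i x • F N i x := fun N =>
    ContDiff.sum fun i _ => (hχ i).smul (hF N i)
  let f : ℕ → SmoothFun d k := fun N => ⟨fun x => ∑ i, χ i x • F N i x, hfs N⟩
  set C : ℝ := Fintype.card (ι × Fin (s + 1)) * (2 ^ s * M)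
  have hC0 : 0 ≤ C := by positivity
  have hcauchy : ∀ N N' : ℕ, ‖toWSpace hΩ.isBounded s p (f N) - toWSpace hΩ.isBounded s p (f N')‖
      ≤ C * (1 / ((N : ℝ) + 1) + 1 / ((N' : ℝ) + 1)) := by
    intro N N'
    have hB : 0 ≤ C * (1 / ((N : ℝ) + 1) + 1 / ((N' : ℝ) + 1)) := by positivity
    refine (pi_norm_le_iff_of_nonneg hB).2 fun n => ?_
    exact LpJet.norm_sub_le (coeFn_toWSpace hΩ.isBounded (f N) n)
      (coeFn_toWSpace hΩ.isBounded (f N') n) hB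
      (eLpNorm_iteratedFDeriv_sum_smul_sub_le hp.out hχ hM hM0 (hF N) (hF N')
        (by positivity) (by positivity) (hFJ N) (hFJ N') n)
  have hlim : Filter.Tendsto (fun N : ℕ => 1 / ((N : ℝ) + 1)) Filter.atTop (nhds 0) :=
    tendsto_one_div_add_atTop_nhds_zero_nat
  have hseq : CauchySeq fun N => toWSpace hΩ.isBounded s p (f N) := by
    refine cauchySeq_of_le_tendsto_0 (fun N => C * (1 / ((N : ℝ) + 1) + 1 / ((N : ℝ) + 1)))
      (fun n m N hn hm => ?_) (by simpa using (hlim.add hlim).const_mul C)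
    rw [dist_eq_norm]
    refine (hcauchy n m).trans ?_
    gcongr
  have := completeSpace_WSpace (s := s) (k := k) (p := p) hΩ.isBounded
  obtain ⟨J', hJ'⟩ := cauchySeq_tendsto_of_complete hseq
  have hzero : ∀ N, ‖(toWSpace hΩ.isBounded s p (f N)).1 0 - J.1 0‖
      ≤ Fintype.card ι * M * (1 / ((N : ℝ) + 1)) := by
    intro N
    refine LpJet.norm_sub_le (coeFn_toWSpace hΩ.isBounded (f N) 0) Filter.EventuallyEq.rfl
      (by positivity) ?_
    have hχM : ∀ i x, ‖χ i x‖ ≤ M := fun i x => by simpa using hM i 0 (Nat.zero_le _) x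
    refine le_of_eq_of_le ?_ (eLpNorm_sum_smul_sub_le hp.out hΩm hχM hM0 hsum
      (fun i => aestronglyMeasurable_iteratedFDeriv (hF N i) _ _)
      (Lp.stronglyMeasurable (J.1 0)).aestronglyMeasurable fun i => hFJ N i 0)
    congr 1
    ext1 x
    congr 1
    ext m : 1
    rw [sum_apply]
    rfl
  have hJ0 : J'.1 0 = J.1 0 := by
    refine tendsto_nhds_unique (f := fun N => (toWSpace hΩ.isBounded s p (f N)).1 0)
      (l := Filter.atTop) ?_ ?_
    · exact ((continuous_apply (0 : Fin (s + 1))).comp continuous_subtype_val).continuousAt.tendsto.comp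
        hJ'
    · rw [tendsto_iff_norm_sub_tendsto_zero]
      exact squeeze_zero (fun _ => norm_nonneg _) hzero
        (by simpa using hlim.const_mul (Fintype.card ι * M : ℝ))
  -- No convergence of the higher derivatives to those of `J` has been shown; it follows because an
  -- element of `W^{s,p}` is determined by its function.
  have hJJ : J' = J := WSpace.ext_of_ae_eq hΩ.isOpen J' J (by
    refine .of_forall fun x => ?_
    change J'.1 0 x 0 = J.1 0 x 0
    rw [hJ0])
  rw [← hJJ]
  exact mem_closure_of_tendsto hJ' (.of_forall fun N => ⟨f N, rfl⟩)

end

/-! ### Networks with one hidden layer -/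

section

variable {σ : ℝ → ℝ} {m n : ℕ}

/-- The scalar functions computed by networks with one hidden layer and without output bias. -/
def shallowSpan (σ : ℝ → ℝ) (m : ℕ) : Submodule ℝ ((Fin m → ℝ) → ℝ) :=
  Submodule.span ℝ (Set.range fun q : (Fin m → ℝ) × ℝ => fun z => σ (q.1 ⬝ᵥ z + q.2))

/-- All outputs share one hidden layer, whose neurons are the union of the ridge functions occurring
in any of them; absent ones get coefficient zero. -/
theorem exists_neuralNet_eval_eq {f : Fin n → (Fin m → ℝ) → ℝ}
    (hf : ∀ i, f i ∈ shallowSpan σ m) :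
    ∃ N : NeuralNet m n, ∀ z i, N.eval σ z i = f i z := by
  classical
  choose c hc using fun i => Finsupp.mem_span_range_iff_exists_finsupp.1 (hf i)
  set S : Finset ((Fin m → ℝ) × ℝ) := Finset.univ.biUnion fun i => (c i).support
  refine ⟨.shallow (Matrix.of fun a => (S.equivFin.symm a).1.1) (fun a => (S.equivFin.symm a).1.2)
    (Matrix.of fun i a => c i (S.equivFin.symm a).1) 0, fun z i => ?_⟩
  have e1 : f i z = ∑ q ∈ S, c i q * σ (q.1 ⬝ᵥ z + q.2) := by
    rw [← hc i, Finsupp.sum, Finset.sum_apply]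
    refine Finset.sum_subset (Finset.subset_biUnion_of_mem (fun i => (c i).support)
      (Finset.mem_univ i)) fun q _ hq => ?_
    rw [Finsupp.notMem_support_iff.1 hq]
    simp
  rw [e1, ← Finset.sum_coe_sort S, ← S.equivFin.symm.sum_comp]
  simp [NeuralNet.eval, Matrix.mulVec, dotProduct]

theorem comp_dotProduct_add_mem_shallowSpan {g : ℝ → ℝ} (hg : g ∈ ridgeSpan σ) (α : Fin m → ℝ)
    (β : ℝ) : (fun z => g (α ⬝ᵥ z + β)) ∈ shallowSpan σ m := by
  refine Submodule.span_induction (p := fun g _ => (fun z => g (α ⬝ᵥ z + β)) ∈ shallowSpan σ m)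
    ?_ ?_ ?_ ?_ hg
  · rintro _ ⟨p, rfl⟩
    refine Submodule.subset_span ⟨(p.1 • α, p.1 * β + p.2), ?_⟩
    ext z
    simp only [smul_dotProduct, smul_eq_mul]
    ring_nf
  · exact Submodule.zero_mem _
  · intro f g _ _ hf hg
    exact Submodule.add_mem _ hf hg
  · intro a f _ hf
    exact Submodule.smul_mem _ a hf

/-- Lipschitz growth is what makes lifted functions integrable, and their integrals `L¹`-continuous,
for inputs that are merely integrable. -/
theorem exists_lipschitz_of_mem_shallowSpan (hσ : ∃ C, LipschitzWith C σ)
    {R : (Fin m → ℝ) → ℝ} (hR : R ∈ shallowSpan σ m) : ∃ C, LipschitzWith C R := by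
  obtain ⟨C, hC⟩ := hσ
  refine Submodule.span_induction (p := fun R _ => ∃ C, LipschitzWith C R) ?_ ?_ ?_ ?_ hR
  · rintro _ ⟨q, rfl⟩
    let T : (Fin m → ℝ) →L[ℝ] ℝ := LinearMap.toContinuousLinearMap (dotProductBilin ℝ ℝ q.1)
    exact ⟨_, hC.comp (T.lipschitz.add (LipschitzWith.const q.2))⟩
  · exact ⟨0, LipschitzWith.const 0⟩
  · rintro f g _ _ ⟨C, hf⟩ ⟨C', hg⟩
    exact ⟨_, hf.add hg⟩
  · rintro a f _ ⟨C, hf⟩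
    exact ⟨_, (lipschitzWith_smul a).comp hf⟩

/-- Networks with one hidden layer approximate continuous functions uniformly on compact sets. -/
theorem exists_mem_shallowSpan_near (hσ : IsActivation σ) {H : (Fin m → ℝ) → ℝ}
    (hH : Continuous H) {B : Set (Fin m → ℝ)} (hB : IsCompact B) {ε : ℝ} (hε : 0 < ε) :
    ∃ R ∈ shallowSpan σ m, ∀ z ∈ B, |R z - H z| ≤ ε := by
  let V : Submodule ℝ C(Fin m → ℝ, ℝ) :=
    { carrier := {l | ∃ α : Fin m → ℝ, ∀ z, l z = α ⬝ᵥ z}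
      add_mem' := by
        rintro l l' ⟨α, h⟩ ⟨α', h'⟩
        exact ⟨α + α', fun z => by rw [ContinuousMap.add_apply, h, h', add_dotProduct]⟩
      zero_mem' := ⟨0, fun z => by simp⟩
      smul_mem' := by
        rintro c l ⟨α, h⟩
        exact ⟨c • α, fun z => by rw [ContinuousMap.smul_apply, h, smul_dotProduct]⟩ }
  have hV : ∀ x y : Fin m → ℝ, x ≠ y → ∃ l ∈ V, l x ≠ l y := by
    intro x y hxy
    obtain ⟨i, hi⟩ := Function.ne_iff.1 hxy
    exact ⟨⟨fun z => z i, continuous_apply i⟩, ⟨Pi.single i 1, fun z => by simp⟩, hi⟩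
  obtain ⟨N, c, l, hl, h⟩ := exists_exp_sum_near V hV ⟨H, hH⟩ hB (half_pos hε)
  choose α hα using hl
  obtain ⟨M, hM⟩ : ∃ M : ℝ, ∀ i, ∀ z ∈ B, |l i z| ≤ M := by
    choose M hM using fun i => hB.exists_bound_of_continuousOn (l i).continuous.continuousOn
    exact ⟨∑ i, |M i|, fun i z hz => (hM i z hz).trans ((le_abs_self _).trans
      (Finset.single_le_sum (fun i _ => abs_nonneg (M i)) (Finset.mem_univ i)))⟩
  set S : ℝ := ∑ i, |c i|
  have hS : 0 ≤ S := Finset.sum_nonneg fun i _ => abs_nonneg _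
  -- Order `0` suffices here: the lifting network is only ever integrated, so no derivatives of it
  -- matter.
  obtain ⟨g, hg, hexp⟩ := (exp_mem_ridgeClosure hσ).2 0 M (ε / 2 / (S + 1)) (by positivity)
  refine ⟨∑ i, c i • fun z => g (α i ⬝ᵥ z + 0), Submodule.sum_mem _ fun i _ =>
    Submodule.smul_mem _ _ (comp_dotProduct_add_mem_shallowSpan hg _ _), fun z hz => ?_⟩
  have e1 : (∑ i, c i • fun z => g (α i ⬝ᵥ z + 0)) z = ∑ i, c i * g (l i z) := by
    rw [Finset.sum_apply]
    exact Finset.sum_congr rfl fun i _ => by rw [hα i z]; simp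
  have h2 : |∑ i, c i * g (l i z) - ∑ i, c i * Real.exp (l i z)| ≤ ε / 2 := by
    rw [← Finset.sum_sub_distrib]
    calc _ ≤ ∑ i, |c i| * (ε / 2 / (S + 1)) := by
          refine (Finset.abs_sum_le_sum_abs _ _).trans (Finset.sum_le_sum fun i _ => ?_)
          rw [← mul_sub, abs_mul, abs_sub_comm]
          have := hexp 0 le_rfl (l i z) (hM i z hz)
          rw [iteratedDeriv_zero] at this
          exact mul_le_mul_of_nonneg_left this (abs_nonneg _)
      _ = ε / 2 * (S / (S + 1)) := by rw [← Finset.sum_mul]; ring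
      _ ≤ ε / 2 * 1 := by
          gcongr
          exact (div_le_one (by linarith)).2 (by linarith)
      _ = ε / 2 := mul_one _
  rw [e1]
  have h3 := h z hz
  calc _ ≤ _ := abs_sub_le _ (∑ i, c i * Real.exp (l i z)) _
    _ ≤ ε / 2 + ε / 2 := add_le_add h2 h3
    _ = ε := add_halves ε

end

/-! ### The integral functionals computed by a lifting network followed by a kernel layer -/

section

variable {σ : ℝ → ℝ} {d k : ℕ} {Ω : Set (EuclideanSpace ℝ (Fin d))}
  {T : Type} [TopologicalSpace T] {v : T → EuclideanSpace ℝ (Fin d) → EuclideanSpace ℝ (Fin k)}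

theorem norm_append_sub_append_le (a b : EuclideanSpace ℝ (Fin k)) (y : EuclideanSpace ℝ (Fin d)) :
    ‖Fin.append a.ofLp y.ofLp - Fin.append b.ofLp y.ofLp‖ ≤ ‖a - b‖ := by
  refine (pi_norm_le_iff_of_nonneg (norm_nonneg _)).2 fun i => ?_
  refine Fin.addCases (fun i => ?_) (fun i => ?_) i
  · simpa using PiLp.norm_apply_le (a - b) i
  · simp

theorem continuous_append_ofLp :
    Continuous fun q : EuclideanSpace ℝ (Fin k) × EuclideanSpace ℝ (Fin d) =>
      Fin.append q.1.ofLp q.2.ofLp := by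
  refine continuous_pi fun i => ?_
  refine Fin.addCases (fun i => ?_) (fun i => ?_) i
  · simp only [Fin.append_left]
    fun_prop
  · simp only [Fin.append_right]
    fun_prop

theorem aestronglyMeasurable_comp_append {H : (Fin (k + d) → ℝ) → ℝ} (hH : Continuous H)
    {u : EuclideanSpace ℝ (Fin d) → EuclideanSpace ℝ (Fin k)}
    (hu : AEStronglyMeasurable u (volume.restrict Ω)) :
    AEStronglyMeasurable (fun y => H (Fin.append (u y).ofLp y.ofLp)) (volume.restrict Ω) :=
  (hH.comp continuous_append_ofLp).comp_aestronglyMeasurable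
    (hu.prodMk aestronglyMeasurable_id)

theorem integrableOn_comp_append (hΩ : Bornology.IsBounded Ω) (hΩm : MeasurableSet Ω)
    {R : (Fin (k + d) → ℝ) → ℝ}
    {C : NNReal} (hR : LipschitzWith C R) {u : EuclideanSpace ℝ (Fin d) → EuclideanSpace ℝ (Fin k)}
    (hu : IntegrableOn u Ω) : IntegrableOn (fun y => R (Fin.append (u y).ofLp y.ofLp)) Ω := by
  have := isFiniteMeasure_restrict_of_isBounded hΩ
  obtain ⟨B, hB⟩ := hΩ.isCompact_closure.exists_bound_of_continuousOn
    ((hR.continuous.comp (continuous_append_ofLp.comp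
      ((continuous_const (y := (0 : EuclideanSpace ℝ (Fin k)))).prodMk continuous_id))).continuousOn)
  refine ((integrable_const B).add (hu.norm.const_mul C)).mono'
    (aestronglyMeasurable_comp_append hR.continuous hu.aestronglyMeasurable) ?_
  filter_upwards [ae_restrict_mem hΩm] with y hy
  have h1 := hR.dist_le_mul (Fin.append (u y).ofLp y.ofLp)
    (Fin.append (0 : EuclideanSpace ℝ (Fin k)).ofLp y.ofLp)
  have h2 := norm_append_sub_append_le (u y) 0 y
  rw [sub_zero] at h2
  rw [dist_eq_norm, dist_eq_norm] at h1
  calc _ ≤ _ := norm_le_norm_add_norm_sub' _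
        (R (Fin.append (0 : EuclideanSpace ℝ (Fin k)).ofLp y.ofLp))
    _ ≤ B + C * ‖u y‖ := add_le_add (hB y (subset_closure hy)) (h1.trans (by gcongr))

theorem continuous_integral_comp_append (hΩ : Bornology.IsBounded Ω) (hΩm : MeasurableSet Ω)
    (hvi : ∀ t, IntegrableOn (v t) Ω)
    (hvc : ∀ t₀, Filter.Tendsto (fun t => ∫ y in Ω, ‖v t y - v t₀ y‖) (nhds t₀) (nhds 0))
    {R : (Fin (k + d) → ℝ) → ℝ} {C : NNReal} (hR : LipschitzWith C R) :
    Continuous fun t => ∫ y in Ω, R (Fin.append (v t y).ofLp y.ofLp) := by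
  refine continuous_iff_continuousAt.2 fun t₀ => ?_
  refine tendsto_iff_norm_sub_tendsto_zero.2 (squeeze_zero (fun _ => norm_nonneg _) (fun t => ?_)
    (by simpa using (hvc t₀).const_mul (C : ℝ)))
  rw [← integral_sub (integrableOn_comp_append hΩ hΩm hR (hvi t))
    (integrableOn_comp_append hΩ hΩm hR (hvi t₀)), ← integral_const_mul]
  refine norm_integral_le_of_norm_le (((hvi t).sub (hvi t₀)).norm.const_mul _)
    (.of_forall fun y => ?_)
  rw [← dist_eq_norm]
  refine (hR.dist_le_mul _ _).trans ?_
  rw [dist_eq_norm]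
  exact mul_le_mul_of_nonneg_left (norm_append_sub_append_le _ _ _) C.2

/-- If all lifting functionals agree on two bounded functions, then so do all functionals given by
continuous integrands. -/
theorem integral_comp_append_eq (hσ : IsActivation σ) (hΩ : Bornology.IsBounded Ω)
    (hΩm : MeasurableSet Ω) {u u' : EuclideanSpace ℝ (Fin d) → EuclideanSpace ℝ (Fin k)}
    (hu : IntegrableOn u Ω) (hu' : IntegrableOn u' Ω) {M : ℝ}
    (hM : ∀ᵐ x ∂volume.restrict Ω, ‖u x‖ ≤ M) (hM' : ∀ᵐ x ∂volume.restrict Ω, ‖u' x‖ ≤ M)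
    (h : ∀ R ∈ shallowSpan σ (k + d), ∫ y in Ω, R (Fin.append (u y).ofLp y.ofLp)
      = ∫ y in Ω, R (Fin.append (u' y).ofLp y.ofLp))
    {H : (Fin (k + d) → ℝ) → ℝ} (hH : Continuous H) :
    ∫ y in Ω, H (Fin.append (u y).ofLp y.ofLp) = ∫ y in Ω, H (Fin.append (u' y).ofLp y.ofLp) := by
  have := isFiniteMeasure_restrict_of_isBounded hΩ
  set B : Set (Fin (k + d) → ℝ) :=
    (fun q : EuclideanSpace ℝ (Fin k) × EuclideanSpace ℝ (Fin d) =>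
      Fin.append q.1.ofLp q.2.ofLp) '' (Metric.closedBall 0 M ×ˢ closure Ω)
  have hB : IsCompact B := ((isCompact_closedBall _ _).prod hΩ.isCompact_closure).image
    continuous_append_ofLp
  obtain ⟨D, hD⟩ := hB.exists_bound_of_continuousOn hH.continuousOn
  have hmem : ∀ {u : EuclideanSpace ℝ (Fin d) → EuclideanSpace ℝ (Fin k)},
      (∀ᵐ x ∂volume.restrict Ω, ‖u x‖ ≤ M) →
      ∀ᵐ y ∂volume.restrict Ω, Fin.append (u y).ofLp y.ofLp ∈ B := by
    intro u hM
    filter_upwards [hM, ae_restrict_mem hΩm] with y h1 h2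
    exact ⟨(u y, y), ⟨by simpa using h1, subset_closure h2⟩, rfl⟩
  have hnear : ∀ {u : EuclideanSpace ℝ (Fin d) → EuclideanSpace ℝ (Fin k)}, IntegrableOn u Ω →
      (∀ᵐ x ∂volume.restrict Ω, ‖u x‖ ≤ M) → ∀ {R ε}, R ∈ shallowSpan σ (k + d) →
      (∀ z ∈ B, |R z - H z| ≤ ε) →
      |(∫ y in Ω, R (Fin.append (u y).ofLp y.ofLp)) - ∫ y in Ω, H (Fin.append (u y).ofLp y.ofLp)|
        ≤ ε * (volume.restrict Ω).real Set.univ := by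
    intro u hu hM R ε hR hRH
    obtain ⟨C, hC⟩ := exists_lipschitz_of_mem_shallowSpan hσ.lipschitz hR
    have hHi : IntegrableOn (fun y => H (Fin.append (u y).ofLp y.ofLp)) Ω := by
      refine (integrable_const D).mono' (aestronglyMeasurable_comp_append hH
        hu.aestronglyMeasurable) ?_
      filter_upwards [hmem hM] with y hy
      exact hD _ hy
    rw [← integral_sub (integrableOn_comp_append hΩ hΩm hC hu) hHi, ← Real.norm_eq_abs]
    refine norm_integral_le_of_norm_le_const (μ := volume.restrict Ω) ?_
    filter_upwards [hmem hM] with y hy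
    exact hRH _ hy
  refine eq_of_abs_sub_le_all fun ε hε => ?_
  set V : ℝ := (volume.restrict Ω).real Set.univ
  have hV : 0 ≤ V := measureReal_nonneg
  obtain ⟨R, hR, hRH⟩ := exists_mem_shallowSpan_near hσ hH hB
    (show 0 < ε / 2 / (V + 1) by positivity)
  have h1 := hnear hu hM hR hRH
  have h2 := hnear hu' hM' hR hRH
  rw [h R hR] at h1
  have h3 : ε / 2 / (V + 1) * V ≤ ε / 2 := by
    rw [div_mul_eq_mul_div]
    exact (div_le_iff₀ (by linarith)).2 (by nlinarith)
  rw [abs_sub_comm] at h1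
  calc _ ≤ _ := abs_sub_le _ (∫ y in Ω, R (Fin.append (u' y).ofLp y.ofLp)) _
    _ ≤ ε / 2 + ε / 2 := add_le_add (h1.trans h3) (h2.trans h3)
    _ = ε := add_halves ε

/-- The lifting functionals separate bounded functions. -/
theorem ae_eq_of_integral_comp_append_eq (hσ : IsActivation σ) (hΩ : Bornology.IsBounded Ω)
    (hΩo : IsOpen Ω) {u u' : EuclideanSpace ℝ (Fin d) → EuclideanSpace ℝ (Fin k)}
    (hu : IntegrableOn u Ω) (hu' : IntegrableOn u' Ω) {M : ℝ}
    (hM : ∀ᵐ x ∂volume.restrict Ω, ‖u x‖ ≤ M) (hM' : ∀ᵐ x ∂volume.restrict Ω, ‖u' x‖ ≤ M)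
    (h : ∀ R ∈ shallowSpan σ (k + d), ∫ y in Ω, R (Fin.append (u y).ofLp y.ofLp)
      = ∫ y in Ω, R (Fin.append (u' y).ofLp y.ofLp)) :
    u =ᵐ[volume.restrict Ω] u' := by
  have hΩm := hΩo.measurableSet
  have hloc : LocallyIntegrableOn (u - u') Ω := (hu.sub hu').locallyIntegrableOn
  have hz := hΩo.ae_eq_zero_of_integral_contDiff_smul_eq_zero hloc fun φ hφ hφc hφΩ => by
    have hi : ∀ {u : EuclideanSpace ℝ (Fin d) → EuclideanSpace ℝ (Fin k)}, IntegrableOn u Ω →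
        IntegrableOn (fun y => φ y • u y) Ω := by
      intro u hu
      obtain ⟨D, hD⟩ := hφ.continuous.bounded_above_of_compact_support hφc
      exact hu.bdd_smul D hφ.continuous.aestronglyMeasurable (.of_forall hD)
    have e1 : ∫ x, φ x • (u - u') x = ∫ x in Ω, φ x • (u - u') x := by
      refine (setIntegral_eq_integral_of_forall_compl_eq_zero fun x hx => ?_).symm
      rw [image_eq_zero_of_notMem_tsupport fun h => hx (hφΩ h), zero_smul]
    have e2 : ∫ x in Ω, φ x • (u - u') x = (∫ x in Ω, φ x • u x) - ∫ x in Ω, φ x • u' x := by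
      rw [← integral_sub (hi hu) (hi hu')]
      simp only [Pi.sub_apply, smul_sub]
    rw [e1, e2, sub_eq_zero]
    ext i
    have e3 : ∀ {u : EuclideanSpace ℝ (Fin d) → EuclideanSpace ℝ (Fin k)}, IntegrableOn u Ω →
        (∫ x in Ω, φ x • u x) i = ∫ x in Ω, φ x * u x i := fun hu =>
      ((EuclideanSpace.proj (𝕜 := ℝ) i).integral_comp_comm (hi hu)).symm
    rw [e3 hu, e3 hu']
    -- The integrand testing the `i`-th component against `φ`, read as a continuous function of the
    -- pair of value and position.
    have hH : Continuous fun z : Fin (k + d) → ℝ =>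
        φ (WithLp.toLp 2 fun j => z (Fin.natAdd k j)) * z (Fin.castAdd d i) := by
      refine (hφ.continuous.comp ?_).mul (continuous_apply _)
      exact (PiLp.continuous_toLp 2 _).comp (continuous_pi fun j => continuous_apply _)
    have := integral_comp_append_eq hσ hΩ hΩm hu hu' hM hM' h hH
    simpa using this
  rw [Filter.EventuallyEq, ae_restrict_iff' hΩm]
  filter_upwards [hz] with x hx hxΩ
  exact sub_eq_zero.1 (hx hxΩ)

end

/-! ### Continuous maps on compact spaces as limits of finite sums -/

section

variable {T F : Type*} [TopologicalSpace T] [CompactSpace T] [NormedAddCommGroup F]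
  [NormedSpace ℝ F]

/-- Continuous maps on a compact space are uniform limits of maps of finite rank. -/
theorem exists_sum_smul_near (G : C(T, F)) {ε : ℝ} (hε : 0 < ε) :
    ∃ (S : Finset F) (β : F → C(T, ℝ)), ∀ t, ‖G t - ∑ η ∈ S, β η t • η‖ ≤ ε := by
  obtain ⟨S, hS⟩ := (isCompact_range G.continuous).elim_finite_subcover
    (fun η => Metric.ball η ε) (fun _ => Metric.isOpen_ball)
    fun y _ => Set.mem_iUnion.2 ⟨y, Metric.mem_ball_self hε⟩
  -- Tent functions around the centres of a finite `ε`-net of the range; normalised, they form a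
  -- partition of unity that gives weight only to centres within `ε` of `G t`.
  set w : F → T → ℝ := fun η t => max 0 (ε - ‖G t - η‖) with hw
  have hw0 : ∀ η t, 0 ≤ w η t := fun η t => le_max_left _ _
  have hwc : ∀ η, Continuous (w η) := fun η => by fun_prop
  have hpos : ∀ t, 0 < ∑ η ∈ S, w η t := by
    intro t
    obtain ⟨η, hη, ht⟩ := Set.mem_iUnion₂.1 (hS ⟨t, rfl⟩)
    refine Finset.sum_pos' (fun η _ => hw0 η t) ⟨η, hη, lt_max_of_lt_right ?_⟩
    rw [Metric.mem_ball, dist_eq_norm] at ht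
    linarith
  refine ⟨S, fun η => ⟨fun t => w η t / ∑ η ∈ S, w η t, (hwc η).div
    (continuous_finsetSum _ fun η _ => hwc η) fun t => (hpos t).ne'⟩, fun t => ?_⟩
  simp only [ContinuousMap.coe_mk]
  have h1 : ∑ η ∈ S, w η t / ∑ η ∈ S, w η t = 1 := by
    rw [← Finset.sum_div, div_self (hpos t).ne']
  have e1 : G t - ∑ η ∈ S, (w η t / ∑ η ∈ S, w η t) • η
      = ∑ η ∈ S, (w η t / ∑ η ∈ S, w η t) • (G t - η) := by
    simp only [smul_sub, Finset.sum_sub_distrib]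
    rw [← Finset.sum_smul, h1, one_smul]
  rw [e1]
  calc _ ≤ ∑ η ∈ S, w η t / (∑ η ∈ S, w η t) * ε := by
        refine (norm_sum_le _ _).trans (Finset.sum_le_sum fun η _ => ?_)
        rw [norm_smul, Real.norm_of_nonneg (div_nonneg (hw0 η t) (hpos t).le)]
        by_cases h : ‖G t - η‖ ≤ ε
        · exact mul_le_mul_of_nonneg_left h (div_nonneg (hw0 η t) (hpos t).le)
        · have : w η t = 0 := max_eq_left (by linarith)
          simp [this]
    _ = ε := by rw [← Finset.sum_mul, h1, one_mul]

/-- Products of a dense set of scalar functions and a dense set of vectors span a dense subspace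
of the continuous maps. -/
theorem dense_span_smul [LocallyCompactPair T ℝ] {A : Set C(T, ℝ)} {D : Set F}
    (hA : Dense (Submodule.span ℝ A : Set C(T, ℝ))) (hD : Dense (Submodule.span ℝ D : Set F)) :
    Dense (Submodule.span ℝ {g : C(T, F) | ∃ β ∈ A, ∃ η ∈ D, ∀ t, g t = β t • η} :
      Set C(T, F)) := by
  set P := Submodule.span ℝ {g : C(T, F) | ∃ β ∈ A, ∃ η ∈ D, ∀ t, g t = β t • η}
  let m : C(T, ℝ) → F → C(T, F) := fun β η => ⟨fun t => β t • η, by fun_prop⟩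
  have hm : Continuous (Function.uncurry m) := by
    refine ContinuousMap.continuous_of_continuous_uncurry _ ?_
    have : Continuous fun q : (C(T, ℝ) × F) × T => q.1.1 q.2 :=
      ContinuousEval.continuous_eval.comp ((continuous_fst.comp continuous_fst).prodMk continuous_snd)
    exact this.smul (continuous_snd.comp continuous_fst)
  have hmP : ∀ β ∈ Submodule.span ℝ A, ∀ η ∈ Submodule.span ℝ D, m β η ∈ P := by
    intro β hβ η hη
    induction hβ using Submodule.span_induction with
    | mem β hβ =>
      induction hη using Submodule.span_induction with
      | mem η hη => exact Submodule.subset_span ⟨β, hβ, η, hη, fun t => rfl⟩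
      | zero =>
        convert P.zero_mem
        ext t
        simp [m]
      | add x y _ _ hx hy =>
        convert P.add_mem hx hy
        ext t
        simp [m]
      | smul a x _ hx =>
        convert P.smul_mem a hx
        ext t
        simp [m, smul_comm a]
    | zero =>
      convert P.zero_mem
      ext t
      simp [m]
    | add x y _ _ hx hy =>
      convert P.add_mem hx hy
      ext t
      simp [m, add_smul]
    | smul a x _ hx =>
      convert P.smul_mem a hx
      ext t
      simp [m, mul_smul]
  -- Joint continuity of the product passes from the two spans to their closures, which are
  -- everything. Thus all maps of finite rank lie in the closure of `P`.
  have hmc : ∀ β η, m β η ∈ P.topologicalClosure := fun β η =>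
    map_mem_closure₂ hm (hA β) (hD η) hmP
  intro G
  rw [← closure_closure]
  refine Metric.mem_closure_iff.2 fun ε hε => ?_
  obtain ⟨S, β, h⟩ := exists_sum_smul_near G (half_pos hε)
  refine ⟨∑ η ∈ S, m (β η) η, P.topologicalClosure.sum_mem fun η _ => hmc _ _, ?_⟩
  refine lt_of_le_of_lt ?_ (half_lt_self hε)
  rw [dist_eq_norm]
  refine (ContinuousMap.norm_le _ (half_pos hε).le).2 fun t => ?_
  rw [ContinuousMap.sub_apply, ContinuousMap.sum_apply]
  exact h t

end

/-! ### Realisation by a neural operator with a single layer -/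

section

variable {σ : ℝ → ℝ} {d k k' n : ℕ} {Ω : Set (EuclideanSpace ℝ (Fin d))}

theorem IsActivation.exists_deriv_ne_zero (hσ : IsActivation σ) : ∃ b, deriv σ b ≠ 0 := by
  by_contra! h
  refine hσ.nonpolynomial ⟨Polynomial.C (σ 0), fun t => ?_⟩
  rw [Polynomial.eval_C]
  exact is_const_of_deriv_eq_zero (hσ.smooth.differentiable (by simp)) h t 0

/-- At small scales `σ` is affine near `b`, so an affine change before and after it yields almost
the identity on a bounded interval. This neutralises the activation of the hidden layer. -/
theorem HasDerivAt.exists_rescaled_near {b b' : ℝ} (h : HasDerivAt σ b' b) (hb : b' ≠ 0) (Λ : ℝ)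
    {θ : ℝ} (hθ : 0 < θ) :
    ∃ δ > 0, ∀ l, |l| ≤ Λ → |(δ * b')⁻¹ * (σ (b + δ * l) - σ b) - l| ≤ θ := by
  have hb' : 0 < |b'| := abs_pos.2 hb
  have h1 := (hasDerivAt_iff_isLittleO.1 h).def (c := θ * |b'| / (|Λ| + 1)) (by positivity)
  obtain ⟨r, hr, h2⟩ := Metric.eventually_nhds_iff.1 h1
  refine ⟨r / (|Λ| + 1) / 2, by positivity, fun l hl => ?_⟩
  set δ := r / (|Λ| + 1) / 2
  have hδ : 0 < δ := by positivity
  have hlΛ : |l| ≤ |Λ| + 1 := hl.trans ((le_abs_self Λ).trans (by linarith))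
  have hδl : |δ * l| < r := by
    rw [abs_mul, abs_of_pos hδ]
    calc δ * |l| ≤ δ * (|Λ| + 1) := by gcongr
      _ = r / 2 := by simp only [δ]; field_simp
      _ < r := by linarith
  have h3 := h2 (y := b + δ * l) (by simpa [Real.dist_eq] using hδl)
  simp only [add_sub_cancel_left, Real.norm_eq_abs, smul_eq_mul] at h3
  have e1 : (δ * b')⁻¹ * (σ (b + δ * l) - σ b) - l
      = (δ * b')⁻¹ * (σ (b + δ * l) - σ b - δ * l * b') := by
    field_simp
  rw [e1, abs_mul, abs_inv, abs_mul, abs_of_pos hδ, inv_mul_le_iff₀ (by positivity)]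
  refine h3.trans ?_
  rw [abs_mul, abs_of_pos hδ]
  calc θ * |b'| / (|Λ| + 1) * (δ * |l|) ≤ θ * |b'| / (|Λ| + 1) * (δ * (|Λ| + 1)) := by gcongr
    _ = δ * |b'| * θ := by field_simp

theorem append_dotProduct_append {m n : ℕ} (a a' : Fin m → ℝ) (b b' : Fin n → ℝ) :
    Fin.append a b ⬝ᵥ Fin.append a' b' = a ⬝ᵥ a' + b ⬝ᵥ b' := by
  simp [dotProduct, Fin.sum_univ_add]

/-- Sums of ridge functions whose offsets are rescaled activations of the lifting functionals are
computed by neural operators with a single layer. -/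
theorem exists_kernelNeuralOperator_eval_eq {R : Fin n → (Fin (k + d) → ℝ) → ℝ}
    (hR : ∀ l, R l ∈ shallowSpan σ (k + d)) {g : ℝ → ℝ} (hg : g ∈ ridgeSpan σ) (b δ α : ℝ)
    (ξ : Fin n → EuclideanSpace ℝ (Fin d)) (a : Fin n → EuclideanSpace ℝ (Fin k')) :
    ∃ N : KernelNeuralOperator Ω k k', ∀ u : EuclideanSpace ℝ (Fin d) → EuclideanSpace ℝ (Fin k),
      (∀ l, IntegrableOn (fun y => R l (Fin.append (u y).ofLp y.ofLp)) Ω) →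
      N.eval σ u = fun x => ∑ l,
        g (α * (σ (b + δ * ∫ y in Ω, R l (Fin.append (u y).ofLp y.ofLp)) - σ b) + ⟪ξ l, x⟫) •
          a l := by
  obtain ⟨NR, hNR⟩ := exists_neuralNet_eval_eq hR
  obtain ⟨NQ, hNQ⟩ := exists_neuralNet_eval_eq (σ := σ) (m := n + d)
    -- The projection network rescales the `l`-th channel by `α`, adds the linear form given by `ξ
    -- l`, and removes the offset `σ b` through its bias.
    (f := fun (i : Fin k') => ∑ l, (a l i) •
      fun z => g (Fin.append (Pi.single l α) (ξ l).ofLp ⬝ᵥ z + -(α * σ b)))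
    fun i => Submodule.sum_mem _ fun l _ => Submodule.smul_mem _ _
      (comp_dotProduct_add_mem_shallowSpan hg _ _)
  -- With `W = 0` and the kernel `δ` times the identity matrix, the layer output is constant in `x`
  -- and its channels hold the integral functionals passed through `σ`.
  let ℓ : KernelLayer Ω n := ⟨0, fun _ => b, fun _ _ => δ • 1, continuousOn_const⟩
  refine ⟨⟨n, NR, [ℓ], by simp, NQ⟩, fun u hu => ?_⟩
  have hℓ : ∀ x, ℓ.eval σ (fun x => NR.eval σ (Fin.append (u x).ofLp x.ofLp)) x
      = fun l => σ (b + δ * ∫ y in Ω, R l (Fin.append (u y).ofLp y.ofLp)) := by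
    intro x
    have e1 : (fun y => NR.eval σ (Fin.append (u y).ofLp y.ofLp))
        = fun y l => R l (Fin.append (u y).ofLp y.ofLp) := by
      ext y l
      exact hNR _ _
    ext l
    rw [e1]
    simp only [KernelLayer.eval, ℓ, Matrix.zero_mulVec, zero_add, Pi.add_apply, Matrix.smul_mulVec,
      Matrix.one_mulVec]
    rw [integral_smul, Pi.smul_apply, smul_eq_mul, eval_integral fun l => hu l]
  ext x i
  change NQ.eval σ (Fin.append (ℓ.eval σ (fun x => NR.eval σ (Fin.append (u x).ofLp x.ofLp)) x)
    x.ofLp) i = _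
  rw [hℓ, hNQ, Finset.sum_apply, WithLp.ofLp_sum, Finset.sum_apply]
  refine Finset.sum_congr rfl fun l _ => ?_
  simp only [Pi.smul_apply, PiLp.smul_apply, smul_eq_mul]
  rw [mul_comm (a l i), append_dotProduct_append, single_dotProduct]
  congr 2
  have : ⟪ξ l, x⟫ = (ξ l).ofLp ⬝ᵥ x.ofLp := by simp [PiLp.inner_apply, dotProduct, mul_comm]
  rw [this]
  ring

theorem norm_iteratedFDeriv_ridge_le {φ : ℝ → ℝ} (hφ : ContDiff ℝ ∞ φ) (c : ℝ)
    (ξ : EuclideanSpace ℝ (Fin d)) (a : EuclideanSpace ℝ (Fin k)) (n : ℕ)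
    (x : EuclideanSpace ℝ (Fin d)) :
    ‖iteratedFDeriv ℝ n (fun x => φ (c + ⟪ξ, x⟫) • a) x‖
      ≤ |iteratedDeriv n φ (c + ⟪ξ, x⟫)| * (‖ξ‖ ^ n * ‖a‖) := by
  have hφc : ContDiff ℝ ∞ fun τ => φ (c + τ) := hφ.comp (contDiff_const.add contDiff_id)
  have hn : ((n : ℕ) : WithTop ℕ∞) ≤ ∞ := by exact_mod_cast le_top
  have hψ : ContDiff ℝ ∞ fun τ => φ (c + τ) • a := hφc.smul contDiff_const
  have e : (fun x => φ (c + ⟪ξ, x⟫) • a) = (fun τ => φ (c + τ) • a) ∘ innerSL ℝ ξ := rfl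
  rw [e, (innerSL ℝ ξ).iteratedFDeriv_comp_right hψ x hn]
  refine (ContinuousMultilinearMap.norm_compContinuousLinearMap_le _ _).trans_eq ?_
  rw [norm_iteratedFDeriv_eq_norm_iteratedDeriv,
    iteratedDeriv_smul_const (hφc.contDiffAt.of_le hn), iteratedDeriv_comp_const_add, norm_smul]
  simp only [innerSL_apply_apply, innerSL_apply_norm, Finset.prod_const, Finset.card_univ,
    Fintype.card_fin, Real.norm_eq_abs]
  ring

theorem iteratedDeriv_const_smul_exp_add {g : ℝ → ℝ} (hg : ContDiff ℝ ∞ g) (c : ℝ) (n : ℕ) (t : ℝ) :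
    iteratedDeriv n (c • Real.exp + (Real.exp - g)) t
      = c * Real.exp t + iteratedDeriv n (Real.exp - g) t := by
  have hn : ((n : ℕ) : WithTop ℕ∞) ≤ ∞ := by exact_mod_cast le_top
  have h1 : ContDiffAt ℝ n Real.exp t := Real.contDiff_exp.contDiffAt.of_le hn
  have h2 : ContDiffAt ℝ n (c • Real.exp) t := h1.const_smul c
  have h3 : ContDiffAt ℝ n (Real.exp - g) t := h1.sub (hg.contDiffAt.of_le hn)
  rw [iteratedDeriv_add h2 h3, iteratedDeriv_const_smul h1, iteratedDeriv_eq_iterate (f := Real.exp),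
    Real.iter_deriv_exp, smul_eq_mul]

/-- The function `x ↦ exp ⟪ξ, x⟫ • a`. -/
noncomputable def expRidge (ξ : EuclideanSpace ℝ (Fin d)) (a : EuclideanSpace ℝ (Fin k)) :
    SmoothFun d k :=
  ⟨fun x => Real.exp ⟪ξ, x⟫ • a, show ContDiff ℝ ∞ fun x => Real.exp ⟪ξ, x⟫ • a from
    ((contDiff_const.inner ℝ contDiff_id).exp).smul contDiff_const⟩

/-- Exponential sums whose coefficients are exponentials of lifting functionals are approximated by
neural operators with a single layer. -/
theorem exists_kernelNeuralOperator_near_exp_sum (hσ : IsActivation σ) (hΩ : Bornology.IsBounded Ω)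
    (hΩm : MeasurableSet Ω) {s : ℕ} {F : Type*} [NormedAddCommGroup F] [NormedSpace ℝ F]
    (J : SmoothFun d k' →ₗ[ℝ] F) {C : ℝ} (hC : 0 ≤ C)
    (hJ : ∀ (f : SmoothFun d k') (B : ℝ), 0 ≤ B →
      (∀ n ≤ s, ∀ x ∈ Ω, ‖iteratedFDeriv ℝ n f.1 x‖ ≤ B) → ‖J f‖ ≤ C * B)
    {R : Fin n → (Fin (k + d) → ℝ) → ℝ} (hR : ∀ l, R l ∈ shallowSpan σ (k + d))
    (ξ : Fin n → EuclideanSpace ℝ (Fin d)) (a : Fin n → EuclideanSpace ℝ (Fin k')) (Λ : ℝ)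
    {ε : ℝ} (hε : 0 < ε) :
    ∃ N : KernelNeuralOperator Ω k k',
      ∀ u : EuclideanSpace ℝ (Fin d) → EuclideanSpace ℝ (Fin k), IntegrableOn u Ω →
      ∃ f : SmoothFun d k', f.1 = N.eval σ u ∧
      ((∀ l, |∫ y in Ω, R l (Fin.append (u y).ofLp y.ofLp)| ≤ Λ) →
      ‖∑ l, Real.exp (∫ y in Ω, R l (Fin.append (u y).ofLp y.ofLp)) • J (expRidge (ξ l) (a l))
        - J f‖ ≤ ε) := by
  obtain ⟨D, hD⟩ := hΩ.exists_norm_le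
  set B : ℝ := ε / (C + 1)
  have hB : 0 < B := by positivity
  set A : ℝ := ∑ l, (1 + ‖ξ l‖) ^ s * ‖a l‖
  have hA : 0 ≤ A := Finset.sum_nonneg fun l _ => by positivity
  set ε₁ : ℝ := B / (2 * (A + 1))
  have hε₁ : 0 < ε₁ := by positivity
  -- Bounds all arguments of `g` on `Ω`: the rescaled functionals stay below `|Λ| + 1` because `θ ≤
  -- 1`, and the rest bounds the linear forms.
  set M : ℝ := |Λ| + 1 + (∑ l, ‖ξ l‖) * |D|
  obtain ⟨g, hg, hexp⟩ := (exp_mem_ridgeClosure hσ).2 s M ε₁ hε₁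
  have hgs := contDiff_of_mem_ridgeSpan hσ.smooth hg
  obtain ⟨b, hb⟩ := hσ.exists_deriv_ne_zero
  -- The bound `1` permits `|exp r - 1| ≤ 2 |r|`; the second term then makes the perturbation of the
  -- functionals cost at most `ε₁`.
  set θ : ℝ := min 1 (ε₁ / (2 * Real.exp M))
  have hθ : 0 < θ := by positivity
  obtain ⟨δ, hδ, hδΛ⟩ := ((hσ.smooth.differentiable (by simp)) b).hasDerivAt.exists_rescaled_near
    hb Λ hθ
  obtain ⟨N, hNe⟩ := exists_kernelNeuralOperator_eval_eq (Ω := Ω) hR hg b δ (δ * deriv σ b)⁻¹ ξ a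
  have hRi : ∀ u : EuclideanSpace ℝ (Fin d) → EuclideanSpace ℝ (Fin k), IntegrableOn u Ω →
      ∀ l, IntegrableOn (fun y => R l (Fin.append (u y).ofLp y.ofLp)) Ω := fun u hu l =>
    let ⟨_, hL⟩ := exists_lipschitz_of_mem_shallowSpan hσ.lipschitz (hR l)
    integrableOn_comp_append hΩ hΩm hL hu
  refine ⟨N, fun u hu => ?_⟩
  have hN : ContDiff ℝ ∞ (N.eval σ u) := by
    rw [hNe u (hRi u hu)]
    exact ContDiff.sum fun l _ => (hgs.comp (contDiff_const.add
      (contDiff_const.inner ℝ contDiff_id))).smul contDiff_const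
  set f : SmoothFun d k' := ⟨N.eval σ u, hN⟩
  refine ⟨f, rfl, fun hΛ => ?_⟩
  set lam : Fin n → ℝ := fun l => ∫ y in Ω, R l (Fin.append (u y).ofLp y.ofLp)
  set lam' : Fin n → ℝ := fun l => (δ * deriv σ b)⁻¹ * (σ (b + δ * lam l) - σ b)
  have hll : ∀ l, |lam' l - lam l| ≤ θ := fun l => hδΛ _ (hΛ l)
  -- The whole error as a ridge profile in the argument `lam' l + ⟪ξ l, x⟫`. The first summand comes
  -- from replacing `lam` by `lam'`, the second from replacing `exp` by `g`.
  set φ : Fin n → ℝ → ℝ := fun l => (Real.exp (lam l - lam' l) - 1) • Real.exp + (Real.exp - g)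
  have hφ : ∀ l, ContDiff ℝ ∞ (φ l) := fun l =>
    (Real.contDiff_exp.const_smul (Real.exp (lam l - lam' l) - 1)).add (Real.contDiff_exp.sub hgs)
  have e1 : ∑ l, Real.exp (lam l) • J (expRidge (ξ l) (a l)) - J f
      = J (∑ l, Real.exp (lam l) • expRidge (ξ l) (a l) - f) := by
    rw [map_sub, map_sum]
    simp only [map_smul]
  have e2 : (∑ l, Real.exp (lam l) • expRidge (ξ l) (a l) - f :
      SmoothFun d k').1 = fun x => ∑ l, φ l (lam' l + ⟪ξ l, x⟫) • a l := by
    have e3 : (∑ l, Real.exp (lam l) • expRidge (ξ l) (a l) - f :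
      SmoothFun d k').1 = (∑ l, Real.exp (lam l) • (expRidge (ξ l) (a l)).1) - N.eval σ u := by
      simp [f]
    rw [e3, hNe u (hRi u hu)]
    funext x
    rw [Pi.sub_apply, Finset.sum_apply, ← Finset.sum_sub_distrib]
    refine Finset.sum_congr rfl fun l _ => ?_
    have e4 : φ l (lam' l + ⟪ξ l, x⟫)
        = Real.exp (lam l) * Real.exp ⟪ξ l, x⟫ - g (lam' l + ⟪ξ l, x⟫) := by
      simp only [φ, Pi.add_apply, Pi.smul_apply, Pi.sub_apply, smul_eq_mul]
      rw [sub_mul, ← Real.exp_add, ← Real.exp_add]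
      ring_nf
    rw [e4, sub_smul, mul_smul]
    rfl
  rw [e1]
  refine (hJ _ B hB.le fun j hj x hx => ?_).trans ?_
  · rw [e2, iteratedFDeriv_fun_sum_apply (f := fun l x => φ l (lam' l + ⟪ξ l, x⟫) • a l)
      fun l _ => (((hφ l).comp (contDiff_const.add
        (contDiff_const.inner ℝ contDiff_id))).smul contDiff_const).contDiffAt.of_le
          (by exact_mod_cast le_top)]
    have hbound : ∀ l, |iteratedDeriv j (φ l) (lam' l + ⟪ξ l, x⟫)| ≤ 2 * ε₁ := by
      intro l
      have hM : |lam' l + ⟪ξ l, x⟫| ≤ M := by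
        have h1 : |lam' l| ≤ |Λ| + 1 := by
          have h2 := abs_sub_abs_le_abs_sub (lam' l) (lam l)
          have h3 : |lam l| ≤ |Λ| := (hΛ l).trans (le_abs_self _)
          have h4 := (hll l).trans (min_le_left _ _)
          linarith
        have h5 : |⟪ξ l, x⟫| ≤ (∑ l, ‖ξ l‖) * |D| := by
          refine (abs_real_inner_le_norm _ _).trans ?_
          gcongr
          · exact Finset.single_le_sum (fun l _ => norm_nonneg (ξ l)) (Finset.mem_univ l)
          · exact (hD x hx).trans (le_abs_self _)
        exact (abs_add_le _ _).trans (add_le_add h1 h5)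
      set τ := lam' l + ⟪ξ l, x⟫
      have e5 : iteratedDeriv j (φ l) τ = (Real.exp (lam l - lam' l) - 1) * Real.exp τ
          + iteratedDeriv j (Real.exp - g) τ := iteratedDeriv_const_smul_exp_add hgs _ _ _
      rw [e5, two_mul]
      refine (abs_add_le _ _).trans (add_le_add ?_ (hexp j hj τ hM))
      rw [abs_mul, Real.abs_exp]
      have h6 : |lam l - lam' l| ≤ θ := by
        rw [abs_sub_comm]
        exact hll l
      calc _ ≤ 2 * |lam l - lam' l| * Real.exp M := by
            gcongr
            · exact Real.abs_exp_sub_one_le (h6.trans (min_le_left _ _))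
            · exact (le_abs_self _).trans hM
        _ ≤ 2 * (ε₁ / (2 * Real.exp M)) * Real.exp M := by
            gcongr
            exact h6.trans (min_le_right _ _)
        _ = ε₁ := by field_simp
    calc _ ≤ ∑ l, 2 * ε₁ * ((1 + ‖ξ l‖) ^ s * ‖a l‖) := by
          refine (norm_sum_le _ _).trans (Finset.sum_le_sum fun l _ => ?_)
          refine (norm_iteratedFDeriv_ridge_le (hφ l) _ _ _ _ _).trans ?_
          have h7 : ‖ξ l‖ ^ j ≤ (1 + ‖ξ l‖) ^ s :=
            (pow_le_pow_left₀ (norm_nonneg _) (by linarith) j).trans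
              (pow_le_pow_right₀ (by linarith [norm_nonneg (ξ l)]) hj)
          exact mul_le_mul (hbound l) (mul_le_mul_of_nonneg_right h7 (norm_nonneg _))
            (by positivity) (by positivity)
      _ = B * (A / (A + 1)) := by
          rw [← Finset.mul_sum]
          simp only [ε₁]
          field_simp
          rfl
      _ ≤ B * 1 := by
          gcongr
          exact (div_le_one (by linarith)).2 (by linarith)
      _ = B := mul_one B
  · simp only [B]
    rw [← mul_div_assoc]
    exact (div_le_iff₀ (by linarith)).2 (by nlinarith)

end

/-! ### Universality of neural operators -/

section

variable {σ : ℝ → ℝ} {d k k' s : ℕ} {Ω : Set (EuclideanSpace ℝ (Fin d))}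

/-- A cut-off equal to one near the closure gives the compact support needed for approximation by
exponential sums and leaves all derivatives in `Ω` unchanged. -/
theorem SmoothFun.exists_sum_expRidge_near {F : Type*} [NormedAddCommGroup F] [NormedSpace ℝ F]
    (hΩ : Bornology.IsBounded Ω) (J : SmoothFun d k →ₗ[ℝ] F) {C : ℝ} (hC : 0 ≤ C)
    (hJ : ∀ (f : SmoothFun d k) (B : ℝ), 0 ≤ B →
      (∀ n ≤ s, ∀ x ∈ Ω, ‖iteratedFDeriv ℝ n f.1 x‖ ≤ B) → ‖J f‖ ≤ C * B)
    (f : SmoothFun d k) {ε : ℝ} (hε : 0 < ε) :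
    ∃ (n : ℕ) (ξ : Fin n → EuclideanSpace ℝ (Fin d)) (a : Fin n → EuclideanSpace ℝ (Fin k)),
      ‖J f - ∑ i, J (expRidge (ξ i) (a i))‖ ≤ ε := by
  obtain ⟨ψ, hψ, hψc, -, hψ1⟩ := exists_contDiff_cutoff hΩ.isCompact_closure isOpen_univ
    (Set.subset_univ _)
  have hψf : ContDiff ℝ ∞ fun x => ψ x • f.1 x := hψ.smul f.2
  obtain ⟨n, ξ, a, h⟩ := exists_exp_sum_iteratedFDeriv_near (m := s) (f := fun x => ψ x • f.1 x)
    hψc.smul_right (hψf.of_le (by exact_mod_cast le_top)) hΩ.isCompact_closure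
    (show 0 < ε / (C + 1) by positivity)
  refine ⟨n, ξ, a, ?_⟩
  rw [← map_sum, ← map_sub]
  refine (hJ _ (ε / (C + 1)) (by positivity) fun j hj x hx => ?_).trans ?_
  · refine le_of_eq_of_le ?_ (h j hj x (subset_closure hx))
    have e : (f - ∑ i, expRidge (ξ i) (a i) : SmoothFun d k).1 =ᶠ[nhds x]
        (fun x => ψ x • f.1 x) - fun x => ∑ i, Real.exp ⟪ξ i, x⟫ • a i := by
      filter_upwards [hψ1 x (subset_closure hx)] with y hy
      have e1 : (f - ∑ i, expRidge (ξ i) (a i) : SmoothFun d k).1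
          = f.1 - ∑ i, (expRidge (ξ i) (a i)).1 := by simp
      rw [e1, Pi.sub_apply, Pi.sub_apply, Finset.sum_apply, hy, one_smul]
      rfl
    rw [(e.iteratedFDeriv ℝ j).eq_of_nhds]
  · rw [← mul_div_assoc]
    exact (div_le_iff₀ (by linarith)).2 (by nlinarith)

variable {T : Type} [TopologicalSpace T] [CompactSpace T]
  {v : T → EuclideanSpace ℝ (Fin d) → EuclideanSpace ℝ (Fin k)}

/-- The lifting functionals form a vector space of continuous functions on `T`. They separate its
points because they determine bounded functions almost everywhere, so the density of exponentials
applies. -/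
theorem dense_span_exp_integral_comp_append (hσ : IsActivation σ) (hΩ : Bornology.IsBounded Ω)
    (hΩo : IsOpen Ω) (hvi : ∀ t, IntegrableOn (v t) Ω)
    (hvc : ∀ t₀, Filter.Tendsto (fun t => ∫ y in Ω, ‖v t y - v t₀ y‖) (nhds t₀) (nhds 0)) {M : ℝ}
    (hvM : ∀ t, ∀ᵐ x ∂volume.restrict Ω, ‖v t x‖ ≤ M)
    (hvs : ∀ t t', v t =ᵐ[volume.restrict Ω] v t' → t = t') :
    Dense (Submodule.span ℝ {β : C(T, ℝ) | ∃ R ∈ shallowSpan σ (k + d), ∀ t,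
      β t = Real.exp (∫ y in Ω, R (Fin.append (v t y).ofLp y.ofLp))} : Set C(T, ℝ)) := by
  have hΩm := hΩo.measurableSet
  have hlip : ∀ R ∈ shallowSpan σ (k + d), ∃ C, LipschitzWith C R := fun R hR =>
    exists_lipschitz_of_mem_shallowSpan hσ.lipschitz hR
  let V : Submodule ℝ C(T, ℝ) :=
    { carrier := {l | ∃ R ∈ shallowSpan σ (k + d), ∀ t,
        l t = ∫ y in Ω, R (Fin.append (v t y).ofLp y.ofLp)}
      add_mem' := by
        rintro l l' ⟨R, hR, h⟩ ⟨R', hR', h'⟩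
        obtain ⟨C, hC⟩ := hlip R hR
        obtain ⟨C', hC'⟩ := hlip R' hR'
        refine ⟨R + R', Submodule.add_mem _ hR hR', fun t => ?_⟩
        rw [ContinuousMap.add_apply, h, h', ← integral_add
          (integrableOn_comp_append hΩ hΩm hC (hvi t)) (integrableOn_comp_append hΩ hΩm hC' (hvi t))]
        rfl
      zero_mem' := ⟨0, Submodule.zero_mem _, fun t => by simp⟩
      smul_mem' := by
        rintro c l ⟨R, hR, h⟩
        refine ⟨c • R, Submodule.smul_mem _ _ hR, fun t => ?_⟩
        rw [ContinuousMap.smul_apply, h, ← integral_smul]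
        rfl }
  have hV : ∀ t t' : T, t ≠ t' → ∃ l ∈ V, l t ≠ l t' := by
    intro t t' htt
    by_contra! hl
    refine htt (hvs t t' (ae_eq_of_integral_comp_append_eq hσ hΩ hΩo (hvi t) (hvi t') (hvM t)
      (hvM t') fun R hR => ?_))
    obtain ⟨C, hC⟩ := hlip R hR
    exact hl ⟨_, continuous_integral_comp_append hΩ hΩm hvi hvc hC⟩ ⟨R, hR, fun t => rfl⟩
  intro β
  refine Metric.mem_closure_iff.2 fun ε hε => ?_
  obtain ⟨n, c, l, hl, h⟩ := exists_exp_sum_near V hV β isCompact_univ (half_pos hε)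
  refine ⟨∑ i, c i • ⟨fun t => Real.exp (l i t), by fun_prop⟩, Submodule.sum_mem _ fun i _ =>
    Submodule.smul_mem _ _ (Submodule.subset_span ?_), ?_⟩
  · obtain ⟨R, hR, hlR⟩ := hl i
    exact ⟨R, hR, fun t => congrArg Real.exp (hlR t)⟩
  · refine lt_of_le_of_lt ?_ (half_lt_self hε)
    rw [dist_comm, dist_eq_norm]
    refine (ContinuousMap.norm_le _ (half_pos hε).le).2 fun t => ?_
    rw [ContinuousMap.sub_apply, ContinuousMap.sum_apply]
    exact h t (Set.mem_univ t)

/-- Neural operators approximate continuous maps from a compact space of bounded functions to a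
normed space in which smooth functions are dense. -/
theorem exists_kernelNeuralOperator_near [T2Space T] (hσ : IsActivation σ) (hΩ : Bornology.IsBounded Ω)
    (hΩo : IsOpen Ω) (hvi : ∀ t, IntegrableOn (v t) Ω)
    (hvc : ∀ t₀, Filter.Tendsto (fun t => ∫ y in Ω, ‖v t y - v t₀ y‖) (nhds t₀) (nhds 0)) {M : ℝ}
    (hvM : ∀ t, ∀ᵐ x ∂volume.restrict Ω, ‖v t x‖ ≤ M)
    (hvs : ∀ t t', v t =ᵐ[volume.restrict Ω] v t' → t = t')
    {F : Type*} [NormedAddCommGroup F] [NormedSpace ℝ F]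
    (J : SmoothFun d k' →ₗ[ℝ] F) {C : ℝ} (hC : 0 ≤ C)
    (hJ : ∀ (f : SmoothFun d k') (B : ℝ), 0 ≤ B →
      (∀ n ≤ s, ∀ x ∈ Ω, ‖iteratedFDeriv ℝ n f.1 x‖ ≤ B) → ‖J f‖ ≤ C * B)
    (hJd : DenseRange J) {G : T → F} (hG : Continuous G) {ε : ℝ} (hε : 0 < ε) :
    ∃ N : KernelNeuralOperator Ω k k',
      ∀ u : EuclideanSpace ℝ (Fin d) → EuclideanSpace ℝ (Fin k), IntegrableOn u Ω →
      ∃ f : SmoothFun d k', f.1 = N.eval σ u ∧ ∀ t, v t = u → ‖G t - J f‖ ≤ ε := by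
  have hΩm := hΩo.measurableSet
  set D : Set F := Set.range fun q : EuclideanSpace ℝ (Fin d) × EuclideanSpace ℝ (Fin k') =>
    J (expRidge q.1 q.2)
  have hD : Dense (Submodule.span ℝ D : Set F) := by
    intro y
    refine Metric.mem_closure_iff.2 fun ε hε => ?_
    obtain ⟨f, hf⟩ := hJd.exists_dist_lt y (half_pos hε)
    obtain ⟨n, ξ, a, h⟩ := SmoothFun.exists_sum_expRidge_near hΩ J hC hJ f (half_pos hε)
    refine ⟨∑ i, J (expRidge (ξ i) (a i)), Submodule.sum_mem _ fun i _ =>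
      Submodule.subset_span ⟨(ξ i, a i), rfl⟩, ?_⟩
    rw [← dist_eq_norm] at h
    calc _ ≤ _ := dist_triangle _ (J f) _
      _ < ε / 2 + ε / 2 := add_lt_add_of_lt_of_le hf h
      _ = ε := add_halves ε
  obtain ⟨g, hg, hGg⟩ := Metric.mem_closure_iff.1 (dense_span_smul
    (dense_span_exp_integral_comp_append hσ hΩ hΩo hvi hvc hvM hvs) hD ⟨G, hG⟩) (ε / 2)
    (half_pos hε)
  obtain ⟨n, c, h, hch⟩ := Submodule.mem_span_set'.1 hg
  choose β hβ η hη hh using fun l => (h l).2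
  choose R hR hβR using hβ
  choose q hq using hη
  -- Compactness of `T` bounds the functionals, which fixes the interval on which the hidden
  -- activation has to be undone.
  obtain ⟨Λ, hΛ⟩ : ∃ Λ : ℝ, ∀ l t, |∫ y in Ω, R l (Fin.append (v t y).ofLp y.ofLp)| ≤ Λ := by
    choose L hL using fun l => exists_lipschitz_of_mem_shallowSpan hσ.lipschitz (hR l)
    choose Λ hΛ using fun l => isCompact_univ.exists_bound_of_continuousOn
      (continuous_integral_comp_append hΩ hΩm hvi hvc (hL l)).continuousOn
    exact ⟨∑ l, |Λ l|, fun l t => (hΛ l t (Set.mem_univ t)).trans ((le_abs_self _).trans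
      (Finset.single_le_sum (fun l _ => abs_nonneg (Λ l)) (Finset.mem_univ l)))⟩
  obtain ⟨N, hN⟩ := exists_kernelNeuralOperator_near_exp_sum hσ hΩ hΩm J hC hJ hR
    (fun l => (q l).1) (fun l => c l • (q l).2) Λ (half_pos hε)
  refine ⟨N, fun u hu => ?_⟩
  obtain ⟨f, hf, hfN⟩ := hN u hu
  refine ⟨f, hf, ?_⟩
  rintro t rfl
  -- The scalar `c l` of the span is absorbed into the vector of the exponential, which depends on
  -- it linearly.
  have e1 : ∑ l, Real.exp (∫ y in Ω, R l (Fin.append (v t y).ofLp y.ofLp)) •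
      J (expRidge (q l).1 (c l • (q l).2)) = g t := by
    rw [← hch, ContinuousMap.sum_apply]
    refine Finset.sum_congr rfl fun l _ => ?_
    have e2 : expRidge (q l).1 (c l • (q l).2) = c l • expRidge (q l).1 (q l).2 := by
      refine Subtype.ext (funext fun x => ?_)
      exact smul_comm _ _ _
    rw [e2, map_smul, ContinuousMap.smul_apply, hh, hβR, ← hq, smul_comm]
  have h1 := hfN fun l => hΛ l t
  rw [e1] at h1
  have h2 : ‖G t - g t‖ ≤ ε / 2 := by
    rw [← dist_eq_norm]
    exact (ContinuousMap.dist_apply_le_dist (f := ⟨G, hG⟩) (g := g) t).trans hGg.le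
  calc _ ≤ _ := norm_sub_le_norm_sub_add_norm_sub _ (g t) _
    _ ≤ ε / 2 + ε / 2 := add_le_add h2 h1
    _ = ε := add_halves ε

end

/-! ### The two settings -/

section

variable {d k s : ℕ} {Ω : Set (EuclideanSpace ℝ (Fin d))} {p : ENNReal}

theorem norm_toCSpace_le (hΩ : Bornology.IsBounded Ω) (f : SmoothFun d k) {B : ℝ} (hB : 0 ≤ B)
    (h : ∀ n ≤ s, ∀ x ∈ Ω, ‖iteratedFDeriv ℝ n f.1 x‖ ≤ B) : ‖toCSpace hΩ s f‖ ≤ B :=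
  CSpace.norm_le _ hB fun n x hx => h n (Nat.lt_succ_iff.1 n.2) x hx

theorem exists_norm_toWSpace_le [Fact (1 ≤ p)] (hΩ : Bornology.IsBounded Ω)
    (hΩm : MeasurableSet Ω) :
    ∃ C : ℝ, 0 ≤ C ∧ ∀ (f : SmoothFun d k) (B : ℝ), 0 ≤ B →
      (∀ n ≤ s, ∀ x ∈ Ω, ‖iteratedFDeriv ℝ n f.1 x‖ ≤ B) → ‖toWSpace hΩ s p f‖ ≤ C * B := by
  have := isFiniteMeasure_restrict_of_isBounded hΩ
  refine ⟨(volume.restrict Ω).real Set.univ ^ (p.toReal)⁻¹, by positivity, fun f B hB h => ?_⟩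
  refine (pi_norm_le_iff_of_nonneg (by positivity)).2 fun n => ?_
  refine Lp.norm_le_of_ae_bound hB ?_
  filter_upwards [coeFn_toWSpace (s := s) (p := p) hΩ f n, ae_restrict_mem hΩm] with x h1 h2
  exact (congrArg norm h1).trans_le (h n (Nat.lt_succ_iff.1 n.2) x h2)

theorem CSpace.integrableOn_toFun (hΩ : Bornology.IsBounded Ω) (u : CSpace Ω s k) :
    IntegrableOn u.toFun Ω :=
  (u.continuousOn_toFun.integrableOn_compact hΩ.isCompact_closure).mono_set subset_closure

theorem CSpace.tendsto_integral_norm_toFun_sub (hΩ : Bornology.IsBounded Ω) (u₀ : CSpace Ω s k) :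
    Filter.Tendsto (fun u : CSpace Ω s k => ∫ y in Ω, ‖u.toFun y - u₀.toFun y‖) (nhds u₀)
      (nhds 0) := by
  have := isFiniteMeasure_restrict_of_isBounded hΩ
  have hlim : Filter.Tendsto (fun u : CSpace Ω s k => ‖u - u₀‖) (nhds u₀) (nhds 0) :=
    tendsto_iff_norm_sub_tendsto_zero.1 Filter.tendsto_id
  refine squeeze_zero (fun u => integral_nonneg fun y => norm_nonneg _) (fun u => ?_)
    (by simpa only [zero_mul] using hlim.mul_const ((volume.restrict Ω).real Set.univ))
  refine (Real.le_norm_self _).trans (norm_integral_le_of_norm_le_const (μ := volume.restrict Ω)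
    (.of_forall fun y => ?_))
  rw [norm_norm, ← Pi.sub_apply, ← CSpace.toFun_sub]
  exact (u - u₀).norm_toFun_le y

theorem WSpace.tendsto_integral_norm_toFun_sub [Fact (1 ≤ p)] (hΩ : Bornology.IsBounded Ω)
    (u₀ : WSpace Ω s p k) :
    Filter.Tendsto (fun u : WSpace Ω s p k => ∫ y in Ω, ‖u.toFun y - u₀.toFun y‖) (nhds u₀)
      (nhds 0) := by
  obtain ⟨C, hC, h⟩ := exists_integral_norm_le_norm_Lp (p := p)
    (F := EuclideanSpace ℝ (Fin d) [×((0 : Fin (s + 1)) : ℕ)]→L[ℝ] EuclideanSpace ℝ (Fin k)) hΩ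
  have key : ∀ g g' : LpJet Ω p k ((0 : Fin (s + 1)) : ℕ),
      ∫ y in Ω, ‖g y 0 - g' y 0‖ ≤ C * ‖g - g'‖ := by
    intro g g'
    refine le_trans (integral_mono_of_nonneg (.of_forall fun y => norm_nonneg _) (h (g - g')).1.norm
      ?_) (h (g - g')).2
    have : IsEmpty (Fin ((0 : Fin (s + 1)) : ℕ)) := inferInstanceAs (IsEmpty (Fin 0))
    filter_upwards [Lp.coeFn_sub g g'] with y hy
    rw [hy, Pi.sub_apply]
    exact ((g y - g' y).le_opNorm 0).trans_eq
      (by rw [Finset.prod_of_isEmpty, mul_one])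
  have hlim : Filter.Tendsto (fun u : WSpace Ω s p k => ‖u - u₀‖) (nhds u₀) (nhds 0) :=
    tendsto_iff_norm_sub_tendsto_zero.1 Filter.tendsto_id
  refine squeeze_zero (fun u => integral_nonneg fun y => norm_nonneg _) (fun u => ?_)
    (by simpa using hlim.const_mul C)
  refine (key (u.1 0) (u₀.1 0)).trans (mul_le_mul_of_nonneg_left ?_ hC)
  exact norm_le_pi_norm (u - u₀).1 0

end

/-! ### The universality theorem. -/

theorem corollary1 (σ : ℝ → ℝ) (hσ : IsActivation σ) (d k k' : ℕ)
    (Ω : Set (EuclideanSpace ℝ (Fin d))) (hΩ : IsBoundedLipschitzDomain Ω) (s s' : ℕ) :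
    (∀ G : CSpace Ω s k → CSpace Ω s' k', Continuous G →
      ∀ K : Set (CSpace Ω s k), IsCompact K → ∀ ε : ℝ, 0 < ε →
        ∃ (N : KernelNeuralOperator Ω k k') (Ψ : CSpace Ω s k → CSpace Ω s' k'),
          (∀ u, ∀ x ∈ closure Ω, (Ψ u).toFun x = N.eval σ u.toFun x) ∧
          ∀ u ∈ K, ‖G u - Ψ u‖ ≤ ε) ∧
    (∀ (p p' : ENNReal) [Fact (1 ≤ p)] [Fact (1 ≤ p')], p ≠ ⊤ → p' ≠ ⊤ →
      ∀ G : WSpace Ω s p k → WSpace Ω s' p' k', Continuous G →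
      ∀ K : Set (WSpace Ω s p k), IsCompact K →
        (∃ M : ℝ, ∀ u ∈ K, ∀ᵐ x ∂volume.restrict Ω, ‖u.toFun x‖ ≤ M) → ∀ ε : ℝ, 0 < ε →
        ∃ (N : KernelNeuralOperator Ω k k') (Ψ : WSpace Ω s p k → WSpace Ω s' p' k'),
          (∀ u, (Ψ u).toFun =ᵐ[volume.restrict Ω] N.eval σ u.toFun) ∧
          ∀ u ∈ K, ‖G u - Ψ u‖ ≤ ε) := by
  have hΩb := hΩ.isBounded
  have hΩo := hΩ.isOpen
  refine ⟨fun G hG K hK ε hε => ?_, fun p p' _ _ _ hp' G hG K hK ⟨M, hM⟩ ε hε => ?_⟩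
  · have := isCompact_iff_compactSpace.1 hK
    obtain ⟨M, hM⟩ := hK.isBounded.exists_norm_le
    obtain ⟨N, hN⟩ := exists_kernelNeuralOperator_near (s := s') (T := K) (v := fun u => u.1.toFun)
      hσ hΩb hΩo (fun u => u.1.integrableOn_toFun hΩb)
      (fun u => (CSpace.tendsto_integral_norm_toFun_sub hΩb u.1).comp
        continuous_subtype_val.continuousAt)
      (fun u => .of_forall fun x => (u.1.norm_toFun_le x).trans (hM _ u.2))
      -- Continuous functions that agree almost everywhere on an open set agree there, and the
      -- function on `Ω` determines the jet.
      (fun u u' h => Subtype.ext (CSpace.ext_of_eqOn hΩo _ _ (Measure.eqOn_open_of_ae_eq h hΩo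
        (u.1.continuousOn_toFun.mono subset_closure) (u'.1.continuousOn_toFun.mono subset_closure))))
      (toCSpace hΩb s') zero_le_one
      (fun f B hB h => (norm_toCSpace_le hΩb f hB h).trans_eq (one_mul B).symm)
      (denseRange_toCSpace hΩ) (hG.comp continuous_subtype_val) hε
    -- The operator yields a smooth function for every integrable input, hence a map on the whole
    -- space; only the error bound is confined to `K`.
    choose f hf hfN using fun u : CSpace Ω s k => hN u.toFun (u.integrableOn_toFun hΩb)
    exact ⟨N, fun u => toCSpace hΩb s' (f u),
      fun u x hx => (toFun_toCSpace hΩb (f u) hx).trans (congrFun (hf u) x),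
      fun u hu => hfN u ⟨u, hu⟩ rfl⟩
  · have := isCompact_iff_compactSpace.1 hK
    obtain ⟨C, hC, hCW⟩ := exists_norm_toWSpace_le (k := k') (s := s') (p := p') hΩb
      hΩo.measurableSet
    obtain ⟨N, hN⟩ := exists_kernelNeuralOperator_near (s := s') (T := K) (v := fun u => u.1.toFun)
      hσ hΩb hΩo (fun u => u.1.integrableOn_toFun hΩb)
      (fun u => (WSpace.tendsto_integral_norm_toFun_sub hΩb u.1).comp
        continuous_subtype_val.continuousAt)
      (fun u => hM _ u.2) (fun u u' h => Subtype.ext (WSpace.ext_of_ae_eq hΩo _ _ h))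
      (toWSpace hΩb s' p') hC hCW (denseRange_toWSpace hp' hΩ) (hG.comp continuous_subtype_val) hε
    choose f hf hfN using fun u : WSpace Ω s p k => hN u.toFun (u.integrableOn_toFun hΩb)
    refine ⟨N, fun u => toWSpace hΩb s' p' (f u), fun u => ?_, fun u hu => hfN u ⟨u, hu⟩ rfl⟩
    rw [← hf u]
    exact toFun_toWSpace hΩb (f u)
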